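/- **Theorem (Guaranteed estimate distinguishing error components, nonlinear Darcy).** Let $d\ge 1$ and let $\Omega\subset\mathbb R^d$ be an open bounded connected polytope with $\Omega=\operatorname{int}\overline\Omega$ (e.g. with Lipschitz boundary), of diameter $h_\Omega$; $\|\cdot\|$ and $(\cdot,\cdot)$ are the $L^2(\Omega)$ norm and product, a subscript $K$ restricts them to $K$, and $|\cdot|$ is the measure of a set or the Euclidean norm. Let $\mathbf K,\tilde{\mathbf K}$ be functions of $r\ge 0$ with symmetric $d\times d$ matrix values such that $\mathbf v=-\mathbf K(|\mathbf w|)\mathbf w\iff\mathbf w=-\tilde{\mathbf K}(|\mathbf v|)\mathbf v$ and, for two positive constants $c,L$ and all $\mathbf v,\mathbf w\in\mathbb R^d$, $$c|\mathbf v-\mathbf w|^2\le(\mathbf v-\mathbf w)\cdot(\tilde{\mathbf K}(|\mathbf v|)\mathbf v-\tilde{\mathbf K}(|\mathbf w|)\mathbf w),\quad |\tilde{\mathbf K}(|\mathbf v|)\mathbf v-\tilde{\mathbf K}(|\mathbf w|)\mathbf w|\le L|\mathbf v-\mathbf w|,$$ $$c|\mathbf v|^2\le\mathbf v\cdot\tilde{\mathbf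 K}(|\mathbf w|)\mathbf v,\quad |\tilde{\mathbf K}(|\mathbf w|)\mathbf v|\le L|\mathbf v|.$$ *Mesh.* Let $\mathcal T_H$ be a polytopal mesh of $\Omega$ whose cells $K$ (with connected interiors) are unions of simplices, forming sets $\mathcal T_K$, of a conforming simplicial mesh $\mathcal T_h=\bigcup_K\mathcal T_K$ of $\overline\Omega$. Let $\mathcal F_K$ be the set of the flat polytopal faces of $K$, each a union of simplicial faces; $\mathcal F_K^{\rm ext}$, $\mathcal F_K^{\rm int}$ are the sets of the simplicial faces on $\partial K$ and inside $K$, and $\mathcal V_K$ is the set of the vertices of $\mathcal T_K$. Each face $\sigma$ has a fixed unit normal $\mathbf n_\sigma$ (exterior on $\partial\Omega$), and $\mathbf n_K$ is the exterior unit normal of $K$. Let $f$ be constant on each $K$, $\mathsf F_K=(f,1)_K$, let $p\in H^1_0(\Omega)$ satisfy $(\mathbf K(|\nabla p|)\nabla p,\nabla v)=(f,v)$ for all $v\in H^1_0(\Omega)$, and let $\mathbf u=-\mathbf K(|\nabla p|)\nabla p$. *Scheme.* Let $\mathsf P\mapsto\mathsf U(\mathsf P)$ be any map from cell values to values on the polytopal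 faces (the nonlinear face normal fluxes, along $\mathbf n_\sigma$, of a locally conservative scheme $\sum_{\sigma\in\mathcal F_K}\mathsf U(\mathsf P)_\sigma\,\mathbf n_K\cdot\mathbf n_\sigma=\mathsf F_K$ for all $K$). On linearization step $k\ge1$, let $\mathsf U^{k-1}$ be any affine map of the same type (the linearized fluxes), and let $\mathsf P^{k,i}$, $i\ge1$, be the iterates of any algebraic solver. Put $\mathsf R_K^{k,i}=\mathsf F_K-\sum_{\sigma\in\mathcal F_K}\mathsf U^{k-1}(\mathsf P^{k,i})_\sigma\,\mathbf n_K\cdot\mathbf n_\sigma$. Fix $k,i,j\ge 1$ and set $$\mathsf U^{k,i}=\mathsf U(\mathsf P^{k,i}),\quad \mathsf U_{\rm lin}^{k,i}=\mathsf U^{k-1}(\mathsf P^{k,i})-\mathsf U(\mathsf P^{k,i}),\quad \mathsf U_{\rm alg}^{k,i}=\mathsf U^{k-1}(\mathsf P^{k,i+j})-\mathsf U^{k-1}(\mathsf P^{k,i}).$$ A flux on a polytopal face is distributed to its simplicial subfaces proportionally to their areas. For $\bullet$ empty, lin or alg, $\mathsf U_{\bullet,K}^{k,i}\in\mathbb R^{\mathcal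 F_K^{\rm ext}}$ collects the resulting fluxes on the faces of $\mathcal F_K^{\rm ext}$, oriented out of $K$. *Potential point values.* Let $\mathsf Z_a=0$ at mesh vertices $a\in\partial\Omega$. At the other vertices let either $\mathsf Z_a$ be the mean of $\mathsf P_K^{k,i}$ over the cells $K$ sharing $a$; or, for given values $\Lambda_\sigma$ on the polytopal faces (e.g. Lagrange multipliers of the scheme), let $\mathsf Z_a=\mathsf P^{k,i}_K$ if $a$ is inside the cell $K$ and let $\mathsf Z_a$ be the mean of $\Lambda_\sigma$ over the polytopal faces sharing $a$ otherwise. Let $\mathsf Z_K=(\mathsf Z_a)_{a\in\mathcal V_K}$ and let $\mathsf Z_K^{\rm ext}$ be the vector of the means of $\mathsf Z$ over the $d$ vertices of $\sigma$, for $\sigma\in\mathcal F_K^{\rm ext}$. *Element matrices.* Let $\mathbf v_\sigma$ be the basis functions of $\mathbf{RT}_0(\mathcal T_K)\cap\mathbf H({\rm div},K)$ (lowest-order Raviart–Thomas) with unit normal flux over $\sigma$ (out of $K$ for $\sigma\in\mathcal F_K^{\rm ext}$, along $\mathbf n_\sigma$ for $\sigma\in\mathcal F_K^{\rm int}$) and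 zero flux over the other faces. Let $(q_l)$ be any basis of the functions that are piecewise constant on $\mathcal T_K$ with mean zero on $K$. With $\alpha=c^{-1}L^2$, let $A^{\star,\circ}$ have the entries $\alpha(\mathbf v_{\sigma'},\mathbf v_\sigma)_K$, $\sigma\in\mathcal F_K^\star$, $\sigma'\in\mathcal F_K^\circ$, and $B^{\circ}$ the entries $-(\nabla\cdot\mathbf v_{\sigma'},q_l)_K$, for $\star,\circ\in\{{\rm int},{\rm ext}\}$, and let $$\widehat A_K=A^{\rm ext,ext}-\begin{pmatrix}A^{\rm int,ext}\\B^{\rm ext}\end{pmatrix}^{t}\begin{pmatrix}A^{\rm int,int}&(B^{\rm int})^t\\B^{\rm int}&0\end{pmatrix}^{-1}\begin{pmatrix}A^{\rm int,ext}\\B^{\rm ext}\end{pmatrix}.$$ With the hat functions $\psi_a$ let $(\widehat S_K)_{a,a'}=c^{-2}L(\nabla\psi_{a'},\nabla\psi_a)_K$ and $(\widehat M_K)_{a,a'}=(\psi_{a'},\psi_a)_K$, $a,a'\in\mathcal V_K$. *Flux reconstruction.* On each $K$, let $\mathbf u_h^{k,i}|_K$ minimise $\|\mathbf v_h\|_K$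 over all $\mathbf v_h\in\mathbf{RT}_0(\mathcal T_K)\cap\mathbf H({\rm div},K)$ with constant divergence on $K$ whose normal fluxes over the faces of $\mathcal F_K^{\rm ext}$ are those given by $\mathsf U^{k,i}$. *Claim.* Let $C_F$ be the smallest constant such that $\|v\|\le C_Fh_\Omega\|\nabla v\|$ for all $v\in H_0^1(\Omega)$. Then $\mathbf u_h^{k,i}$ exists, is unique, and belongs to $\mathbf{RT}_0(\mathcal T_h)\cap\mathbf H({\rm div},\Omega)$, and $$c^{1/2}\|\mathbf u-\mathbf u_h^{k,i}\|\le\eta_{\rm sp}+\eta_{\rm lin}+\eta_{\rm alg}+\eta_{\rm rem},\qquad \eta_\bullet=\Big\{\sum_{K\in\mathcal T_H}\eta_{\bullet,K}^2\Big\}^{1/2},$$ where the following right-hand sides for sp, lin, alg are nonnegative: $$\eta_{{\rm sp},K}^2=(\mathsf U_K^{k,i})^t\widehat A_K\mathsf U_K^{k,i}+\mathsf Z_K^t\widehat S_K\mathsf Z_K+2c^{-1}L\Big[(\mathsf U_K^{k,i})^t\mathsf Z_K^{\rm ext}-\Big(\sum_{\sigma\in\mathcal F_K}\mathsf U^{k,i}_\sigma\,\mathbf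 n_K\cdot\mathbf n_\sigma\Big)|K|^{-1}\,\mathsf 1^t\widehat M_K\mathsf Z_K\Big],$$ $$\eta_{{\rm lin},K}^2=(\mathsf U_{{\rm lin},K}^{k,i})^t\widehat A_K\mathsf U_{{\rm lin},K}^{k,i},\qquad \eta_{{\rm alg},K}^2=(\mathsf U_{{\rm alg},K}^{k,i})^t\widehat A_K\mathsf U_{{\rm alg},K}^{k,i},$$ $$\eta_{{\rm rem},K}=c^{-1/2}L\,C_F\,h_\Omega\,|K|^{-1/2}\,|\mathsf R_K^{k,i+j}|.$$ -/

import Mathlib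

open MeasureTheory Filter Topology
open scoped ContDiff Matrix

noncomputable section

namespace NonlinearDarcy

/-- The Euclidean space `ℝᵈ`. -/
abbrev Euc (d : ℕ) : Type := EuclideanSpace ℝ (Fin d)

/-! ### Sobolev spaces -/

section Sobolev

variable {d : ℕ}

/-- The `L²(s)`-norm of a scalar- or vector-valued function. -/
def l2norm {G : Type*} [NormedAddCommGroup G] (s : Set (Euc d)) (v : Euc d → G) : ℝ :=
  Real.sqrt (∫ x in s, ‖v x‖ ^ 2)

/-- The space `𝒟(Ω)` of smooth functions with compact support in `Ω`. -/
def IsTestFunction (Ω : Set (Euc d)) (φ : Euc d → ℝ) : Prop :=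
  ContDiff ℝ ∞ φ ∧ HasCompactSupport φ ∧ tsupport φ ⊆ Ω

/-- `v ∈ H¹(Ω)` with weak gradient `g`. -/
def HasWeakGradient (Ω : Set (Euc d)) (v : Euc d → ℝ) (g : Euc d → Euc d) : Prop :=
  MemLp v 2 (volume.restrict Ω) ∧ MemLp g 2 (volume.restrict Ω) ∧
    ∀ φ : Euc d → ℝ, IsTestFunction Ω φ → ∀ i : Fin d,
      ∫ x in Ω, v x * (gradient φ x) i = -∫ x in Ω, (g x) i * φ x

/-- `v ∈ H(div, Ω)` with weak divergence `w`. -/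
def HasWeakDivergence (Ω : Set (Euc d)) (v : Euc d → Euc d) (w : Euc d → ℝ) : Prop :=
  MemLp v 2 (volume.restrict Ω) ∧ MemLp w 2 (volume.restrict Ω) ∧
    ∀ φ : Euc d → ℝ, IsTestFunction Ω φ →
      ∫ x in Ω, inner ℝ (v x) (gradient φ x) = -∫ x in Ω, w x * φ x

/-- `v ∈ H¹₀(Ω)` with weak gradient `g`: `H¹₀(Ω)` is the closure of `𝒟(Ω)` in `H¹(Ω)`. -/
def MemH10 (Ω : Set (Euc d)) (v : Euc d → ℝ) (g : Euc d → Euc d) : Prop :=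
  HasWeakGradient Ω v g ∧
    ∃ φ : ℕ → Euc d → ℝ, (∀ n, IsTestFunction Ω (φ n)) ∧
      Tendsto (fun n => eLpNorm (fun x => φ n x - v x) 2 (volume.restrict Ω)) atTop (𝓝 0) ∧
      Tendsto (fun n => eLpNorm (fun x => gradient (φ n) x - g x) 2 (volume.restrict Ω))
        atTop (𝓝 0)

/-- The constant `C_F` of the Friedrichs inequality `‖v‖ ≤ C_F h_Ω ‖∇v‖` on `H¹₀(Ω)`,
with `h_Ω` the diameter of `Ω`: the smallest admissible one. -/
def friedrichsConstant (Ω : Set (Euc d)) : ℝ :=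
  sInf {c : ℝ | 0 ≤ c ∧ ∀ v g, MemH10 Ω v g →
    l2norm Ω v ≤ c * Metric.diam Ω * l2norm Ω g}

/-- The classical divergence of a vector field. -/
def divergence (v : Euc d → Euc d) (x : Euc d) : ℝ :=
  LinearMap.trace ℝ (Euc d) (fderiv ℝ v x : Euc d →ₗ[ℝ] Euc d)

end Sobolev

/-! ### The nonlinear Darcy problem -/

/-- The assumptions on the tensor-valued functions `𝐊` (here `D`) and its inverse law `𝐊̃`
(here `E`), with monotonicity constant `c` and Lipschitz constant `L`. -/
structure IsAdmissibleLaw {d : ℕ} (D E : ℝ → Euc d →L[ℝ] Euc d) (c L : ℝ) : Prop where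
  c_pos : 0 < c
  L_pos : 0 < L
  inverse : ∀ v w : Euc d, v = -(D ‖w‖ w) ↔ w = -(E ‖v‖ v)
  strongly_monotone : ∀ v w : Euc d,
    c * ‖v - w‖ ^ 2 ≤ inner ℝ (v - w) (E ‖v‖ v - E ‖w‖ w)
  lipschitz : ∀ v w : Euc d, ‖E ‖v‖ v - E ‖w‖ w‖ ≤ L * ‖v - w‖
  symm_D : ∀ w a b : Euc d, inner ℝ (D ‖w‖ a) b = inner ℝ a (D ‖w‖ b)
  symm_E : ∀ w a b : Euc d, inner ℝ (E ‖w‖ a) b = inner ℝ a (E ‖w‖ b)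
  eig_lower : ∀ v w : Euc d, c * ‖v‖ ^ 2 ≤ inner ℝ v (E ‖w‖ v)
  eig_upper : ∀ v w : Euc d, ‖E ‖w‖ v‖ ≤ L * ‖v‖

/-- `p ∈ H¹₀(Ω)`, with weak gradient `gp`, is the weak solution of
`-div(D(|∇p|)∇p) = f` in `Ω`, `p = 0` on `∂Ω`. -/
def IsWeakSolution {d : ℕ} (Ω : Set (Euc d)) (D : ℝ → Euc d →L[ℝ] Euc d) (f : Euc d → ℝ)
    (p : Euc d → ℝ) (gp : Euc d → Euc d) : Prop :=
  MemH10 Ω p gp ∧ ∀ v g, MemH10 Ω v g →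
    ∫ x in Ω, inner ℝ (D ‖gp x‖ (gp x)) (g x) = ∫ x in Ω, f x * v x

/-- The flux (Darcy velocity) `𝐮 = -D(|∇p|)∇p`. -/
def darcyFlux {d : ℕ} (D : ℝ → Euc d →L[ℝ] Euc d) (gp : Euc d → Euc d) : Euc d → Euc d :=
  fun x => -(D ‖gp x‖ (gp x))

/-! ### Simplicial meshes -/

/-- A conforming simplicial mesh of `Ω` with simplices `T`, `(d-1)`-dimensional faces `S` and
vertices `V`. A nondegenerate simplex is given by its `d + 1` affinely independent vertices;
`side κ i` is the face of `κ` opposite to its `i`-th vertex. -/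
structure SimplicialMesh (d : ℕ) (Ω : Set (Euc d)) (T S V : Type*) where
  node : V → Euc d
  node_injective : Function.Injective node
  vert : T → Fin (d + 1) → V
  vert_surjective : ∀ a, ∃ κ i, vert κ i = a
  simplex : T → AffineBasis (Fin (d + 1)) ℝ (Euc d)
  simplex_apply : ∀ κ i, simplex κ i = node (vert κ i)
  side : T → Fin (d + 1) → S
  side_surjective : ∀ σ, ∃ κ i, side κ i = σ
  side_eq_iff : ∀ κ i κ' i', side κ i = side κ' i' ↔ vert κ '' {i}ᶜ = vert κ' '' {i'}ᶜ
  cover : ⋃ κ, convexHull ℝ (Set.range (simplex κ)) = closure Ω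
  /-- Different simplices meet along an entire common face of dimension at most `d - 1`, or
  not at all. -/
  conforming : ∀ κ κ', κ ≠ κ' → Set.range (simplex κ) ≠ Set.range (simplex κ') ∧
    convexHull ℝ (Set.range (simplex κ)) ∩ convexHull ℝ (Set.range (simplex κ')) =
      convexHull ℝ (Set.range (simplex κ) ∩ Set.range (simplex κ'))

namespace SimplicialMesh

variable {d : ℕ} {Ω : Set (Euc d)} {T S V : Type*} (M : SimplicialMesh d Ω T S V)

/-- The closed simplex `κ`. -/
def hull (κ : T) : Set (Euc d) := convexHull ℝ (Set.range (M.simplex κ))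

/-- The volume `|κ|`. -/
def vol (κ : T) : ℝ := volume.real (M.hull κ)

/-- The (constant) gradient of the `i`-th barycentric coordinate of `κ`. -/
def gradCoord (κ : T) (i : Fin (d + 1)) : Euc d :=
  gradient (fun x => (M.simplex κ).coord i x) 0

/-- The exterior unit normal of `κ` on its `i`-th side; the `i`-th barycentric coordinate vanishes
on that side and is positive in `κ`. -/
def outNormal (κ : T) (i : Fin (d + 1)) : Euc d :=
  -(‖M.gradCoord κ i‖⁻¹ • M.gradCoord κ i)

/-- The set of the vertices of a face. -/
def faceVertices (σ : S) : Set V := {a | ∃ κ i j, M.side κ i = σ ∧ j ≠ i ∧ M.vert κ j = a}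

/-- The closed face `σ`. -/
def faceHull (σ : S) : Set (Euc d) := convexHull ℝ (M.node '' M.faceVertices σ)

/-- The face `σ` lies on the boundary of the polytope formed by the simplices `κ` with
`cell κ = K`: it is a side of exactly one of them. -/
def OnBoundary {C : Type*} (cell : T → C) (K : C) (σ : S) : Prop :=
  ∃! q : T × Fin (d + 1), cell q.1 = K ∧ M.side q.1 q.2 = σ

/-- The face `σ` lies inside the polytope formed by the simplices `κ` with `cell κ = K`: it is
shared by two of them. -/
def Inside {C : Type*} (cell : T → C) (K : C) (σ : S) : Prop :=
  ∃ q q' : T × Fin (d + 1), q ≠ q' ∧ (cell q.1 = K ∧ M.side q.1 q.2 = σ) ∧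
    (cell q'.1 = K ∧ M.side q'.1 q'.2 = σ)

end SimplicialMesh

/-! ### Polytopal meshes with simplicial submeshes -/

/-- A polytopal mesh of `Ω` with cells `C` and polytopal faces `F`, with a simplicial submesh.
A cell is the union of the simplices `κ` with `cell κ = K`; a polytopal face is the union of
the simplicial faces `σ` lying on cell boundaries with `parent σ` that face (the value
`parent σ` has no meaning when `σ` lies inside a cell). -/
structure PolytopalMesh (d : ℕ) (Ω : Set (Euc d)) (T S V C F : Type*) extends
    SimplicialMesh d Ω T S V where
  cell : T → C
  cell_surjective : Function.Surjective cell
  /-- The interior of each cell is connected: any two simplices of a cell are linked by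
  a chain of simplices of that cell in which consecutive ones share a face. -/
  cell_connected : ∀ κ κ', cell κ = cell κ' → Relation.ReflTransGen
    (fun a b => cell a = cell b ∧ ∃ i j, side a i = side b j) κ κ'
  parent : S → F
  parent_surjective : ∀ τ, ∃ K σ, toSimplicialMesh.OnBoundary cell K σ ∧ parent σ = τ
  /-- A polytopal face is an entire face of each cell it meets in a simplicial face. -/
  parent_entire : ∀ K L σ σ', toSimplicialMesh.OnBoundary cell K σ →
    toSimplicialMesh.OnBoundary cell L σ' → parent σ = parent σ' →
      toSimplicialMesh.OnBoundary cell K σ'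
  /-- The unit normal `𝐧_σ` fixing the orientation of a simplicial face; arbitrary on interior
  faces and exterior to `Ω` on boundary faces. -/
  normal : S → Euc d
  normal_eq_or : ∀ κ i, normal (side κ i) = toSimplicialMesh.outNormal κ i ∨
    normal (side κ i) = -toSimplicialMesh.outNormal κ i
  normal_boundary : ∀ κ i, (∀ κ' i', side κ' i' = side κ i → κ' = κ) →
    normal (side κ i) = toSimplicialMesh.outNormal κ i
  /-- The unit normal `𝐧_σ` fixing the orientation of a polytopal face. -/
  polyNormal : F → Euc d
  polyNormal_eq : ∀ K σ, toSimplicialMesh.OnBoundary cell K σ → normal σ = polyNormal (parent σ)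
  /-- The unit normal `𝐧_K` on a polytopal face of `K`, pointing out of `K`. -/
  outward : C → F → Euc d
  outward_eq : ∀ κ i, toSimplicialMesh.OnBoundary cell (cell κ) (side κ i) →
    outward (cell κ) (parent (side κ i)) = toSimplicialMesh.outNormal κ i
  /-- Polytopal faces are flat. -/
  flat : ∀ K L σ σ', toSimplicialMesh.OnBoundary cell K σ →
    toSimplicialMesh.OnBoundary cell L σ' → parent σ = parent σ' →
      ∀ a ∈ toSimplicialMesh.faceVertices σ, ∀ b ∈ toSimplicialMesh.faceVertices σ',
        inner ℝ (polyNormal (parent σ)) (node a - node b) = 0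

namespace PolytopalMesh

variable {d : ℕ} {Ω : Set (Euc d)} {T S V C F : Type*} [Fintype T] [Fintype S] [Fintype V]
  [Fintype C] [Fintype F] (M : PolytopalMesh d Ω T S V C F)

/-- The simplicial mesh `𝒯_K` of the cell `K`. -/
def Sub (K : C) : Type _ := {κ : T // M.cell κ = K}

/-- The simplicial faces on the boundary of the cell `K`. -/
def ExtFace (K : C) : Type _ := {σ : S // M.OnBoundary M.cell K σ}

/-- The simplicial faces inside the cell `K`. -/
def IntFace (K : C) : Type _ := {σ : S // M.Inside M.cell K σ}

/-- The vertices of the simplices of `𝒯_K`. -/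
def SubVertex (K : C) : Type _ := {a : V // ∃ κ i, M.cell κ = K ∧ M.vert κ i = a}

instance (K : C) : Fintype (M.Sub K) := by
  classical exact inferInstanceAs (Fintype {κ : T // M.cell κ = K})

instance (K : C) : Fintype (M.ExtFace K) := by
  classical exact inferInstanceAs (Fintype {σ : S // M.OnBoundary M.cell K σ})

instance (K : C) : Fintype (M.IntFace K) := by
  classical exact inferInstanceAs (Fintype {σ : S // M.Inside M.cell K σ})

instance (K : C) : Fintype (M.SubVertex K) := by
  classical exact inferInstanceAs (Fintype {a : V // ∃ κ i, M.cell κ = K ∧ M.vert κ i = a})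

/-- The closed polytope `K`. -/
def cellSet (K : C) : Set (Euc d) := ⋃ κ : M.Sub K, M.hull κ.1

/-- The volume `|K|`. -/
def cellVol (K : C) : ℝ := volume.real (M.cellSet K)

open Classical in
/-- The set `ℱ_K` of the polytopal faces of `K`. -/
def cellFaces (K : C) : Finset F :=
  Finset.univ.filter fun τ => ∃ σ, M.OnBoundary M.cell K σ ∧ M.parent σ = τ

/-- The `(d-1)`-dimensional measure of a simplicial face. -/
def faceArea (σ : S) : ℝ := (μHE[d - 1] : Measure (Euc d)).real (M.faceHull σ)

/-- The closed polytopal face. -/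
def polyFaceSet (τ : F) : Set (Euc d) :=
  ⋃ σ ∈ {σ : S | (∃ K, M.OnBoundary M.cell K σ) ∧ M.parent σ = τ}, M.faceHull σ

/-- The `(d-1)`-dimensional measure of a polytopal face. -/
def polyFaceArea (τ : F) : ℝ := (μHE[d - 1] : Measure (Euc d)).real (M.polyFaceSet τ)

/-- `𝖥_K = (f, 1)_K`. -/
def load (f : Euc d → ℝ) (K : C) : ℝ := ∫ x in M.cellSet K, f x

/-! ### Face normal fluxes -/

/-- The total outflux `∑_{σ ∈ ℱ_K} 𝖴_σ 𝐧_K·𝐧_σ` of `K` for face normal fluxes `𝖴` on the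
polytopal faces, taken along `𝐧_σ`. -/
def outflux (U : F → ℝ) (K : C) : ℝ :=
  ∑ τ ∈ M.cellFaces K, U τ * inner ℝ (M.outward K τ) (M.polyNormal τ)

/-- The normal flux along `𝐧_σ` on a simplicial subface `σ` of a polytopal face, obtained from
that on the polytopal face proportionally to the area. -/
def subFlux (U : F → ℝ) (σ : S) : ℝ :=
  U (M.parent σ) / M.polyFaceArea (M.parent σ) * M.faceArea σ

/-- The element vector of the face normal fluxes on the simplicial faces of `∂K`, with the fluxes
oriented out of `K`. -/
def elemFlux (U : F → ℝ) (K : C) : M.ExtFace K → ℝ := fun σ =>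
  inner ℝ (M.outward K (M.parent σ.1)) (M.normal σ.1) * M.subFlux U σ.1

/-! ### Lowest-order Raviart–Thomas fields and the flux reconstruction -/

/-- The `RT₀` polynomial `x ↦ a + b x`. -/
def rtEval (w : Euc d × ℝ) (x : Euc d) : Euc d := w.1 + w.2 • x

/-- The piecewise polynomial field on `Ω` with the `RT₀` polynomial `u κ` in each simplex `κ`. -/
def toField (u : T → Euc d × ℝ) (x : Euc d) : Euc d :=
  ∑ κ, (interior (M.hull κ)).indicator (rtEval (u κ)) x

/-- The restriction of `u` to `K` lies in `RT₀(𝒯_K) ∩ H(div, K)` (the normal traces are continuous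
over the faces inside `K`), and its normal flux over each simplicial face `σ` of `∂K`, along
`𝐧_σ`, is the one given by `U`. -/
def MemVN (U : F → ℝ) (K : C) (u : M.Sub K → Euc d × ℝ) : Prop :=
  (∀ (κ κ' : M.Sub K) (i i' : Fin (d + 1)), κ ≠ κ' → M.side κ.1 i = M.side κ'.1 i' →
    ∀ x ∈ M.faceHull (M.side κ.1 i),
      inner ℝ (rtEval (u κ) x) (M.outNormal κ.1 i) =
        -inner ℝ (rtEval (u κ') x) (M.outNormal κ'.1 i')) ∧
  ∀ (κ : M.Sub K) (i : Fin (d + 1)), M.OnBoundary M.cell K (M.side κ.1 i) →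
    ∫ x in M.faceHull (M.side κ.1 i),
        inner ℝ (rtEval (u κ) x) (M.normal (M.side κ.1 i)) ∂(μHE[d - 1] : Measure (Euc d)) =
      M.subFlux U (M.side κ.1 i)

/-- The divergence of `u` is constant on `K`. -/
def HasConstDiv (K : C) (u : M.Sub K → Euc d × ℝ) : Prop :=
  ∃ δ : ℝ, ∀ κ, ∀ x, divergence (rtEval (u κ)) x = δ

/-- `‖u‖²_K`. -/
def energy (K : C) (u : M.Sub K → Euc d × ℝ) : ℝ :=
  ∑ κ : M.Sub K, ∫ x in M.hull κ.1, ‖rtEval (u κ) x‖ ^ 2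

/-- The flux reconstruction lifting the face normal fluxes `U`: on each cell, the minimiser of the
`L²`-norm among the Raviart–Thomas fields with these fluxes and with constant divergence. -/
def IsFluxReconstruction (U : F → ℝ) (u : T → Euc d × ℝ) : Prop :=
  ∀ K, (M.MemVN U K (fun κ => u κ.1) ∧ M.HasConstDiv K (fun κ => u κ.1)) ∧
    ∀ w : M.Sub K → Euc d × ℝ, M.MemVN U K w → M.HasConstDiv K w →
      M.energy K (fun κ => u κ.1) ≤ M.energy K w

/-! ### The mixed finite element matrix -/

open Classical in
/-- The restriction to `κ ∈ 𝒯_K` of the basis function `𝐯_σ` of `RT₀(𝒯_K) ∩ H(div, K)` with unit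
normal flux over `σ`, oriented out of `K` if `σ` lies on `∂K` and along `𝐧_σ` otherwise, and
with zero normal flux over all the other faces. -/
def rtBasis (K : C) (σ : S) (κ : M.Sub K) (x : Euc d) : Euc d :=
  ∑ i : Fin (d + 1), if M.side κ.1 i = σ then
    ((if M.OnBoundary M.cell K σ then 1 else inner ℝ (M.outNormal κ.1 i) (M.normal σ)) /
      (d * M.vol κ.1)) • (x - M.simplex κ.1 i) else 0

/-- `α (𝐯_{σ'}, 𝐯_σ)_K`. -/
def rtMass (α : ℝ) (K : C) (σ σ' : S) : ℝ :=
  α * ∑ κ : M.Sub K, ∫ x in M.hull κ.1, inner ℝ (M.rtBasis K σ' κ x) (M.rtBasis K σ κ x)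

/-- The piecewise constants on `𝒯_K` with zero mean value on `K`. -/
def Q0 (K : C) : Submodule ℝ (M.Sub K → ℝ) where
  carrier := {q | ∑ κ, M.vol κ.1 * q κ = 0}
  add_mem' := by
    intro a b ha hb
    simp only [Set.mem_ofPred_eq, Pi.add_apply, mul_add, Finset.sum_add_distrib] at *
    rw [ha, hb, add_zero]
  zero_mem' := by simp
  smul_mem' := by
    intro c a ha
    simp only [Set.mem_ofPred_eq, Pi.smul_apply, smul_eq_mul] at *
    simp only [mul_left_comm _ c]
    rw [← Finset.mul_sum, ha, mul_zero]

/-- `-(div 𝐯_σ, q)_K`. -/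
def rtDiv (K : C) (q : M.Sub K → ℝ) (σ : S) : ℝ :=
  -∑ κ : M.Sub K, ∫ x in M.hull κ.1, divergence (M.rtBasis K σ κ) x * q κ

open Classical in
/-- The element matrix of the mixed finite element method with the tensor `𝐊⁻¹ = α I`, built with
a basis `q` of the piecewise constants of zero mean value. -/
def mfeMatrix (α : ℝ) (K : C) {J : Type*} [Fintype J] (q : Module.Basis J ℝ (M.Q0 K)) :
    Matrix (M.ExtFace K) (M.ExtFace K) ℝ :=
  let Aii : Matrix (M.IntFace K) (M.IntFace K) ℝ := .of fun σ σ' => M.rtMass α K σ.1 σ'.1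
  let Aie : Matrix (M.IntFace K) (M.ExtFace K) ℝ := .of fun σ σ' => M.rtMass α K σ.1 σ'.1
  let Aee : Matrix (M.ExtFace K) (M.ExtFace K) ℝ := .of fun σ σ' => M.rtMass α K σ.1 σ'.1
  let Bi : Matrix J (M.IntFace K) ℝ := .of fun l σ => M.rtDiv K (q l).1 σ.1
  let Be : Matrix J (M.ExtFace K) ℝ := .of fun l σ => M.rtDiv K (q l).1 σ.1
  let G := Matrix.fromRows Aie Be
  Aee - Gᵀ * (Matrix.fromBlocks Aii Biᵀ Bi 0)⁻¹ * G

/-! ### The finite element matrices -/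

open Classical in
/-- The restriction to `κ` of the hat function `ψ_a`. -/
def hat (a : V) (κ : T) (x : Euc d) : ℝ :=
  ∑ i : Fin (d + 1), if M.vert κ i = a then (M.simplex κ).coord i x else 0

/-- The element stiffness matrix with the tensor `𝐊 = β I`. -/
def stiffMatrix (β : ℝ) (K : C) : Matrix (M.SubVertex K) (M.SubVertex K) ℝ := .of fun a a' =>
  ∑ κ : M.Sub K, ∫ x in M.hull κ.1,
    inner ℝ (β • gradient (M.hat a'.1 κ.1) x) (gradient (M.hat a.1 κ.1) x)

/-- The element mass matrix. -/
def massMatrix (K : C) : Matrix (M.SubVertex K) (M.SubVertex K) ℝ := .of fun a a' =>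
  ∑ κ : M.Sub K, ∫ x in M.hull κ.1, M.hat a'.1 κ.1 x * M.hat a.1 κ.1 x

/-! ### Potential point values -/

open Classical in
/-- The set `𝒯_a` of the cells sharing the vertex `a`. -/
def vertexCells (a : V) : Finset C :=
  Finset.univ.filter fun K => ∃ κ i, M.cell κ = K ∧ M.vert κ i = a

open Classical in
/-- The set `ℱ_a` of the polytopal faces sharing the vertex `a`; it is empty when `a` lies inside
a cell. -/
def vertexFaces (a : V) : Finset F :=
  Finset.univ.filter fun τ =>
    ∃ K σ, M.OnBoundary M.cell K σ ∧ M.parent σ = τ ∧ a ∈ M.faceVertices σ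

/-- The mean of the cell values over the cells sharing `a`; it is `P K` when `a` lies inside the
cell `K`. -/
def cellMean (P : C → ℝ) (a : V) : ℝ :=
  (∑ K ∈ M.vertexCells a, P K) / (M.vertexCells a).card

open Classical in
/-- Potential point values by averaging the cell values. -/
def pointValues (P : C → ℝ) (a : V) : ℝ :=
  if M.node a ∈ frontier Ω then 0 else M.cellMean P a

open Classical in
/-- Potential point values by averaging face values (Lagrange multipliers) `Λ`. -/
def pointValuesHybrid (P : C → ℝ) (Λ : F → ℝ) (a : V) : ℝ :=
  if M.node a ∈ frontier Ω then 0
  else if M.vertexFaces a = ∅ then M.cellMean P a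
  else (∑ τ ∈ M.vertexFaces a, Λ τ) / (M.vertexFaces a).card

/-- `Z` are potential point values built from the cell values `P` in one of the two ways. -/
def IsPointValues (P : C → ℝ) (Z : V → ℝ) : Prop :=
  Z = M.pointValues P ∨ ∃ Λ : F → ℝ, Z = M.pointValuesHybrid P Λ

/-- The element vector `𝖹_K`. -/
def elemPoint (Z : V → ℝ) (K : C) : M.SubVertex K → ℝ := fun a => Z a.1

open Classical in
/-- The element vector `𝖹_K^ext` of the face values, the means over the `d` vertices of a face. -/
def elemPointExt (Z : V → ℝ) (K : C) : M.ExtFace K → ℝ := fun σ =>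
  (1 / (d : ℝ)) * ∑ a ∈ Finset.univ.filter (fun a => a ∈ M.faceVertices σ.1), Z a

end PolytopalMesh

/-! ### The discretization with iterative linearization and algebraic solver -/

/-- A locally conservative discretization with unknowns in the cells `C` and normal fluxes on the
faces `F`, an iterative linearization and an iterative algebraic solver. No property is
required: any scheme, linearization and solver is covered. -/
structure IterativeScheme (C F : Type*) where
  /-- The nonlinear face normal fluxes `𝖴(𝖯)`, along `𝐧_σ`. -/
  flux : (C → ℝ) → F → ℝ
  /-- The linearized (affine) face normal fluxes; `linFlux (k - 1)` is used on step `k ≥ 1`. -/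
  linFlux : ℕ → (C → ℝ) →ᵃ[ℝ] (F → ℝ)
  /-- The iterates `𝖯^{k,i}`. -/
  iterate : ℕ → ℕ → C → ℝ

namespace IterativeScheme

variable {d : ℕ} {Ω : Set (Euc d)} {T S V C F : Type*} [Fintype T] [Fintype S] [Fintype V]
  [Fintype C] [Fintype F] (A : IterativeScheme C F) (M : PolytopalMesh d Ω T S V C F)

/-- Discretization face fluxes `𝖴(𝖯^{k,i})`. -/
def discFlux (k i : ℕ) : F → ℝ := A.flux (A.iterate k i)

/-- Linearization error face fluxes `𝖴^{k-1}(𝖯^{k,i}) - 𝖴(𝖯^{k,i})`. -/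
def linErrFlux (k i : ℕ) : F → ℝ := A.linFlux (k - 1) (A.iterate k i) - A.flux (A.iterate k i)

/-- Algebraic error face fluxes `𝖴^{k-1}(𝖯^{k,i+j}) - 𝖴^{k-1}(𝖯^{k,i})`. -/
def algErrFlux (k i j : ℕ) : F → ℝ :=
  A.linFlux (k - 1) (A.iterate k (i + j)) - A.linFlux (k - 1) (A.iterate k i)

/-- The algebraic residual `𝖱_K^{k,i} = 𝖥_K - ∑_{σ ∈ ℱ_K} (𝖴^{k-1}(𝖯^{k,i}))_σ 𝐧_K·𝐧_σ`. -/
def residual (f : Euc d → ℝ) (k i : ℕ) (K : C) : ℝ :=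
  M.load f K - M.outflux (A.linFlux (k - 1) (A.iterate k i)) K

end IterativeScheme

/-! ### The estimators -/

section Estimators

variable {d : ℕ} {Ω : Set (Euc d)} {T S V C F : Type*} [Fintype T] [Fintype S] [Fintype V]
  [Fintype C] [Fintype F] (M : PolytopalMesh d Ω T S V C F)
  {J : C → Type*} [∀ K, Fintype (J K)] (q : ∀ K, Module.Basis (J K) ℝ (M.Q0 K)) (c L : ℝ)

/-- The squared discretization estimator of a cell, for face fluxes `U` and point values `Z`. -/
def etaSpSq (U : F → ℝ) (Z : V → ℝ) (K : C) : ℝ :=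
  let UK := M.elemFlux U K
  let ZK := M.elemPoint Z K
  UK ⬝ᵥ (M.mfeMatrix (c⁻¹ * L ^ 2) K (q K) *ᵥ UK)
    + ZK ⬝ᵥ (M.stiffMatrix (c⁻¹ ^ 2 * L) K *ᵥ ZK)
    + 2 * c⁻¹ * L * (UK ⬝ᵥ M.elemPointExt Z K
        - M.outflux U K * (M.cellVol K)⁻¹ * ((fun _ => 1) ⬝ᵥ (M.massMatrix K *ᵥ ZK)))

/-- The squared linearization or algebraic estimator of a cell, for error face fluxes `U`. -/
def etaFluxSq (U : F → ℝ) (K : C) : ℝ :=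
  M.elemFlux U K ⬝ᵥ (M.mfeMatrix (c⁻¹ * L ^ 2) K (q K) *ᵥ M.elemFlux U K)

/-- The algebraic remainder estimator of a cell, for the algebraic residual `R`. -/
def etaRem (R : C → ℝ) (K : C) : ℝ :=
  (Real.sqrt c)⁻¹ * L * friedrichsConstant Ω * Metric.diam Ω *
    (Real.sqrt (M.cellVol K))⁻¹ * |R K|

end Estimators

end NonlinearDarcy

end

/-! Error bound. The pointwise map `N v = E ‖v‖ v` is strongly monotone (constant `c`) and Lipschitz
(constant `L`) on `L²(Ω)ᵈ`, and the inverse law gives `N u = -∇p`. Let `W` be the orthogonal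
complement of the gradients of test functions, so that `Wᗮ` is the closure of these gradients and
contains `∇p`. For the approximation `a = u_h`, a fixed point argument yields `w ∈ W` with `N (a +
w) ∈ Wᗮ`, and the error splits as `u - a = (u - (a + w)) + w`. Strong monotonicity, tested with `w`,
gives `c ‖w‖ ≤ ‖N a + g‖` for every `g ∈ Wᗮ`. Tested with `u - (a + w)`, where `w` drops out, it
gives `c ‖u - (a + w)‖ ≤ L B`, with `B` a bound of the functional `z ↦ (u - a, z)` on `Wᗮ`. Hence `c
‖u - a‖ ≤ L B + ‖N a + g‖` (`norm_sub_le_of_monotone`, `flux_error_le`); dividing by `√c` leaves two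
terms to be bounded by estimators.

The functional `B`. A lift of face fluxes has the weak divergence `outflux / |K|` on each cell
(`integral_inner_toField_gradient`). The linearized fluxes at the iterate `i + j` are the sum of the
discretization, linearization and algebraic fluxes, so tested with `∇φ` the difference `u - u_h`
equals the sum of the lifts of the linearization and algebraic fluxes, minus the residual tested
with `φ`. Cauchy–Schwarz and the Friedrichs inequality bound the three parts.

The nonconformity term. Take `g = ∇s`, with `s` continuous, piecewise affine, of vertex values `Z`.
That `∇s` lies in `Wᗮ` follows by thresholding and mollifying `s` (`exists_testFunctions_tendsto`).
A linear algebra inequality for symmetric tensors with spectrum in `[c, L]`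
(`norm_add_sq_le_of_isSymm`) bounds `c⁻¹ |N(u_h) + ∇s|²` by an expression where only the cross term
`2 c⁻¹ L u_h · ∇s` mixes flux and potential. Green's formula evaluates the integral of this cross
term from face fluxes and point values alone (`etaSpSq_eq`), and nonnegativity of the estimator
comes with the inequality.

Computability. On each cell the reconstruction minimises a definite quadratic form under linear
constraints. Its saddle-point matrix is invertible: the form is definite, and the divergence
constraint is onto because the cell is connected through faces. The Schur complement of that matrix
is the element matrix, whose quadratic form is therefore `c⁻¹ L²` times the minimal energy
(`exists_cell_minimiser`). No lifted field has to be computed.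

Geometry. All divergence theorems reduce to one computation: a simplex is a cone over each of its
sides, and for the field `φ(x) (x - bᵢ)` only the side opposite to the apex `bᵢ` contributes
(`integral_hull_green`). Conformity of the mesh makes the contributions of faces shared by two
simplices cancel. -/

set_option linter.unusedSectionVars false

noncomputable section

namespace NonlinearDarcy

/-! ### Barycentric coordinates and their gradients -/

section Simplex

variable {d : ℕ} (b : AffineBasis (Fin (d + 1)) ℝ (Euc d))

/-- The gradient of the `i`-th barycentric coordinate. -/
def baryGrad (i : Fin (d + 1)) : Euc d := gradient (fun x => b.coord i x) 0

lemma hasGradientAt_coord (i : Fin (d + 1)) (x : Euc d) :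
    HasGradientAt (fun x => b.coord i x)
      ((InnerProductSpace.toDual ℝ (Euc d)).symm (b.coord i).linear.toContinuousLinearMap) x := by
  rw [hasGradientAt_iff_hasFDerivAt]
  have h : (fun x => b.coord i x) =
      fun x => (b.coord i).linear.toContinuousLinearMap x + b.coord i 0 := by
    ext y
    conv_lhs => rw [AffineMap.decomp (b.coord i)]
    simp
  rw [h, LinearIsometryEquiv.apply_symm_apply]
  exact (b.coord i).linear.toContinuousLinearMap.hasFDerivAt.add_const _

lemma gradient_coord (i : Fin (d + 1)) (x : Euc d) :
    gradient (fun x => b.coord i x) x = baryGrad b i := by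
  rw [baryGrad, (hasGradientAt_coord b i x).gradient, (hasGradientAt_coord b i 0).gradient]

lemma linear_coord (i : Fin (d + 1)) (v : Euc d) :
    (b.coord i).linear v = inner ℝ (baryGrad b i) v := by
  rw [baryGrad, (hasGradientAt_coord b i 0).gradient, InnerProductSpace.toDual_symm_apply]
  rfl

lemma coord_sub (i : Fin (d + 1)) (x y : Euc d) :
    b.coord i x - b.coord i y = inner ℝ (baryGrad b i) (x - y) := by
  rw [← linear_coord, ← vsub_eq_sub, ← vsub_eq_sub x y, AffineMap.linearMap_vsub]

lemma coord_add (i : Fin (d + 1)) (x v : Euc d) :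
    b.coord i (x + v) = b.coord i x + inner ℝ (baryGrad b i) v := by
  have := coord_sub b i (x + v) x
  rw [add_sub_cancel_left] at this
  linarith

lemma sum_baryGrad : ∑ i, baryGrad b i = 0 := by
  refine ext_inner_right ℝ fun v => ?_
  rw [sum_inner, inner_zero_left]
  have h1 := b.sum_coord_apply_eq_one (0 + v)
  simp only [coord_add, Finset.sum_add_distrib, b.sum_coord_apply_eq_one] at h1
  linarith

/-- The identity `∑ λᵢ(x) bᵢ = x`, differentiated in the direction `v`. -/
lemma sum_inner_baryGrad_smul (v : Euc d) : ∑ i, (inner ℝ (baryGrad b i) v : ℝ) • b i = v := by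
  have h1 := b.linear_combination_coord_eq_self (0 + v)
  have h0 := b.linear_combination_coord_eq_self 0
  simp only [coord_add, add_smul, Finset.sum_add_distrib] at h1
  rw [h0] at h1
  simpa using h1

lemma inner_baryGrad_sub_self {i : Fin (d + 1)} {x : Euc d} :
    inner ℝ (baryGrad b i) (x - b i) = b.coord i x - 1 := by
  rw [← coord_sub, b.coord_apply_eq]

lemma inner_baryGrad_sub {i j : Fin (d + 1)} (h : i ≠ j) {x : Euc d} :
    inner ℝ (baryGrad b i) (x - b j) = b.coord i x := by
  rw [← coord_sub, b.coord_apply_ne h, sub_zero]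

lemma baryGrad_ne_zero (hd : 1 ≤ d) (i : Fin (d + 1)) : baryGrad b i ≠ 0 := by
  intro h
  obtain ⟨j, hj⟩ : ∃ j : Fin (d + 1), j ≠ i := by
    have : Nontrivial (Fin (d + 1)) := Fin.nontrivial_iff_two_le.2 (by omega)
    exact exists_ne i
  have := inner_baryGrad_sub_self b (i := i) (x := b j)
  rw [h, inner_zero_left, b.coord_apply_ne hj.symm] at this
  linarith

lemma continuous_coord (i : Fin (d + 1)) : Continuous (fun x => b.coord i x) :=
  (b.coord i).continuous_of_finiteDimensional

lemma mem_hull_iff {x : Euc d} :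
    x ∈ convexHull ℝ (Set.range b) ↔ ∀ i, 0 ≤ b.coord i x := by
  rw [b.convexHull_eq_nonneg_coord]; rfl

lemma isCompact_hull : IsCompact (convexHull ℝ (Set.range b)) :=
  (Set.finite_range b).isCompact_convexHull ℝ

lemma interior_hull_nonempty : (interior (convexHull ℝ (Set.range b))).Nonempty :=
  ⟨_, b.centroid_mem_interior_convexHull⟩

lemma volume_hull_pos : 0 < volume.real (convexHull ℝ (Set.range b)) := by
  refine ENNReal.toReal_pos ?_ (isCompact_hull b).measure_lt_top.ne
  exact (Measure.measure_pos_of_nonempty_interior _ (interior_hull_nonempty b)).ne'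

lemma interior_hull_ae_eq :
    interior (convexHull ℝ (Set.range b)) =ᵐ[volume] convexHull ℝ (Set.range b) :=
  interior_ae_eq_of_null_frontier ((convex_convexHull ℝ _).addHaar_frontier volume)

lemma volume_coord_eq_zero (hd : 1 ≤ d) (i : Fin (d + 1)) (r : ℝ) :
    volume {x : Euc d | b.coord i x = r} = 0 := by
  have h : {x : Euc d | b.coord i x = r} =
      ((AffineSubspace.mk' r ⊥ : AffineSubspace ℝ ℝ).comap (b.coord i) : Set (Euc d)) := by
    ext x
    simp [AffineSubspace.mem_mk', sub_eq_zero]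
  rw [h]
  refine Measure.addHaar_affineSubspace _ _ fun htop => ?_
  have h1 : ∀ x, b.coord i x = r := fun x => by
    have : x ∈ ((⊤ : AffineSubspace ℝ (Euc d)) : Set (Euc d)) := trivial
    rw [← htop, ← h] at this
    exact this
  have h2 := coord_add b i 0 (baryGrad b i)
  rw [h1, h1, real_inner_self_eq_norm_sq] at h2
  have := norm_pos_iff.2 (baryGrad_ne_zero b hd i)
  nlinarith

end Simplex

/-! ### Integration over a cone -/

section Cone

variable {d : ℕ}

/-- Coordinates along a unit vector and its orthogonal complement, with origin `p`. -/
def axisEquiv {n : Euc d} (hn : ‖n‖ = 1) (p : Euc d) : ℝ × (ℝ ∙ n)ᗮ ≃ᵐ Euc d :=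
  ((LinearIsometryEquiv.toSpanUnitSingleton n hn).toHomeomorph.toMeasurableEquiv.prodCongr
    (MeasurableEquiv.refl _)).trans ((ℝ ∙ n).measurableEquivProd p).symm

lemma axisEquiv_apply {n : Euc d} (hn : ‖n‖ = 1) (p : Euc d) (t : ℝ) (w : (ℝ ∙ n)ᗮ) :
    axisEquiv hn p (t, w) = p + (t • n + w) := by
  simp only [axisEquiv, MeasurableEquiv.trans_apply, Submodule.measurableEquivProd_symm_apply]
  rw [vadd_eq_add, add_comm]
  rfl

lemma measurePreserving_axisEquiv {n : Euc d} (hn : ‖n‖ = 1) (p : Euc d) :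
    MeasurePreserving (axisEquiv hn p) := by
  have h1 := ((ℝ ∙ n).measurePreserving_measurableEquivProd p).symm
  rw [InnerProductSpace.euclideanHausdorffMeasure_eq_volume] at h1
  refine MeasurePreserving.trans ?_ h1
  exact (LinearIsometryEquiv.toSpanUnitSingleton n hn).measurePreserving.prod
    (MeasurePreserving.id _)

lemma finrank_orthogonal_unit (hd : 1 ≤ d) {n : Euc d} (hn : ‖n‖ = 1) :
    Module.finrank ℝ (ℝ ∙ n)ᗮ = d - 1 := by
  have : Fact (Module.finrank ℝ (Euc d) = (d - 1) + 1) := ⟨by simp; omega⟩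
  refine Submodule.finrank_orthogonal_span_singleton (n := d - 1) ?_
  rintro rfl
  simp at hn

-- The slice at height `t` above the apex is the base scaled by `t / h`, which produces the Jacobian
-- `(t / h) ^ (d - 1)`; Fubini then integrates along the rays. The description of `K` may fail at `t
-- = 0`, a null set of heights.
open scoped Pointwise in
lemma integral_cone (hd : 1 ≤ d) {n : Euc d} (hn : ‖n‖ = 1) (p : Euc d) {h : ℝ} (hh : 0 < h)
    {B : Set (ℝ ∙ n)ᗮ} (hB : IsCompact B) {K : Set (Euc d)} (hK : IsCompact K)
    (hKB : ∀ (t : ℝ) (w : (ℝ ∙ n)ᗮ), t ≠ 0 →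
      (p + (t • n + w) ∈ K ↔ (0 < t ∧ t ≤ h) ∧ (h / t) • w ∈ B))
    {G : Euc d → ℝ} (hG : Continuous G) :
    ∫ x in K, G x = ∫ w in B, ∫ t in (0 : ℝ)..h,
      (t / h) ^ (d - 1) * G (p + (t / h) • (h • n + (w : Euc d))) := by
  have hKm := hK.isClosed.measurableSet
  have e1 : ∫ x in K, G x = ∫ q : ℝ × (ℝ ∙ n)ᗮ, K.indicator G (axisEquiv hn p q) := by
    rw [← integral_indicator hKm]
    exact ((measurePreserving_axisEquiv hn p).integral_comp
      (axisEquiv hn p).measurableEmbedding _).symm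
  have hint : Integrable (fun q : ℝ × (ℝ ∙ n)ᗮ => K.indicator G (axisEquiv hn p q)) :=
    ((measurePreserving_axisEquiv hn p).integrable_comp_emb
      (axisEquiv hn p).measurableEmbedding).2
      ((integrable_indicator_iff hKm).2 (hG.continuousOn.integrableOn_compact hK))
  rw [e1, Measure.volume_eq_prod, integral_prod _ (by rwa [Measure.volume_eq_prod] at hint)]
  have e2 : ∀ᵐ t : ℝ, ∫ w : (ℝ ∙ n)ᗮ, K.indicator G (axisEquiv hn p (t, w)) =
      (Set.Ioc 0 h).indicator (fun t => ∫ w in B,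
        (t / h) ^ (d - 1) * G (p + (t / h) • (h • n + (w : Euc d)))) t := by
    have h0 : ∀ᵐ t : ℝ, t ≠ 0 := by simp [ae_iff]
    filter_upwards [h0] with t ht
    by_cases hth : t ∈ Set.Ioc 0 h
    · rw [Set.indicator_of_mem hth, integral_const_mul]
      have hR : 0 < t / h := div_pos hth.1 hh
      have e3 : ∀ w : (ℝ ∙ n)ᗮ, K.indicator G (axisEquiv hn p (t, w)) =
          ((t / h) • B).indicator (fun w : (ℝ ∙ n)ᗮ => G (p + (t • n + (w : Euc d)))) w := by
        intro w
        rw [axisEquiv_apply]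
        have : p + (t • n + (w : Euc d)) ∈ K ↔ w ∈ (t / h) • B := by
          rw [hKB t w ht, Set.mem_smul_set_iff_inv_smul_mem₀ hR.ne', inv_div]
          simp [hth.1, hth.2]
        by_cases hw : w ∈ (t / h) • B
        · rw [Set.indicator_of_mem hw, Set.indicator_of_mem (this.2 hw)]
        · rw [Set.indicator_of_notMem hw, Set.indicator_of_notMem (fun h => hw (this.1 h))]
      simp_rw [e3]
      rw [integral_indicator (hB.smul (t / h)).isClosed.measurableSet]
      have e4 := Measure.setIntegral_comp_smul_of_pos (volume : Measure (ℝ ∙ n)ᗮ)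
        (fun w : (ℝ ∙ n)ᗮ => G (p + (t • n + (w : Euc d)))) B hR
      rw [finrank_orthogonal_unit hd hn] at e4
      have e5 : ∀ w : (ℝ ∙ n)ᗮ, G (p + (t / h) • (h • n + (w : Euc d))) =
          G (p + (t • n + (((t / h) • w : (ℝ ∙ n)ᗮ) : Euc d))) := by
        intro w
        rw [smul_add, smul_smul, div_mul_cancel₀ _ hh.ne']
        rfl
      simp_rw [e5]
      rw [e4, smul_eq_mul, ← mul_assoc, mul_inv_cancel₀ (by positivity), one_mul]
    · rw [Set.indicator_of_notMem hth]
      have : ∀ w : (ℝ ∙ n)ᗮ, K.indicator G (axisEquiv hn p (t, w)) = 0 := by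
        intro w
        refine Set.indicator_of_notMem (fun hw => hth ?_) _
        rw [axisEquiv_apply] at hw
        exact ((hKB t w ht).1 hw).1
      simp [this]
  rw [integral_congr_ae e2, integral_indicator measurableSet_Ioc]
  simp_rw [intervalIntegral.integral_of_le hh.le]
  refine integral_integral_swap ?_
  rw [Measure.prod_restrict]
  have : IntegrableOn (Function.uncurry fun (t : ℝ) (w : (ℝ ∙ n)ᗮ) =>
      (t / h) ^ (d - 1) * G (p + (t / h) • (h • n + (w : Euc d)))) (Set.Icc 0 h ×ˢ B)
      (volume.prod volume) := by
    refine ContinuousOn.integrableOn_compact (isCompact_Icc.prod hB) (Continuous.continuousOn ?_)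
    unfold Function.uncurry
    fun_prop
  exact this.mono_set (Set.prod_mono Set.Ioc_subset_Icc_self le_rfl)

/-- Along the ray through the base point `p + y` the integrand, with the Jacobian, is the
`t`-derivative of `h (t / h)ᵈ φ(p + (t / h) y)`. Only the value on the base survives, the one at the
apex being zero as `d ≥ 1`. -/
lemma integral_cone_green (hd : 1 ≤ d) {n : Euc d} (hn : ‖n‖ = 1) (p : Euc d) {h : ℝ}
    (hh : 0 < h) {B : Set (ℝ ∙ n)ᗮ} (hB : IsCompact B) {K : Set (Euc d)} (hK : IsCompact K)
    (hKB : ∀ (t : ℝ) (w : (ℝ ∙ n)ᗮ), t ≠ 0 →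
      (p + (t • n + w) ∈ K ↔ (0 < t ∧ t ≤ h) ∧ (h / t) • w ∈ B))
    {φ : Euc d → ℝ} (hφ : ContDiff ℝ 1 φ) :
    ∫ x in K, (inner ℝ (x - p) (gradient φ x) + d * φ x) =
      h * ∫ w in B, φ (p + (h • n + (w : Euc d))) := by
  have hgrad : Continuous (gradient φ) :=
    (InnerProductSpace.toDual ℝ (Euc d)).symm.continuous.comp (hφ.continuous_fderiv one_ne_zero)
  have hφc := hφ.continuous
  rw [integral_cone hd hn p hh hB hK hKB (by fun_prop), ← integral_const_mul]
  refine integral_congr_ae (.of_forall fun w => ?_)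
  set y : Euc d := h • n + (w : Euc d) with hy
  have hder : ∀ t ∈ Set.uIcc 0 h, HasDerivAt (fun t : ℝ => h * ((t / h) ^ d * φ (p + (t / h) • y)))
      ((t / h) ^ (d - 1) * (inner ℝ (p + (t / h) • y - p) (gradient φ (p + (t / h) • y)) +
        d * φ (p + (t / h) • y))) t := by
    intro t _
    have h1 : HasDerivAt (fun t : ℝ => t / h) h⁻¹ t := by
      simpa using (hasDerivAt_id t).div_const h
    have h2 : HasDerivAt (fun t : ℝ => p + (t / h) • y) (h⁻¹ • y) t := (h1.smul_const y).const_add p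
    have h3 : HasFDerivAt φ (fderiv ℝ φ (p + (t / h) • y)) (p + (t / h) • y) :=
      (hφ.differentiable one_ne_zero _).hasFDerivAt
    have h4 := ((h1.pow d).mul (h3.comp_hasDerivAt t h2)).const_mul h
    have h5 : fderiv ℝ φ (p + (t / h) • y) y = inner ℝ y (gradient φ (p + (t / h) • y)) := by
      rw [real_inner_comm, gradient, InnerProductSpace.toDual_symm_apply]
    obtain ⟨m, rfl⟩ : ∃ m, d = m + 1 := ⟨d - 1, by omega⟩
    refine HasDerivAt.congr_deriv (f' := _) h4 ?_
    simp only [Function.comp_apply, map_smul, h5, smul_eq_mul, add_sub_cancel_left, inner_smul_left,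
      Nat.add_sub_cancel, pow_succ, conj_trivial, Pi.pow_apply]
    field_simp
    ring
  beta_reduce
  rw [intervalIntegral.integral_eq_sub_of_hasDerivAt hder]
  · have : (0 : ℝ) ^ d = 0 := zero_pow (by omega)
    simp [hh.ne', this, hy]
  · refine Continuous.intervalIntegrable ?_ _ _
    fun_prop

end Cone

/-! ### The divergence theorem on a simplex -/

section SimplexGreen

variable {d : ℕ} (b : AffineBasis (Fin (d + 1)) ℝ (Euc d))

/-- The side of a simplex opposite to its `i`-th vertex. -/
def sideSet (i : Fin (d + 1)) : Set (Euc d) :=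
  {x | (∀ j, 0 ≤ b.coord j x) ∧ b.coord i x = 0}

lemma isClosed_sideSet (i : Fin (d + 1)) : IsClosed (sideSet b i) := by
  refine IsClosed.inter ?_ (isClosed_eq (continuous_coord b i) continuous_const)
  exact isClosed_le continuous_const (continuous_pi fun j => continuous_coord b j)

/-- The exterior unit normal on the `i`-th side. -/
def baryNormal (i : Fin (d + 1)) : Euc d := -(‖baryGrad b i‖⁻¹ • baryGrad b i)

variable {b}

lemma norm_baryNormal (hd : 1 ≤ d) (i : Fin (d + 1)) : ‖baryNormal b i‖ = 1 := by
  have := norm_pos_iff.2 (baryGrad_ne_zero b hd i)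
  rw [baryNormal, norm_neg, norm_smul, norm_inv, norm_norm, inv_mul_cancel₀ this.ne']

lemma inner_baryGrad_baryNormal (hd : 1 ≤ d) (i : Fin (d + 1)) :
    inner ℝ (baryGrad b i) (baryNormal b i) = -‖baryGrad b i‖ := by
  have := norm_pos_iff.2 (baryGrad_ne_zero b hd i)
  rw [baryNormal, inner_neg_right, inner_smul_right, real_inner_self_eq_norm_sq]
  field_simp

lemma baryGrad_eq (hd : 1 ≤ d) (i : Fin (d + 1)) :
    baryGrad b i = -(‖baryGrad b i‖ • baryNormal b i) := by
  have := norm_pos_iff.2 (baryGrad_ne_zero b hd i)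
  rw [baryNormal, smul_neg, neg_neg, smul_smul, mul_inv_cancel₀ this.ne', one_smul]

variable (b) in
/-- The isometric parametrization of the hyperplane carrying the `i`-th side. -/
def sideParam (i : Fin (d + 1)) (w : (ℝ ∙ baryNormal b i)ᗮ) : Euc d :=
  b i + (‖baryGrad b i‖⁻¹ • baryNormal b i + (w : Euc d))

lemma isometry_sideParam (i : Fin (d + 1)) : Isometry (sideParam b i) :=
  Isometry.of_dist_eq fun w w' => by simp [sideParam, dist_eq_norm]

lemma inner_baryGrad_coe (hd : 1 ≤ d) (i : Fin (d + 1)) (w : (ℝ ∙ baryNormal b i)ᗮ) :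
    inner ℝ (baryGrad b i) (w : Euc d) = 0 := by
  rw [baryGrad_eq hd, inner_neg_left, inner_smul_left,
    Submodule.mem_orthogonal_singleton_iff_inner_right.1 w.2]
  simp

lemma range_sideParam (hd : 1 ≤ d) (i : Fin (d + 1)) :
    Set.range (sideParam b i) = {x | b.coord i x = 0} := by
  have hg := norm_pos_iff.2 (baryGrad_ne_zero b hd i)
  ext x
  constructor
  · rintro ⟨w, rfl⟩
    simp only [Set.mem_ofPred_eq, sideParam]
    rw [coord_add, b.coord_apply_eq, inner_add_right, inner_baryGrad_coe hd, inner_smul_right,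
      inner_baryGrad_baryNormal hd]
    field_simp
    ring
  · intro hx
    have hx : b.coord i x = 0 := hx
    refine ⟨⟨x - b i - ‖baryGrad b i‖⁻¹ • baryNormal b i, ?_⟩, by simp [sideParam]⟩
    rw [Submodule.mem_orthogonal_singleton_iff_inner_right, inner_sub_right, inner_smul_right,
      real_inner_self_eq_norm_sq, norm_baryNormal hd]
    conv_lhs => enter [1]; rw [baryNormal]
    rw [inner_neg_left, inner_smul_left, inner_baryGrad_sub_self, hx]
    simp

/-- The normalised Hausdorff measure is invariant under isometries and is the Lebesgue measure on a
Euclidean space of the same dimension. Surface integrals thus become volume integrals over `(ℝ ∙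
n)ᗮ`, of dimension `d - 1`. -/
lemma euclideanHausdorff_restrict_side (hd : 1 ≤ d) (i : Fin (d + 1)) :
    (μHE[d - 1] : Measure (Euc d)).restrict {x | b.coord i x = 0} =
      (volume : Measure (ℝ ∙ baryNormal b i)ᗮ).map (sideParam b i) := by
  rw [← range_sideParam hd, ← (isometry_sideParam i).map_euclideanHausdorffMeasure,
    ← InnerProductSpace.euclideanHausdorffMeasure_eq_volume,
    finrank_orthogonal_unit hd (norm_baryNormal hd i)]

lemma measurableEmbedding_sideParam (i : Fin (d + 1)) : MeasurableEmbedding (sideParam b i) :=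
  (isometry_sideParam i).isClosedEmbedding.measurableEmbedding

/-- In the parametrization of the hyperplane `λᵢ = 0` the set is the zero set of an affine function.
That function is not identically zero: it equals `1` at `b j`, which lies on this hyperplane. -/
lemma euclideanHausdorff_inter_eq_zero (hd : 1 ≤ d) {i j : Fin (d + 1)} (hij : i ≠ j) :
    (μHE[d - 1] : Measure (Euc d)) {x | b.coord i x = 0 ∧ b.coord j x = 0} = 0 := by
  have hm : MeasurableSet {x : Euc d | b.coord j x = 0} :=
    (isClosed_eq (continuous_coord b j) continuous_const).measurableSet
  have h1 : (μHE[d - 1] : Measure (Euc d)) {x | b.coord i x = 0 ∧ b.coord j x = 0} =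
      (μHE[d - 1] : Measure (Euc d)).restrict {x | b.coord i x = 0} {x | b.coord j x = 0} := by
    rw [Measure.restrict_apply hm, Set.inter_comm]
    rfl
  rw [h1, euclideanHausdorff_restrict_side hd, (measurableEmbedding_sideParam i).map_apply]
  let A : (ℝ ∙ baryNormal b i)ᗮ →ᵃ[ℝ] ℝ :=
    (b.coord j).comp ((AffineMap.const ℝ _ (b i + ‖baryGrad b i‖⁻¹ • baryNormal b i)) +
      (ℝ ∙ baryNormal b i)ᗮ.subtype.toAffineMap)
  have hA : ∀ w, A w = b.coord j (sideParam b i w) := fun w => by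
    simp [A, sideParam, add_assoc]
  have h2 : sideParam b i ⁻¹' {x | b.coord j x = 0} =
      ((AffineSubspace.mk' (0 : ℝ) ⊥ : AffineSubspace ℝ ℝ).comap A : Set _) := by
    ext w
    simp [AffineSubspace.mem_mk', hA]
  rw [h2]
  refine Measure.addHaar_affineSubspace _ _ fun htop => ?_
  obtain ⟨w, hw⟩ : b j ∈ Set.range (sideParam b i) := by
    rw [range_sideParam hd]
    exact b.coord_apply_ne hij
  have : w ∈ ((⊤ : AffineSubspace ℝ (ℝ ∙ baryNormal b i)ᗮ) : Set _) := trivial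
  rw [← htop, ← h2, Set.mem_preimage, hw] at this
  have h3 : b.coord j (b j) = 0 := this
  rw [b.coord_apply_eq] at h3
  norm_num at h3

lemma sideParam_preimage (hd : 1 ≤ d) (i : Fin (d + 1)) :
    sideParam b i ⁻¹' sideSet b i = sideParam b i ⁻¹' convexHull ℝ (Set.range b) := by
  ext w
  have : sideParam b i w ∈ {x | b.coord i x = 0} := by
    rw [← range_sideParam hd]
    exact ⟨w, rfl⟩
  have : b.coord i (sideParam b i w) = 0 := this
  simp [sideSet, mem_hull_iff, this]

/-- The divergence theorem for the field `φ(x) (x - bᵢ)` on a simplex: only the side opposite to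
`bᵢ` contributes. -/
lemma integral_hull_green (hd : 1 ≤ d) (i : Fin (d + 1)) {φ : Euc d → ℝ} (hφ : ContDiff ℝ 1 φ) :
    ∫ x in convexHull ℝ (Set.range b), (inner ℝ (x - b i) (gradient φ x) + d * φ x) =
      ‖baryGrad b i‖⁻¹ * ∫ x in sideSet b i, φ x ∂(μHE[d - 1] : Measure (Euc d)) := by
  have hg := norm_pos_iff.2 (baryGrad_ne_zero b hd i)
  have hB : IsCompact (sideParam b i ⁻¹' convexHull ℝ (Set.range b)) :=
    (isometry_sideParam i).isClosedEmbedding.isCompact_preimage (isCompact_hull b)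
  -- The simplex is a cone with apex `b i`, axis along the exterior normal of the opposite side, and
  -- height `1 / ‖∇λᵢ‖`.
  rw [integral_cone_green hd (norm_baryNormal hd i) (b i) (inv_pos.2 hg) hB (isCompact_hull b) ?_ hφ]
  · congr 1
    have h1 : (μHE[d - 1] : Measure (Euc d)).restrict (sideSet b i) =
        ((volume : Measure (ℝ ∙ baryNormal b i)ᗮ).map (sideParam b i)).restrict (sideSet b i) := by
      rw [← euclideanHausdorff_restrict_side hd,
        Measure.restrict_restrict (isClosed_sideSet b i).measurableSet,
        Set.inter_eq_left.2 (fun x hx => hx.2)]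
    rw [h1, (measurableEmbedding_sideParam i).setIntegral_map, sideParam_preimage hd]
    rfl
  · intro t w ht
    have hi : ∀ (t : ℝ) (w : (ℝ ∙ baryNormal b i)ᗮ),
        b.coord i (b i + (t • baryNormal b i + (w : Euc d))) = 1 - t * ‖baryGrad b i‖ := by
      intro t w
      rw [coord_add, b.coord_apply_eq, inner_add_right, inner_baryGrad_coe hd, inner_smul_right,
        inner_baryGrad_baryNormal hd]
      ring
    have hj : ∀ j, j ≠ i → ∀ s : ℝ, b.coord j (b i + s • (t • baryNormal b i + (w : Euc d))) =
        s * b.coord j (b i + (t • baryNormal b i + (w : Euc d))) := by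
      intro j hji s
      rw [coord_add, coord_add, b.coord_apply_ne hji, inner_smul_right]
      ring
    have hs : sideParam b i ((‖baryGrad b i‖⁻¹ / t) • w) =
        b i + (‖baryGrad b i‖⁻¹ / t) • (t • baryNormal b i + (w : Euc d)) := by
      rw [sideParam, smul_add, smul_smul, div_mul_cancel₀ _ ht]
      rfl
    have hsi : b.coord i (sideParam b i ((‖baryGrad b i‖⁻¹ / t) • w)) = 0 := by
      rw [sideParam, hi, inv_mul_cancel₀ hg.ne', sub_self]
    rw [Set.mem_preimage, mem_hull_iff, mem_hull_iff]
    constructor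
    · intro h
      have h1 : 0 ≤ 1 - t * ‖baryGrad b i‖ := hi t w ▸ h i
      have h2 : 1 - t * ‖baryGrad b i‖ ≤ 1 := by
        rw [← hi t w, ← b.sum_coord_apply_eq_one (b i + (t • baryNormal b i + (w : Euc d)))]
        exact Finset.single_le_sum (fun j _ => h j) (Finset.mem_univ i)
      have h3 : 0 < t := lt_of_le_of_ne (by nlinarith) ht.symm
      refine ⟨⟨h3, ?_⟩, fun j => ?_⟩
      · rw [← mul_le_mul_iff_left₀ hg, inv_mul_cancel₀ hg.ne']
        linarith
      · by_cases hji : j = i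
        · rw [hji, hsi]
        · rw [hs, hj j hji]
          exact mul_nonneg (by positivity) (h j)
    · rintro ⟨⟨h3, h4⟩, h⟩ j
      by_cases hji : j = i
      · rw [hji, hi]
        rw [← mul_le_mul_iff_left₀ hg, inv_mul_cancel₀ hg.ne'] at h4
        linarith
      · have := h j
        rw [hs, hj j hji] at this
        exact (mul_nonneg_iff_of_pos_left (by positivity)).1 this

/-- The volume of a simplex in terms of the area of a side. -/
lemma volume_hull_eq (hd : 1 ≤ d) (i : Fin (d + 1)) :
    d * volume.real (convexHull ℝ (Set.range b)) =
      ‖baryGrad b i‖⁻¹ * (μHE[d - 1] : Measure (Euc d)).real (sideSet b i) := by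
  have := integral_hull_green hd i (b := b) (φ := fun _ => 1) contDiff_const
  simpa [gradient_fun_const, mul_comm] using this

lemma area_sideSet_eq (hd : 1 ≤ d) (i : Fin (d + 1)) :
    (μHE[d - 1] : Measure (Euc d)).real (sideSet b i) =
      d * volume.real (convexHull ℝ (Set.range b)) * ‖baryGrad b i‖ := by
  have hg := norm_pos_iff.2 (baryGrad_ne_zero b hd i)
  rw [volume_hull_eq hd i]
  field_simp

lemma area_sideSet_pos (hd : 1 ≤ d) (i : Fin (d + 1)) :
    0 < (μHE[d - 1] : Measure (Euc d)).real (sideSet b i) := by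
  have hg := norm_pos_iff.2 (baryGrad_ne_zero b hd i)
  have := volume_hull_pos b
  have : (0 : ℝ) < d := by exact_mod_cast hd
  rw [area_sideSet_eq hd]
  positivity

/-- Green's formula with `φ = λᵢ`: the side term vanishes, and `(x - bᵢ) · ∇λᵢ = λᵢ - 1` leaves `(d
+ 1) ∫ λᵢ = |κ|`. -/
lemma integral_hull_coord (hd : 1 ≤ d) (i : Fin (d + 1)) :
    ∫ x in convexHull ℝ (Set.range b), b.coord i x =
      volume.real (convexHull ℝ (Set.range b)) / (d + 1) := by
  have hsm : ContDiff ℝ 1 (fun x => b.coord i x) := by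
    have : (fun x => b.coord i x) = fun x => b.coord i 0 + inner ℝ (baryGrad b i) x := by
      ext x
      rw [← coord_add, zero_add]
    rw [this]
    exact contDiff_const.add (contDiff_const.inner ℝ contDiff_id)
  have h1 := integral_hull_green (b := b) hd i hsm
  have h2 : ∫ x in sideSet b i, b.coord i x ∂(μHE[d - 1] : Measure (Euc d)) = 0 := by
    rw [setIntegral_congr_fun (isClosed_sideSet b i).measurableSet (g := fun _ => 0)
      (fun x hx => hx.2)]
    simp
  have hint : IntegrableOn (fun x => b.coord i x) (convexHull ℝ (Set.range b)) :=
    (continuous_coord b i).continuousOn.integrableOn_compact (isCompact_hull b)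
  have h3 : ∀ x, inner ℝ (x - b i) (gradient (fun x => b.coord i x) x) + d * b.coord i x =
      (d + 1) * b.coord i x - 1 := fun x => by
    rw [gradient_coord, real_inner_comm, inner_baryGrad_sub_self]
    ring
  rw [h2] at h1
  simp_rw [h3] at h1
  rw [integral_sub (hint.const_mul _) (continuous_const.continuousOn.integrableOn_compact
      (isCompact_hull b)),
    integral_const_mul] at h1
  simp at h1
  field_simp
  linarith

end SimplexGreen

/-! ### Conformity and the position of neighbouring simplices -/

namespace SimplicialMesh

variable {d : ℕ} {Ω : Set (Euc d)} {T S V : Type*} (M : SimplicialMesh d Ω T S V)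

lemma vert_injective (κ : T) : Function.Injective (M.vert κ) := fun i j h =>
  (M.simplex κ).ind.injective (by rw [M.simplex_apply, M.simplex_apply, h])

lemma side_injective (κ : T) : Function.Injective (M.side κ) := by
  intro i j h
  rw [M.side_eq_iff, (M.vert_injective κ).image_injective.eq_iff] at h
  exact Set.singleton_injective (compl_injective h)

lemma gradCoord_eq (κ : T) (i : Fin (d + 1)) : M.gradCoord κ i = baryGrad (M.simplex κ) i := rfl

lemma outNormal_eq (κ : T) (i : Fin (d + 1)) : M.outNormal κ i = baryNormal (M.simplex κ) i := rfl

lemma mem_hull {κ : T} {x : Euc d} : x ∈ M.hull κ ↔ ∀ i, 0 ≤ (M.simplex κ).coord i x :=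
  mem_hull_iff _

lemma vol_pos (κ : T) : 0 < M.vol κ := volume_hull_pos _

lemma isClosed_hull (κ : T) : IsClosed (M.hull κ) := (isCompact_hull _).isClosed

open Classical in
/-- The value in `x` of the affine function on the simplex `κ` that is `1` at the vertex `a` and
vanishes at the other ones. -/
def nodal (a : V) (κ : T) (x : Euc d) : ℝ :=
  ∑ i, if M.vert κ i = a then (M.simplex κ).coord i x else 0

lemma nodal_vert (κ : T) (i : Fin (d + 1)) (x : Euc d) :
    M.nodal (M.vert κ i) κ x = (M.simplex κ).coord i x := by
  rw [nodal, Finset.sum_eq_single i]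
  · simp
  · intro j _ hj
    rw [if_neg fun h => hj (M.vert_injective κ h)]
  · simp

lemma nodal_of_ne {a : V} {κ : T} (h : ∀ i, M.vert κ i ≠ a) (x : Euc d) : M.nodal a κ x = 0 :=
  Finset.sum_eq_zero fun i _ => if_neg (h i)

lemma nodal_add_smul {a : V} {κ : T} {x y : Euc d} {s t : ℝ} (h : s + t = 1) :
    M.nodal a κ (s • x + t • y) = s * M.nodal a κ x + t * M.nodal a κ y := by
  simp only [nodal, Finset.mul_sum, ← Finset.sum_add_distrib]
  refine Finset.sum_congr rfl fun i _ => ?_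
  split_ifs
  · exact Convex.combo_affine_apply h
  · simp

lemma nodal_node [DecidableEq V] (a : V) (κ : T) (i : Fin (d + 1)) :
    M.nodal a κ (M.node (M.vert κ i)) = if M.vert κ i = a then 1 else 0 := by
  classical
  by_cases h : ∃ j, M.vert κ j = a
  · obtain ⟨j, rfl⟩ := h
    rw [nodal_vert, ← M.simplex_apply, AffineBasis.coord_apply]
    simp [(M.vert_injective κ).eq_iff, eq_comm]
  · push Not at h
    rw [nodal_of_ne M h, if_neg (h i)]

/-- The nodal functions of two simplices agree on their intersection. -/
lemma nodal_eq (a : V) {κ κ' : T} {x : Euc d} (h : x ∈ M.hull κ) (h' : x ∈ M.hull κ') :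
    M.nodal a κ x = M.nodal a κ' x := by
  classical
  by_cases hκ : κ = κ'
  · rw [hκ]
  -- By conformity a common point is a convex combination of common vertices. Both nodal functions
  -- are affine and take the same values, zero or one, at these vertices.
  have hx : x ∈ convexHull ℝ (Set.range (M.simplex κ) ∩ Set.range (M.simplex κ')) := by
    rw [← (M.conforming κ κ' hκ).2]
    exact ⟨h, h'⟩
  have hconv : Convex ℝ {x | M.nodal a κ x = M.nodal a κ' x} := by
    intro x hx y hy s t _ _ hst
    simp only [Set.mem_ofPred_eq] at *
    rw [nodal_add_smul M hst, nodal_add_smul M hst, hx, hy]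
  refine convexHull_min ?_ hconv hx
  rintro _ ⟨⟨i, rfl⟩, ⟨j, hj⟩⟩
  rw [M.simplex_apply, M.simplex_apply] at hj
  have hv := M.node_injective hj
  simp only [Set.mem_ofPred_eq]
  rw [M.simplex_apply, nodal_node]
  conv_rhs => rw [← hv, nodal_node]
  rw [hv]

lemma exists_vert_of_nodal_pos {a : V} {κ : T} {x : Euc d} (h : M.nodal a κ x ≠ 0) :
    ∃ i, M.vert κ i = a := by
  by_contra hc
  push Not at hc
  exact h (M.nodal_of_ne hc x)

/-- A vertex of `κ` with a positive coordinate in a point common with `κ'` belongs to `κ'`. -/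
lemma exists_vert_of_coord_pos {κ κ' : T} {x : Euc d} (h : x ∈ M.hull κ) (h' : x ∈ M.hull κ')
    {i : Fin (d + 1)} (hi : 0 < (M.simplex κ).coord i x) : ∃ j, M.vert κ' j = M.vert κ i := by
  refine M.exists_vert_of_nodal_pos (x := x) ?_
  rw [← M.nodal_eq _ h h', nodal_vert]
  exact hi.ne'

lemma coord_eq_of_vert_eq {κ κ' : T} {x : Euc d} (h : x ∈ M.hull κ) (h' : x ∈ M.hull κ')
    {i j : Fin (d + 1)} (hij : M.vert κ i = M.vert κ' j) :
    (M.simplex κ).coord i x = (M.simplex κ').coord j x := by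
  rw [← nodal_vert, ← nodal_vert, hij, M.nodal_eq _ h h']

lemma range_simplex (κ : T) : Set.range (M.simplex κ) = M.node '' Set.range (M.vert κ) := by
  rw [← Set.range_comp]
  congr 1
  ext1 i
  exact M.simplex_apply κ i

lemma eq_of_range_vert_subset {κ κ' : T} (h : Set.range (M.vert κ) ⊆ Set.range (M.vert κ')) :
    κ = κ' := by
  by_contra hne
  refine (M.conforming κ κ' hne).1 ?_
  rw [range_simplex, range_simplex]
  congr 1
  refine Set.eq_of_subset_of_ncard_le h ?_ (Set.finite_range _)
  rw [← Set.image_univ, ← Set.image_univ, Set.ncard_image_of_injective _ (M.vert_injective κ),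
    Set.ncard_image_of_injective _ (M.vert_injective κ')]

/-- Different simplices have no common interior points. -/
lemma eq_of_coord_pos {κ κ' : T} {x : Euc d} (h : ∀ i, 0 < (M.simplex κ).coord i x)
    (h' : x ∈ M.hull κ') : κ = κ' := by
  refine M.eq_of_range_vert_subset ?_
  rintro _ ⟨i, rfl⟩
  exact M.exists_vert_of_coord_pos (M.mem_hull.2 fun i => (h i).le) h' (h i)

lemma mem_interior_hull {κ : T} {x : Euc d} :
    x ∈ interior (M.hull κ) ↔ ∀ i, 0 < (M.simplex κ).coord i x := by
  rw [hull, AffineBasis.interior_convexHull]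
  rfl

lemma faceVertices_side (κ : T) (i : Fin (d + 1)) :
    M.faceVertices (M.side κ i) = M.vert κ '' {i}ᶜ := by
  ext a
  constructor
  · rintro ⟨κ', i', j, hs, hj, rfl⟩
    rw [← (M.side_eq_iff κ' i' κ i).1 hs]
    exact ⟨j, hj, rfl⟩
  · rintro ⟨j, hj, rfl⟩
    exact ⟨κ, i, j, rfl, hj, rfl⟩

lemma faceHull_side (κ : T) (i : Fin (d + 1)) :
    M.faceHull (M.side κ i) = sideSet (M.simplex κ) i := by
  classical
  rw [faceHull, faceVertices_side, Set.image_image]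
  apply Set.Subset.antisymm
  · refine convexHull_min ?_ ?_
    · rintro _ ⟨j, hj, rfl⟩
      have hj : j ≠ i := hj
      beta_reduce
      rw [← M.simplex_apply]
      refine ⟨fun k => ?_, (M.simplex κ).coord_apply_ne hj.symm⟩
      rw [AffineBasis.coord_apply]
      split_ifs <;> norm_num
    · intro x hx y hy s t hs ht hst
      have hc : ∀ k, (M.simplex κ).coord k (s • x + t • y) =
          s • (M.simplex κ).coord k x + t • (M.simplex κ).coord k y := fun k =>
        Convex.combo_affine_apply hst
      refine ⟨fun k => ?_, ?_⟩
      · rw [hc]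
        exact add_nonneg (mul_nonneg hs (hx.1 k)) (mul_nonneg ht (hy.1 k))
      · rw [hc, hx.2, hy.2]
        simp
  · rintro x ⟨hx, hxi⟩
    rw [← (M.simplex κ).linear_combination_coord_eq_self x,
      ← Finset.sum_filter_of_ne (p := fun k => k ≠ i)]
    · refine (convex_convexHull ℝ _).sum_mem (fun k _ => hx k) ?_ fun k hk => ?_
      · rw [Finset.sum_filter_of_ne]
        · exact (M.simplex κ).sum_coord_apply_eq_one x
        · rintro k _ hk rfl
          exact hk hxi
      · refine subset_convexHull ℝ _ ⟨k, ?_, (M.simplex_apply κ k).symm⟩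
        simpa using hk
    · rintro k _ hk rfl
      exact hk (by rw [hxi, zero_smul])

lemma mem_faceHull {κ : T} {i : Fin (d + 1)} {x : Euc d} :
    x ∈ M.faceHull (M.side κ i) ↔ x ∈ M.hull κ ∧ (M.simplex κ).coord i x = 0 := by
  rw [faceHull_side, mem_hull]
  rfl

/-- If one of two simplices sharing a face had its opposite vertex on the same side, they would
overlap. -/
lemma coord_neg_of_side_eq (hd : 1 ≤ d) {κ κ' : T} {i i' : Fin (d + 1)} (hne : κ ≠ κ')
    (h : M.side κ i = M.side κ' i') :
    ∃ c : ℝ, c < 0 ∧ M.gradCoord κ' i' = c • M.gradCoord κ i := by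
  have hv := (M.side_eq_iff κ i κ' i').1 h
  have hv' : ∀ j ≠ i, (M.simplex κ').coord i' (M.simplex κ j) = 0 := by
    intro j hj
    obtain ⟨k, hk, hkj⟩ : M.vert κ j ∈ M.vert κ' '' {i'}ᶜ := hv ▸ ⟨j, hj, rfl⟩
    rw [M.simplex_apply, ← hkj, ← M.simplex_apply]
    exact (M.simplex κ').coord_apply_ne (Ne.symm hk)
  set c := (M.simplex κ').coord i' (M.simplex κ i) with hc
  -- The coordinate of `κ'` vanishes at every vertex of `κ` except the `i`-th one, so it is `c`
  -- times the `i`-th coordinate of `κ`.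
  have hg : M.gradCoord κ' i' = c • M.gradCoord κ i := by
    refine ext_inner_right ℝ fun v => ?_
    have h1 : ∀ y, (M.simplex κ').coord i' y = c * (M.simplex κ).coord i y := by
      intro y
      have h2 : (M.simplex κ').coord i' y =
          ∑ j, (M.simplex κ).coord j y * (M.simplex κ').coord i' (M.simplex κ j) := by
        conv_lhs => rw [← (M.simplex κ).affineCombination_coord_eq_self y]
        rw [Finset.map_affineCombination _ _ _ ((M.simplex κ).sum_coord_apply_eq_one y),
          Finset.affineCombination_eq_linear_combination _ _ _
            ((M.simplex κ).sum_coord_apply_eq_one y)]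
        rfl
      rw [h2, Finset.sum_eq_single i]
      · ring
      · intro j _ hj
        rw [hv' j hj, mul_zero]
      · simp
    rw [gradCoord_eq, gradCoord_eq, inner_smul_left]
    have h3 := coord_add (M.simplex κ') i' 0 v
    have h4 := coord_add (M.simplex κ) i 0 v
    rw [h1, h1, h4] at h3
    simp only [conj_trivial]
    linarith
  refine ⟨c, ?_, hg⟩
  by_contra hc0
  have hc1 : 0 < c := by
    refine lt_of_le_of_ne (not_lt.1 hc0) fun h0 => ?_
    rw [← h0, zero_smul] at hg
    exact baryGrad_ne_zero _ hd _ hg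
  -- a common interior point next to the barycentre of the common face
  obtain ⟨y, hy, hyi⟩ : ∃ y, (∀ j ≠ i, 0 < (M.simplex κ).coord j y) ∧
      (M.simplex κ).coord i y = 0 := by
    classical
    have hd0 : (0 : ℝ) < d := by exact_mod_cast hd
    let w : Fin (d + 1) → ℝ := fun j => if j = i then 0 else (d : ℝ)⁻¹
    have hw : ∑ j, w j = 1 := by
      simp only [w]
      rw [Finset.sum_ite, Finset.sum_const_zero, zero_add, Finset.sum_const, Finset.filter_ne']
      simp [hd0.ne']
    refine ⟨Finset.univ.affineCombination ℝ (M.simplex κ) w, fun j hj => ?_, ?_⟩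
    · rw [AffineBasis.coord_apply_combination_of_mem _ (Finset.mem_univ _) hw]
      simp [w, hj, hd0]
    · rw [AffineBasis.coord_apply_combination_of_mem _ (Finset.mem_univ _) hw]
      simp [w]
  have hyκ : y ∈ M.hull κ := M.mem_hull.2 fun j => by
    by_cases hj : j = i
    · rw [hj, hyi]
    · exact (hy j hj).le
  have hyf : y ∈ M.faceHull (M.side κ' i') := h ▸ M.mem_faceHull.2 ⟨hyκ, hyi⟩
  obtain ⟨hyκ', hyi'⟩ := M.mem_faceHull.1 hyf
  have hy' : ∀ j ≠ i', 0 < (M.simplex κ').coord j y := by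
    intro j hj
    obtain ⟨k, hk, hkj⟩ : M.vert κ' j ∈ M.vert κ '' {i}ᶜ := hv ▸ ⟨j, hj, rfl⟩
    rw [← M.coord_eq_of_vert_eq hyκ hyκ' hkj]
    exact hy k hk
  have hev : ∀ᶠ t : ℝ in 𝓝[>] 0, (∀ j, 0 < (M.simplex κ).coord j (y + t • M.gradCoord κ i)) ∧
      ∀ j, 0 < (M.simplex κ').coord j (y + t • M.gradCoord κ i) := by
    have hgp : 0 < ‖M.gradCoord κ i‖ := norm_pos_iff.2 (baryGrad_ne_zero _ hd _)
    have hcont : ∀ (κ : T) (j : Fin (d + 1)) (g : Euc d), 0 < (M.simplex κ).coord j y →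
        ∀ᶠ t : ℝ in 𝓝[>] 0, 0 < (M.simplex κ).coord j (y + t • g) := by
      intro κ j g hj
      have h1 : Continuous fun t : ℝ => (M.simplex κ).coord j (y + t • g) :=
        (continuous_coord _ j).comp (by fun_prop)
      refine nhdsWithin_le_nhds (h1.continuousAt.eventually (lt_mem_nhds ?_))
      simpa using hj
    rw [eventually_and, eventually_all, eventually_all]
    constructor
    · intro j
      by_cases hj : j = i
      · filter_upwards [self_mem_nhdsWithin] with t ht
        have ht : 0 < t := ht
        rw [hj, coord_add, hyi, inner_smul_right, ← gradCoord_eq, real_inner_self_eq_norm_sq]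
        positivity
      · exact hcont κ j _ (hy j hj)
    · intro j
      by_cases hj : j = i'
      · filter_upwards [self_mem_nhdsWithin] with t ht
        have ht : 0 < t := ht
        rw [hj, coord_add, hyi', inner_smul_right, ← gradCoord_eq, hg, inner_smul_left,
          real_inner_self_eq_norm_sq, conj_trivial]
        positivity
      · exact hcont κ' j _ (hy' j hj)
  obtain ⟨t, h1, h2⟩ := hev.exists
  exact hne (M.eq_of_coord_pos h1 (M.mem_hull.2 fun j => (h2 j).le))

lemma outNormal_eq_neg (hd : 1 ≤ d) {κ κ' : T} {i i' : Fin (d + 1)} (hne : κ ≠ κ')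
    (h : M.side κ i = M.side κ' i') : M.outNormal κ' i' = -M.outNormal κ i := by
  obtain ⟨c, hc, hg⟩ := M.coord_neg_of_side_eq hd hne h
  rw [outNormal, outNormal, hg, norm_smul, Real.norm_eq_abs, abs_of_neg hc, smul_smul]
  congr 1
  rw [mul_inv, mul_right_comm, neg_inv.symm, neg_mul, inv_mul_cancel₀ hc.ne]
  simp

lemma norm_outNormal (hd : 1 ≤ d) (κ : T) (i : Fin (d + 1)) : ‖M.outNormal κ i‖ = 1 :=
  norm_baryNormal hd i

/-- A face is shared by at most two simplices. -/
lemma side_eq_trichotomy (hd : 1 ≤ d) {q q' q'' : T × Fin (d + 1)}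
    (h : M.side q.1 q.2 = M.side q'.1 q'.2) (h' : M.side q.1 q.2 = M.side q''.1 q''.2)
    (hne : q ≠ q') (hne' : q ≠ q'') : q' = q'' := by
  have key : ∀ {q q' : T × Fin (d + 1)}, M.side q.1 q.2 = M.side q'.1 q'.2 → q ≠ q' →
      q.1 ≠ q'.1 := by
    rintro ⟨κ, i⟩ ⟨κ', i'⟩ h hne (rfl : κ = κ')
    exact hne (congrArg (Prod.mk κ) (M.side_injective κ h))
  -- Three simplices around one face would have pairwise opposite unit normals, hence a normal equal
  -- to its own negative.
  by_contra hc
  have h1 := M.outNormal_eq_neg hd (key h hne) h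
  have h2 := M.outNormal_eq_neg hd (key h' hne') h'
  have h3 := M.outNormal_eq_neg hd (key (h.symm.trans h') hc) (h.symm.trans h')
  rw [h1, h2, neg_neg] at h3
  have h4 : M.outNormal q.1 q.2 = 0 := by
    have h5 : (2 : ℝ) • M.outNormal q.1 q.2 = 0 := by
      rw [two_smul]
      nth_rewrite 1 [← h3]
      exact neg_add_cancel _
    exact (smul_eq_zero.1 h5).resolve_left two_ne_zero
  have := M.norm_outNormal hd q.1 q.2
  rw [h4] at this
  simp at this

end SimplicialMesh

/-! ### Faces and vertices relative to the boundary of the domain -/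

namespace SimplicialMesh

variable {d : ℕ} {Ω : Set (Euc d)} {T S V : Type*} (M : SimplicialMesh d Ω T S V)

lemma hull_subset_closure (κ : T) : M.hull κ ⊆ closure Ω := by
  rw [← M.cover]
  exact Set.subset_iUnion (fun κ => convexHull ℝ (Set.range (M.simplex κ))) κ

lemma exists_mem_hull {x : Euc d} (hx : x ∈ closure Ω) : ∃ κ, x ∈ M.hull κ := by
  rw [← M.cover] at hx
  exact Set.mem_iUnion.1 hx

lemma interior_hull_subset (hΩ : interior (closure Ω) = Ω) (κ : T) : interior (M.hull κ) ⊆ Ω :=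
  (interior_mono (M.hull_subset_closure κ)).trans hΩ.le

variable [Finite T]

/-- Near a point of `Ω`, the simplices containing this point cover everything. -/
lemma eventually_mem_hull (hΩ : IsOpen Ω) {z : Euc d} (hz : z ∈ Ω) :
    ∀ᶠ y in 𝓝 z, ∃ κ, y ∈ M.hull κ ∧ z ∈ M.hull κ := by
  have h1 : ∀ κ, ∀ᶠ y in 𝓝 z, y ∈ M.hull κ → z ∈ M.hull κ := by
    intro κ
    by_cases h : z ∈ M.hull κ
    · exact .of_forall fun _ _ => h
    · filter_upwards [(M.isClosed_hull κ).isOpen_compl.mem_nhds h] with y hy hy'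
      exact absurd hy' hy
  filter_upwards [hΩ.mem_nhds hz, eventually_all.2 h1] with y hy hall
  obtain ⟨κ, hκ⟩ := M.exists_mem_hull (subset_closure hy)
  exact ⟨κ, hκ, hall κ hκ⟩

/-- A face belonging to only one simplex lies on the boundary of `Ω`. -/
lemma faceHull_disjoint (hd : 1 ≤ d) (hΩ : IsOpen Ω) {κ : T} {i : Fin (d + 1)}
    (h : ∀ κ' i', M.side κ' i' = M.side κ i → κ' = κ) {x : Euc d}
    (hx : x ∈ M.faceHull (M.side κ i)) : x ∉ Ω := by
  classical
  intro hxΩ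
  obtain ⟨hxκ, hxi⟩ := M.mem_faceHull.1 hx
  rw [mem_hull] at hxκ
  have hd0 : (0 : ℝ) < d := by exact_mod_cast hd
  obtain ⟨y, hy, hyi⟩ : ∃ y, (∀ j ≠ i, 0 < (M.simplex κ).coord j y) ∧
      (M.simplex κ).coord i y = 0 := by
    let w : Fin (d + 1) → ℝ := fun j => if j = i then 0 else (d : ℝ)⁻¹
    have hw : ∑ j, w j = 1 := by
      simp only [w]
      rw [Finset.sum_ite, Finset.sum_const_zero, zero_add, Finset.sum_const, Finset.filter_ne']
      simp [hd0.ne']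
    refine ⟨Finset.univ.affineCombination ℝ (M.simplex κ) w, fun j hj => ?_, ?_⟩
    · rw [AffineBasis.coord_apply_combination_of_mem _ (Finset.mem_univ _) hw]
      simp [w, hj, hd0]
    · rw [AffineBasis.coord_apply_combination_of_mem _ (Finset.mem_univ _) hw]
      simp [w]
  -- The point `x` may lie on the rim of the face. A small move towards the barycentre `y` of the
  -- face reaches its relative interior without leaving the open set `Ω`.
  obtain ⟨z, hz, hzi, hzΩ⟩ : ∃ z, (∀ j ≠ i, 0 < (M.simplex κ).coord j z) ∧
      (M.simplex κ).coord i z = 0 ∧ z ∈ Ω := by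
    have h1 : Tendsto (fun t : ℝ => (1 - t) • x + t • y) (𝓝[>] 0) (𝓝 x) := by
      have : Continuous (fun t : ℝ => (1 - t) • x + t • y) := by fun_prop
      simpa using (this.tendsto 0).mono_left nhdsWithin_le_nhds
    obtain ⟨t, htΩ, ht⟩ := ((h1.eventually (hΩ.mem_nhds hxΩ)).and
      (Ioo_mem_nhdsGT (zero_lt_one' ℝ))).exists
    have hc : ∀ k, (M.simplex κ).coord k ((1 - t) • x + t • y) =
        (1 - t) • (M.simplex κ).coord k x + t • (M.simplex κ).coord k y := fun k =>
      Convex.combo_affine_apply (by ring)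
    refine ⟨_, fun j hj => ?_, ?_, htΩ⟩
    · rw [hc]
      exact add_pos_of_nonneg_of_pos (mul_nonneg (by linarith [ht.2]) (hxκ j))
        (mul_pos ht.1 (hy j hj))
    · rw [hc, hxi, hyi]
      simp
  -- Leaving `κ` at `z` along the exterior normal, one stays in `Ω` and enters a simplex `κ'` that
  -- also contains `z`; it is not `κ`, whose `i`-th coordinate has become negative.
  have h2 : Tendsto (fun t : ℝ => z + t • M.outNormal κ i) (𝓝[>] 0) (𝓝 z) := by
    have : Continuous (fun t : ℝ => z + t • M.outNormal κ i) := by fun_prop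
    simpa using (this.tendsto 0).mono_left nhdsWithin_le_nhds
  obtain ⟨t, ⟨κ', htκ', hzκ'⟩, ht⟩ := ((h2.eventually (M.eventually_mem_hull hΩ hzΩ)).and
    self_mem_nhdsWithin).exists
  have ht : 0 < t := ht
  have hzκ : z ∈ M.hull κ := M.mem_hull.2 fun j => by
    by_cases hj : j = i
    · rw [hj, hzi]
    · exact (hz j hj).le
  have hne : κ' ≠ κ := by
    rintro rfl
    have h3 := M.mem_hull.1 htκ' i
    rw [coord_add, hzi, inner_smul_right, outNormal_eq, inner_baryGrad_baryNormal hd] at h3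
    have := norm_pos_iff.2 (baryGrad_ne_zero (M.simplex κ') hd i)
    nlinarith
  -- All the vertices of the face have positive coordinates at `z`, so they belong to `κ'`. By
  -- counting, the face is then a side of `κ'`, contrary to the assumption.
  have hsub : M.vert κ '' {i}ᶜ ⊆ Set.range (M.vert κ') := by
    rintro _ ⟨j, hj, rfl⟩
    exact M.exists_vert_of_coord_pos hzκ hzκ' (hz j hj)
  obtain ⟨i', hi'⟩ : ∃ i', M.vert κ' i' ∉ M.vert κ '' {i}ᶜ := by
    by_contra hc
    push Not at hc
    refine hne (M.eq_of_range_vert_subset ?_)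
    rintro _ ⟨j, rfl⟩
    exact Set.image_subset_range _ _ (hc j)
  have hcard : ∀ (κ : T) (i : Fin (d + 1)), (M.vert κ '' {i}ᶜ).ncard = d := fun κ i => by
    rw [Set.ncard_image_of_injective _ (M.vert_injective κ), Set.ncard_compl]
    simp
  refine hne (h κ' i' ((M.side_eq_iff κ' i' κ i).2 (Eq.symm ?_)))
  refine Set.eq_of_subset_of_ncard_le ?_ (by rw [hcard, hcard]) (Set.toFinite _)
  intro a ha
  obtain ⟨j, rfl⟩ := hsub ha
  refine ⟨j, ?_, rfl⟩
  rintro (rfl : j = i')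
  exact hi' ha

/-- A point of a simplex lies inside `Ω` as soon as one of the vertices spanning the smallest face
around it does. -/
lemma mem_of_node_mem (hΩ : IsOpen Ω) (hΩr : interior (closure Ω) = Ω) {κ : T} {i : Fin (d + 1)}
    {x : Euc d} (hx : x ∈ M.hull κ) (hi : 0 < (M.simplex κ).coord i x)
    (ha : M.node (M.vert κ i) ∈ Ω) : x ∈ Ω := by
  set a := M.node (M.vert κ i) with haa
  have hline : Tendsto (fun t : ℝ => a + t • (x - a)) (𝓝[>] 0) (𝓝 a) := by
    have : Continuous (fun t : ℝ => a + t • (x - a)) := by fun_prop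
    simpa using (this.tendsto 0).mono_left nhdsWithin_le_nhds
  -- Contracting `x` towards the vertex `a` brings it into `Ω`, where the simplices cover a
  -- neighbourhood.
  obtain ⟨ε, hzΩ, hε⟩ := ((hline.eventually (hΩ.mem_nhds ha)).and
    (Ioo_mem_nhdsGT (zero_lt_one' ℝ))).exists
  set z := a + ε • (x - a) with hz
  have hcomb : ∀ y, a + ε • (y - a) = (1 - ε) • a + ε • y := fun y => by module
  have haκ : ∀ j, (M.simplex κ).coord j a = (M.simplex κ).coord j (M.simplex κ i) := fun j => by
    rw [haa, M.simplex_apply]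
  have hcz : ∀ k, (M.simplex κ).coord k z =
      (1 - ε) • (M.simplex κ).coord k a + ε • (M.simplex κ).coord k x := fun k => by
    rw [hz, hcomb]
    exact Convex.combo_affine_apply (by ring)
  have hzi : 0 < (M.simplex κ).coord i z := by
    rw [hcz, haκ, AffineBasis.coord_apply_eq]
    exact add_pos (mul_pos (by linarith [hε.2]) one_pos) (mul_pos hε.1 hi)
  have hzκ : z ∈ M.hull κ := by
    rw [hz, hcomb]
    refine (convex_convexHull ℝ _) ?_ hx (by linarith [hε.2]) hε.1.le (by ring)
    exact subset_convexHull ℝ _ ⟨i, M.simplex_apply κ i⟩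
  have hscale : Tendsto (fun y : Euc d => a + ε • (y - a)) (𝓝 x) (𝓝 z) := by
    have : Continuous (fun y : Euc d => a + ε • (y - a)) := by fun_prop
    exact this.tendsto x
  have hpos : ∀ κ' : T, x ∈ M.hull κ' → ∀ j, M.vert κ' j = M.vert κ i →
      ∀ᶠ y in 𝓝 x, 0 < (M.simplex κ').coord j y := by
    intro κ' hx' j hj
    refine (continuous_coord _ j).continuousAt.eventually (lt_mem_nhds ?_)
    beta_reduce
    rwa [M.coord_eq_of_vert_eq hx' hx hj]
  have hpos' : ∀ᶠ y in 𝓝 x, ∀ κ' : T, x ∈ M.hull κ' → ∀ j, M.vert κ' j = M.vert κ i →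
      0 < (M.simplex κ').coord j y := by
    refine eventually_all.2 fun κ' => ?_
    by_cases hx' : x ∈ M.hull κ'
    · have := eventually_all.2 fun j => show ∀ᶠ y in 𝓝 x, M.vert κ' j = M.vert κ i →
          0 < (M.simplex κ').coord j y from by
        by_cases hj : M.vert κ' j = M.vert κ i
        · filter_upwards [hpos κ' hx' j hj] with y hy _ using hy
        · exact .of_forall fun _ h => absurd h hj
      filter_upwards [this] with y hy _ using hy
    · exact .of_forall fun _ h => absurd h hx'
  -- the simplices around `z` have `a` as a vertex, and dilating them from `a` covers `x`
  have hsc : ∀ κ' : T, z ∈ M.hull κ' → ∀ y, a + ε • (y - a) ∈ M.hull κ' →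
      ∃ j, M.vert κ' j = M.vert κ i ∧ ∀ k ≠ j, 0 ≤ (M.simplex κ').coord k y := by
    intro κ' hzκ' y hy
    obtain ⟨j, hj⟩ := M.exists_vert_of_coord_pos hzκ hzκ' hzi
    refine ⟨j, hj, fun k hk => ?_⟩
    have h1 := M.mem_hull.1 hy k
    have h2 : (M.simplex κ').coord k a = 0 := by
      rw [haa, ← hj, ← M.simplex_apply]
      exact (M.simplex κ').coord_apply_ne hk
    have h3 : (M.simplex κ').coord k (a + ε • (y - a)) =
        (1 - ε) • (M.simplex κ').coord k a + ε • (M.simplex κ').coord k y := by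
      rw [hcomb]
      exact Convex.combo_affine_apply (by ring)
    rw [h3, h2, smul_zero, zero_add] at h1
    exact (mul_nonneg_iff_of_pos_left hε.1).1 h1
  have hxκ' : ∀ κ' : T, z ∈ M.hull κ' → x ∈ M.hull κ' := by
    intro κ' hzκ'
    obtain ⟨j, hj, hk⟩ := hsc κ' hzκ' x hzκ'
    refine M.mem_hull.2 fun k => ?_
    by_cases hkj : k = j
    · subst hkj
      have h1 := M.coord_eq_of_vert_eq hzκ' hzκ hj
      have h3 : (M.simplex κ').coord k z =
          (1 - ε) • (M.simplex κ').coord k a + ε • (M.simplex κ').coord k x := by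
        rw [hz, hcomb]
        exact Convex.combo_affine_apply (by ring)
      have h4 : (M.simplex κ').coord k a = 1 := by
        rw [haa, ← hj, ← M.simplex_apply, AffineBasis.coord_apply_eq]
      rw [h3, hcz, h4, haκ, AffineBasis.coord_apply_eq] at h1
      have h5 : (M.simplex κ').coord k x = (M.simplex κ).coord i x := by
        have h6 := add_left_cancel h1
        exact mul_left_cancel₀ hε.1.ne' h6
      rw [h5]
      exact hi.le
    · exact hk k hkj
  -- For `y` near `x` the contracted point lies in some `κ'` that has `a` as a vertex. The other
  -- coordinates are only scaled by `ε`, so they are nonnegative at `y` too, and that of `a` is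
  -- positive near `x` by continuity. Hence a neighbourhood of `x` lies in `closure Ω`, and
  -- regularity of `Ω` concludes.
  rw [← hΩr, mem_interior_iff_mem_nhds]
  filter_upwards [hscale.eventually (M.eventually_mem_hull hΩ hzΩ), hpos'] with y hy hy'
  obtain ⟨κ', hyκ', hzκ'⟩ := hy
  obtain ⟨j, hj, hk⟩ := hsc κ' hzκ' y hyκ'
  refine M.hull_subset_closure κ' (M.mem_hull.2 fun k => ?_)
  by_cases hkj : k = j
  · subst hkj
    exact (hy' κ' (hxκ' κ' hzκ') k hj).le
  · exact hk k hkj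

end SimplicialMesh

/-! ### Splitting integrals over the simplices -/

namespace SimplicialMesh

variable {d : ℕ} {Ω : Set (Euc d)} {T S V : Type*} (M : SimplicialMesh d Ω T S V)

/-- A vertex of `κ` missing from `κ'` has zero coordinate on the whole intersection, which therefore
lies in a hyperplane. -/
lemma volume_inter_eq_zero (hd : 1 ≤ d) {κ κ' : T} (h : κ ≠ κ') :
    volume (M.hull κ ∩ M.hull κ') = 0 := by
  obtain ⟨i, hi⟩ : ∃ i, M.vert κ i ∉ Set.range (M.vert κ') := by
    by_contra hc
    push Not at hc
    refine h (M.eq_of_range_vert_subset ?_)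
    rintro _ ⟨i, rfl⟩
    exact hc i
  refine measure_mono_null (fun x hx => ?_) (volume_coord_eq_zero (M.simplex κ) hd i 0)
  by_contra hc
  refine hi ?_
  exact M.exists_vert_of_coord_pos hx.1 hx.2 (lt_of_le_of_ne (M.mem_hull.1 hx.1 i) (Ne.symm hc))

lemma restrict_iUnion_hull (hd : 1 ≤ d) {ι : Type*} [Fintype ι] {e : ι → T}
    (he : Function.Injective e) :
    (volume : Measure (Euc d)).restrict (⋃ k, M.hull (e k)) =
      ∑ k, volume.restrict (M.hull (e k)) := by
  rw [Measure.restrict_iUnion_ae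
    (fun k l h => M.volume_inter_eq_zero hd (he.ne h))
    (fun k => (M.isClosed_hull (e k)).measurableSet.nullMeasurableSet), Measure.sum_fintype]

variable [Fintype T]

/-- No regularity of the boundary is needed: since `Ω` contains the interior of every simplex, its
boundary is covered by finitely many frontiers of convex sets. -/
lemma volume_closure_diff (M : SimplicialMesh d Ω T S V) (hΩr : interior (closure Ω) = Ω) :
    volume (closure Ω \ Ω) = 0 := by
  have h : closure Ω \ Ω ⊆ ⋃ κ, frontier (M.hull κ) := by
    rintro x ⟨hx, hxΩ⟩
    obtain ⟨κ, hκ⟩ := M.exists_mem_hull hx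
    refine Set.mem_iUnion.2 ⟨κ, subset_closure hκ, fun hi => hxΩ ?_⟩
    exact M.interior_hull_subset hΩr κ hi
  refine measure_mono_null h (measure_iUnion_null fun κ => ?_)
  exact (convex_convexHull ℝ _).addHaar_frontier volume

/-- Integration over `Ω` is integration over the simplices. -/
lemma restrict_eq_sum (hd : 1 ≤ d) (hΩr : interior (closure Ω) = Ω) :
    (volume : Measure (Euc d)).restrict Ω = ∑ κ, volume.restrict (M.hull κ) := by
  have h2 := M.restrict_iUnion_hull hd Function.injective_id
  simp only [id] at h2
  rw [← h2]
  refine Measure.restrict_congr_set ?_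
  have h1 : (⋃ κ, M.hull κ) = closure Ω := by
    rw [← M.cover]
    rfl
  rw [h1]
  exact subset_closure.eventuallyLE.antisymm
    (ae_le_set.2 (M.volume_closure_diff hΩr))

end SimplicialMesh

/-! ### Lowest-order Raviart–Thomas polynomials on one simplex -/

section RaviartThomas

variable {d : ℕ} (b : AffineBasis (Fin (d + 1)) ℝ (Euc d))

namespace PolytopalMesh

lemma rtEval_add (w w' : Euc d × ℝ) (x : Euc d) :
    rtEval (w + w') x = rtEval w x + rtEval w' x := by
  simp only [rtEval, Prod.fst_add, Prod.snd_add]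
  module

lemma rtEval_smul (c : ℝ) (w : Euc d × ℝ) (x : Euc d) : rtEval (c • w) x = c • rtEval w x := by
  simp only [rtEval, Prod.smul_fst, Prod.smul_snd, smul_eq_mul]
  module

lemma continuous_rtEval (w : Euc d × ℝ) : Continuous (rtEval w) := by
  unfold rtEval
  fun_prop

lemma divergence_rtEval (w : Euc d × ℝ) (x : Euc d) : divergence (rtEval w) x = d * w.2 := by
  have h : HasFDerivAt (rtEval w) (w.2 • ContinuousLinearMap.id ℝ (Euc d)) x := by
    unfold rtEval
    exact ((hasFDerivAt_id x).const_smul w.2).const_add w.1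
  rw [divergence, h.fderiv]
  simp [mul_comm]

/-- The normal outflux of an `RT₀` polynomial through the `i`-th side of a simplex. -/
def rtDof (i : Fin (d + 1)) : Euc d × ℝ →ₗ[ℝ] ℝ where
  toFun w := -(d * volume.real (convexHull ℝ (Set.range b))) *
    (inner ℝ (baryGrad b i) w.1 - w.2 * b.coord i 0)
  map_add' w w' := by
    simp only [Prod.fst_add, Prod.snd_add, inner_add_right]
    ring
  map_smul' c w := by
    simp only [Prod.smul_fst, Prod.smul_snd, smul_eq_mul, inner_smul_right, RingHom.id_apply]
    ring

/-- The `RT₀` polynomial with the normal outfluxes `F`. -/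
def rtOfDof (F : Fin (d + 1) → ℝ) : Euc d × ℝ :=
  ∑ i, (F i / (d * volume.real (convexHull ℝ (Set.range b)))) • (-b i, (1 : ℝ))

variable {b}

lemma inner_baryGrad_rtEval (i : Fin (d + 1)) (w : Euc d × ℝ) (x : Euc d) :
    inner ℝ (baryGrad b i) (rtEval w x) =
      inner ℝ (baryGrad b i) w.1 - w.2 * b.coord i 0 + w.2 * b.coord i x := by
  have := coord_add b i 0 x
  rw [zero_add] at this
  rw [rtEval, inner_add_right, inner_smul_right, this]
  ring

/-- The normal component of `a + b x` is constant on each hyperplane `λᵢ = const`, so any point of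
the side can be used. The factor arises because the area of the side times its exterior unit normal
is `-d |κ| ∇λᵢ`. -/
lemma rtDof_eq {i : Fin (d + 1)} (w : Euc d × ℝ) {x : Euc d} (hx : b.coord i x = 0) :
    rtDof b i w = -(d * volume.real (convexHull ℝ (Set.range b))) *
      inner ℝ (baryGrad b i) (rtEval w x) := by
  rw [inner_baryGrad_rtEval, hx, mul_zero, add_zero]
  rfl

lemma rtDof_eq_area (hd : 1 ≤ d) {i : Fin (d + 1)} (w : Euc d × ℝ) {x : Euc d}
    (hx : b.coord i x = 0) :
    rtDof b i w = (μHE[d - 1] : Measure (Euc d)).real (sideSet b i) *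
      inner ℝ (rtEval w x) (baryNormal b i) := by
  rw [rtDof_eq w hx, area_sideSet_eq hd, baryGrad_eq hd, inner_neg_left, inner_smul_left,
    real_inner_comm, ← baryGrad_eq hd]
  simp only [conj_trivial]
  ring

lemma rtEval_sum {ι : Type*} (s : Finset ι) (w : ι → Euc d × ℝ) (x : Euc d) :
    rtEval (∑ k ∈ s, w k) x = ∑ k ∈ s, rtEval (w k) x := by
  simp only [rtEval, Prod.fst_sum, Prod.snd_sum, Finset.sum_smul, Finset.sum_add_distrib]

lemma rtEval_rtOfDof (F : Fin (d + 1) → ℝ) (x : Euc d) :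
    rtEval (rtOfDof b F) x =
      ∑ i, (F i / (d * volume.real (convexHull ℝ (Set.range b)))) • (x - b i) := by
  rw [rtOfDof, rtEval_sum]
  refine Finset.sum_congr rfl fun i _ => ?_
  rw [rtEval_smul, rtEval, one_smul, neg_add_eq_sub]

/-- The coefficient of `x - bᵢ` is `b λᵢ(x) - ∇λᵢ · w(x)`, with `b` the slope of `w`. The identities
`∑ λᵢ = 1`, `∑ λᵢ(x) bᵢ = x`, `∑ ∇λᵢ = 0` and `∑ (∇λᵢ · v) bᵢ = v` cancel everything except `w(x)`.
-/
lemma rtEval_eq_sum (hd : 1 ≤ d) (w : Euc d × ℝ) (x : Euc d) :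
    rtEval w x =
      ∑ i, (rtDof b i w / (d * volume.real (convexHull ℝ (Set.range b)))) • (x - b i) := by
  have hv := volume_hull_pos b
  have hd0 : (0 : ℝ) < d := by exact_mod_cast hd
  have h1 : ∀ i, rtDof b i w / (d * volume.real (convexHull ℝ (Set.range b))) =
      w.2 * b.coord i x - inner ℝ (baryGrad b i) (rtEval w x) := fun i => by
    rw [inner_baryGrad_rtEval, rtDof]
    simp only [LinearMap.coe_mk, AddHom.coe_mk]
    field_simp
    ring
  simp only [h1, sub_smul, Finset.sum_sub_distrib, smul_sub, ← Finset.sum_smul, ← sum_inner,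
    sum_baryGrad, sum_inner_baryGrad_smul, mul_smul, ← Finset.smul_sum,
    b.sum_coord_apply_eq_one, b.linear_combination_coord_eq_self]
  simp

lemma rtDof_rtOfDof (hd : 1 ≤ d) (F : Fin (d + 1) → ℝ) (i : Fin (d + 1)) :
    rtDof b i (rtOfDof b F) = F i := by
  have hv := volume_hull_pos b
  have hd0 : (0 : ℝ) < d := by exact_mod_cast hd
  obtain ⟨x, hx⟩ : ∃ x, b.coord i x = 0 := by
    obtain ⟨j, hj⟩ : ∃ j : Fin (d + 1), j ≠ i := by
      have : Nontrivial (Fin (d + 1)) := Fin.nontrivial_iff_two_le.2 (by omega)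
      exact exists_ne i
    exact ⟨b j, b.coord_apply_ne hj.symm⟩
  rw [rtDof_eq _ hx, rtEval_rtOfDof, inner_sum, Finset.sum_eq_single i]
  · rw [inner_smul_right, inner_baryGrad_sub_self, hx]
    field_simp
    ring
  · intro j _ hj
    rw [inner_smul_right, inner_baryGrad_sub b hj.symm, hx, mul_zero]
  · simp

/-- Two distinct points suffice: the difference of the values determines the slope, since `d ≥ 1`,
and then either value determines the constant part. -/
lemma eq_of_rtEval_eqOn {w w' : Euc d × ℝ} (hd : 1 ≤ d) {U : Set (Euc d)} (hU : IsOpen U)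
    (hne : U.Nonempty) (h : ∀ x ∈ U, rtEval w x = rtEval w' x) : w = w' := by
  obtain ⟨x, hx⟩ := hne
  have : Nontrivial (Euc d) := by
    have : Nonempty (Fin d) := ⟨⟨0, hd⟩⟩
    infer_instance
  obtain ⟨v, hv⟩ := exists_ne (0 : Euc d)
  have h1 : Tendsto (fun t : ℝ => x + t • v) (𝓝[>] 0) (𝓝 x) := by
    have : Continuous (fun t : ℝ => x + t • v) := by fun_prop
    simpa using (this.tendsto 0).mono_left nhdsWithin_le_nhds
  obtain ⟨t, htU, ht⟩ := ((h1.eventually (hU.mem_nhds hx)).and self_mem_nhdsWithin).exists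
  have ht : 0 < t := ht
  have e1 := h x hx
  have e2 := h _ htU
  simp only [rtEval] at e1 e2
  have e3 : (t * (w.2 - w'.2)) • v = 0 := by
    have e4 : (t * (w.2 - w'.2)) • v =
        (w.1 + w.2 • (x + t • v)) - (w'.1 + w'.2 • (x + t • v)) -
          ((w.1 + w.2 • x) - (w'.1 + w'.2 • x)) := by module
    rw [e4, e1, e2]
    simp
  have e5 : w.2 = w'.2 := by
    have := (smul_eq_zero.1 e3).resolve_right hv
    have := (mul_eq_zero.1 this).resolve_left ht.ne'
    linarith
  rw [e5] at e1
  exact Prod.ext (add_right_cancel e1) e5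

lemma rtDof_injective (hd : 1 ≤ d) {w w' : Euc d × ℝ} (h : ∀ i, rtDof b i w = rtDof b i w') :
    w = w' := by
  refine eq_of_rtEval_eqOn hd isOpen_univ ⟨0, trivial⟩ fun x _ => ?_
  rw [rtEval_eq_sum (b := b) hd w, rtEval_eq_sum (b := b) hd w']
  simp only [h]

/-- The divergence theorem for a field of constant divergence, in algebraic form: `∑ ∇λᵢ = 0` and `∑
λᵢ(0) = 1`. -/
lemma sum_rtDof (w : Euc d × ℝ) :
    ∑ i, rtDof b i w = d * w.2 * volume.real (convexHull ℝ (Set.range b)) := by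
  simp only [rtDof, LinearMap.coe_mk, AddHom.coe_mk]
  rw [← Finset.mul_sum, Finset.sum_sub_distrib, ← Finset.mul_sum, ← sum_inner, sum_baryGrad,
    b.sum_coord_apply_eq_one, inner_zero_left]
  ring

lemma integrableOn_inner_rtEval (w w' : Euc d × ℝ) :
    IntegrableOn (fun x => inner ℝ (rtEval w x) (rtEval w' x)) (convexHull ℝ (Set.range b)) :=
  ((continuous_rtEval w).inner (continuous_rtEval w')).continuousOn.integrableOn_compact
    (isCompact_hull b)

variable (b) in
/-- The `L²` scalar product of two `RT₀` polynomials on a simplex. -/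
def rtForm : LinearMap.BilinForm ℝ (Euc d × ℝ) :=
  LinearMap.mk₂ ℝ (fun w w' => ∫ x in convexHull ℝ (Set.range b), inner ℝ (rtEval w x) (rtEval w' x))
    (by
      intro w w' w''
      rw [← integral_add]
      · simp only [rtEval_add, inner_add_left]
      all_goals exact integrableOn_inner_rtEval _ _)
    (by
      intro c w w'
      rw [smul_eq_mul, ← integral_const_mul]
      simp only [rtEval_smul, inner_smul_left, conj_trivial])
    (by
      intro w w' w''
      rw [← integral_add]
      · simp only [rtEval_add, inner_add_right]
      all_goals exact integrableOn_inner_rtEval _ _)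
    (by
      intro c w w'
      rw [smul_eq_mul, ← integral_const_mul]
      simp only [rtEval_smul, inner_smul_right])

lemma rtForm_apply (w w' : Euc d × ℝ) :
    rtForm b w w' = ∫ x in convexHull ℝ (Set.range b), inner ℝ (rtEval w x) (rtEval w' x) := rfl

lemma rtForm_comm (w w' : Euc d × ℝ) : rtForm b w w' = rtForm b w' w := by
  simp only [rtForm_apply, real_inner_comm]

lemma rtForm_self (w : Euc d × ℝ) :
    rtForm b w w = ∫ x in convexHull ℝ (Set.range b), ‖rtEval w x‖ ^ 2 := by
  simp only [rtForm_apply, real_inner_self_eq_norm_sq]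

lemma rtForm_self_nonneg (w : Euc d × ℝ) : 0 ≤ rtForm b w w := by
  rw [rtForm_self]
  positivity

lemma eq_zero_of_rtForm_self (hd : 1 ≤ d) {w : Euc d × ℝ} (h : rtForm b w w = 0) : w = 0 := by
  have hc : Continuous fun x => ‖rtEval w x‖ ^ 2 := (continuous_rtEval w).norm.pow 2
  rw [rtForm_self, integral_eq_zero_iff_of_nonneg (fun _ => by positivity)
    (hc.continuousOn.integrableOn_compact (isCompact_hull b))] at h
  have h1 : (fun x => ‖rtEval w x‖ ^ 2) =ᵐ[volume.restrict (interior (convexHull ℝ (Set.range b)))]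
      fun _ => 0 := ae_restrict_of_ae_restrict_of_subset interior_subset h
  have h2 := Measure.eqOn_open_of_ae_eq h1 isOpen_interior
    hc.continuousOn continuousOn_const
  refine eq_of_rtEval_eqOn hd isOpen_interior (interior_hull_nonempty b) fun x hx => ?_
  have h3 : ‖rtEval w x‖ ^ 2 = 0 := h2 hx
  rw [norm_eq_zero.1 (pow_eq_zero_iff two_ne_zero |>.1 h3)]
  simp [rtEval]

end PolytopalMesh

end RaviartThomas

/-! ### Degrees of freedom of Raviart–Thomas fields on a cell -/

namespace PolytopalMesh

variable {d : ℕ} {Ω : Set (Euc d)} {T S V C F : Type*} [Fintype T] [Fintype S] [Fintype V]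
  [Fintype C] [Fintype F] (M : PolytopalMesh d Ω T S V C F)

variable {M} in
lemma onBoundary_or_inside {K : C} (κ : M.Sub K) (i : Fin (d + 1)) :
    M.OnBoundary M.cell K (M.side κ.1 i) ∨ M.Inside M.cell K (M.side κ.1 i) := by
  by_contra h
  push Not at h
  refine h.1 ⟨(κ.1, i), ⟨κ.2, rfl⟩, fun q hq => ?_⟩
  by_contra hne
  exact h.2 ⟨q, (κ.1, i), hne, hq, κ.2, rfl⟩

variable {M} in
lemma not_inside_of_onBoundary {K : C} {σ : S} (h : M.OnBoundary M.cell K σ) :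
    ¬M.Inside M.cell K σ := by
  rintro ⟨q, q', hne, hq, hq'⟩
  exact hne (h.unique hq hq')

/-- The orientation of the basis function of the `i`-th side of `κ ∈ 𝒯_K`: with respect to the
exterior normal of `κ`. -/
def fluxSign (K : C) (q : M.Sub K × Fin (d + 1)) : ℝ :=
  open Classical in if M.OnBoundary M.cell K (M.side q.1.1 q.2) then 1
    else inner ℝ (M.outNormal q.1.1 q.2) (M.normal (M.side q.1.1 q.2))

lemma inner_outNormal_normal (hd : 1 ≤ d) (κ : T) (i : Fin (d + 1)) :
    inner ℝ (M.outNormal κ i) (M.normal (M.side κ i)) = (1 : ℝ) ∨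
      inner ℝ (M.outNormal κ i) (M.normal (M.side κ i)) = (-1 : ℝ) := by
  rcases M.normal_eq_or κ i with h | h
  · left
    rw [h, real_inner_self_eq_norm_sq, M.norm_outNormal hd, one_pow]
  · right
    rw [h, inner_neg_right, real_inner_self_eq_norm_sq, M.norm_outNormal hd, one_pow]

lemma fluxSign_mul_self (hd : 1 ≤ d) (K : C) (q : M.Sub K × Fin (d + 1)) :
    M.fluxSign K q * M.fluxSign K q = 1 := by
  unfold fluxSign
  split_ifs
  · norm_num
  · rcases M.inner_outNormal_normal hd q.1.1 q.2 with h | h <;> rw [h] <;> norm_num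

variable {M} in
lemma fluxSign_of_onBoundary {K : C} {q : M.Sub K × Fin (d + 1)}
    (h : M.OnBoundary M.cell K (M.side q.1.1 q.2)) : M.fluxSign K q = 1 := if_pos h

variable {M} in
lemma ne_of_side_eq {K : C} {q q' : M.Sub K × Fin (d + 1)} (hne : q ≠ q')
    (h : M.side q.1.1 q.2 = M.side q'.1.1 q'.2) : q.1 ≠ q'.1 := by
  obtain ⟨κ, i⟩ := q
  obtain ⟨κ', i'⟩ := q'
  rintro (rfl : κ = κ')
  exact hne (congrArg (Prod.mk κ) (M.side_injective κ.1 h))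

variable {M} in
lemma fluxSign_eq_neg (hd : 1 ≤ d) {K : C} {q q' : M.Sub K × Fin (d + 1)} (hne : q ≠ q')
    (h : M.side q.1.1 q.2 = M.side q'.1.1 q'.2) : M.fluxSign K q' = -M.fluxSign K q := by
  have hκ := ne_of_side_eq hne h
  have h1 : ¬M.OnBoundary M.cell K (M.side q.1.1 q.2) := fun hb =>
    not_inside_of_onBoundary hb ⟨(q.1.1, q.2), (q'.1.1, q'.2), fun he =>
      hκ (Subtype.ext (congrArg Prod.fst he)), ⟨q.1.2, rfl⟩, q'.1.2, h.symm⟩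
  unfold fluxSign
  rw [if_neg h1, if_neg (h ▸ h1), ← h,
    M.outNormal_eq_neg hd (fun he => hκ (Subtype.ext he)) h, inner_neg_left]

open Classical in
variable {M} in
lemma sum_side_of_onBoundary {K : C} {σ : S} (h : M.OnBoundary M.cell K σ)
    (q : M.Sub K × Fin (d + 1)) (hq : M.side q.1.1 q.2 = σ) (g : M.Sub K × Fin (d + 1) → ℝ) :
    ∑ p : M.Sub K × Fin (d + 1), (if M.side p.1.1 p.2 = σ then g p else 0) = g q := by
  rw [Finset.sum_eq_single q]
  · rw [if_pos hq]
  · intro p _ hp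
    rw [if_neg]
    intro hs
    have := h.unique (y₁ := (p.1.1, p.2)) (y₂ := (q.1.1, q.2)) ⟨p.1.2, hs⟩ ⟨q.1.2, hq⟩
    simp only [Prod.mk.injEq] at this
    exact hp (Prod.ext (Subtype.ext this.1) this.2)
  · simp

open Classical in
variable {M} in
lemma sum_side_of_inside (hd : 1 ≤ d) {K : C} {σ : S} {q q' : M.Sub K × Fin (d + 1)} (hne : q ≠ q')
    (hq : M.side q.1.1 q.2 = σ) (hq' : M.side q'.1.1 q'.2 = σ)
    (g : M.Sub K × Fin (d + 1) → ℝ) :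
    ∑ p : M.Sub K × Fin (d + 1), (if M.side p.1.1 p.2 = σ then g p else 0) = g q + g q' := by
  rw [← Finset.sum_pair hne, ← Finset.sum_subset (Finset.subset_univ {q, q'})]
  · refine Finset.sum_congr rfl fun p hp => ?_
    simp only [Finset.mem_insert, Finset.mem_singleton] at hp
    rcases hp with rfl | rfl
    · rw [if_pos hq]
    · rw [if_pos hq']
  · intro p _ hp
    simp only [Finset.mem_insert, Finset.mem_singleton, not_or] at hp
    rw [if_neg]
    intro hs
    have := M.side_eq_trichotomy hd (q := (q.1.1, q.2)) (q' := (q'.1.1, q'.2))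
      (q'' := (p.1.1, p.2)) (hq.trans hq'.symm) (hq.trans hs.symm)
      (fun he => ne_of_side_eq hne (hq.trans hq'.symm) (Subtype.ext (congrArg Prod.fst he)))
      (fun he => ne_of_side_eq (Ne.symm hp.1) (hq.trans hs.symm)
        (Subtype.ext (congrArg Prod.fst he)))
    simp only [Prod.mk.injEq] at this
    exact hp.2 (Prod.ext (Subtype.ext this.1.symm) this.2.symm)

variable {M} in
lemma exists_pair_of_inside {K : C} {σ : S} (h : M.Inside M.cell K σ) :
    ∃ q q' : M.Sub K × Fin (d + 1), q ≠ q' ∧ M.side q.1.1 q.2 = σ ∧ M.side q'.1.1 q'.2 = σ := by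
  obtain ⟨q, q', hne, hq, hq'⟩ := h
  refine ⟨(⟨q.1, hq.1⟩, q.2), (⟨q'.1, hq'.1⟩, q'.2), fun he => hne ?_, hq.2, hq'.2⟩
  have h1 : q.1 = q'.1 := congrArg (fun p => p.1.1) he
  have h2 : q.2 = q'.2 := congrArg (fun p => p.2) he
  exact Prod.ext h1 h2

variable {M} in
lemma exists_of_onBoundary {K : C} {σ : S} (h : M.OnBoundary M.cell K σ) :
    ∃ q : M.Sub K × Fin (d + 1), M.side q.1.1 q.2 = σ := by
  obtain ⟨q, hq, -⟩ := h
  exact ⟨(⟨q.1, hq.1⟩, q.2), hq.2⟩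

/-! ### Degrees of freedom on a cell -/

/-- The outflux of `u` through a side of a simplex of `𝒯_K`. -/
def dof (K : C) (u : M.Sub K → Euc d × ℝ) (q : M.Sub K × Fin (d + 1)) : ℝ :=
  rtDof (M.simplex q.1.1) q.2 (u q.1)

open Classical in
/-- The coefficients of the basis function `𝐯_σ`. -/
def basisCoef (K : C) (σ : S) : M.Sub K → Euc d × ℝ := fun κ =>
  rtOfDof (M.simplex κ.1) fun i => if M.side κ.1 i = σ then M.fluxSign K (κ, i) else 0

lemma rtEval_basisCoef (K : C) (σ : S) (κ : M.Sub K) (x : Euc d) :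
    rtEval (M.basisCoef K σ κ) x = M.rtBasis K σ κ x := by
  classical
  rw [basisCoef, rtEval_rtOfDof, rtBasis]
  refine Finset.sum_congr rfl fun i _ => ?_
  split_ifs with h h'
  · subst h
    rw [fluxSign_of_onBoundary h']
    rfl
  · subst h
    rw [fluxSign, if_neg h']
    rfl
  · simp

open Classical in
lemma dof_basisCoef (hd : 1 ≤ d) (K : C) (σ : S) (q : M.Sub K × Fin (d + 1)) :
    M.dof K (M.basisCoef K σ) q = if M.side q.1.1 q.2 = σ then M.fluxSign K q else 0 := by
  rw [dof, basisCoef, rtDof_rtOfDof hd]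

/-- The `RT₀` field with given coefficients on the faces of `∂K` and inside `K`. -/
def ofCoef (K : C) (e : M.ExtFace K → ℝ) (y : M.IntFace K → ℝ) : M.Sub K → Euc d × ℝ :=
  ∑ σ, e σ • M.basisCoef K σ.1 + ∑ σ, y σ • M.basisCoef K σ.1

lemma dof_ofCoef_ext (hd : 1 ≤ d) (K : C) (e : M.ExtFace K → ℝ) (y : M.IntFace K → ℝ)
    (q : M.Sub K × Fin (d + 1)) (h : M.OnBoundary M.cell K (M.side q.1.1 q.2)) :
    M.dof K (M.ofCoef K e y) q = e ⟨_, h⟩ := by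
  classical
  have h1 : M.dof K (M.ofCoef K e y) q = ∑ σ, e σ * M.dof K (M.basisCoef K σ.1) q +
      ∑ σ, y σ * M.dof K (M.basisCoef K σ.1) q := by
    simp [dof, ofCoef, Finset.sum_apply]
  simp only [h1, M.dof_basisCoef hd]
  let a : M.ExtFace K := ⟨_, h⟩
  rw [Finset.sum_eq_single a, Finset.sum_eq_zero]
  · simp [a, fluxSign_of_onBoundary h]
  · rintro ⟨σ, hσ⟩ -
    rw [if_neg, mul_zero]
    rintro rfl
    exact not_inside_of_onBoundary h hσ
  · rintro ⟨σ, hσ⟩ - hne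
    rw [if_neg, mul_zero]
    rintro rfl
    exact hne rfl
  · simp

lemma dof_ofCoef_int (hd : 1 ≤ d) (K : C) (e : M.ExtFace K → ℝ) (y : M.IntFace K → ℝ)
    (q : M.Sub K × Fin (d + 1)) (h : M.Inside M.cell K (M.side q.1.1 q.2)) :
    M.dof K (M.ofCoef K e y) q = y ⟨_, h⟩ * M.fluxSign K q := by
  classical
  have h1 : M.dof K (M.ofCoef K e y) q = ∑ σ, e σ * M.dof K (M.basisCoef K σ.1) q +
      ∑ σ, y σ * M.dof K (M.basisCoef K σ.1) q := by
    simp [dof, ofCoef, Finset.sum_apply]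
  simp only [h1, M.dof_basisCoef hd]
  let a : M.IntFace K := ⟨_, h⟩
  rw [Finset.sum_eq_zero, Finset.sum_eq_single a]
  · simp [a]
  · rintro ⟨σ, hσ⟩ - hne
    rw [if_neg, mul_zero]
    rintro rfl
    exact hne rfl
  · simp
  · rintro ⟨σ, hσ⟩ -
    rw [if_neg, mul_zero]
    rintro rfl
    exact not_inside_of_onBoundary hσ h

variable {M} in
lemma eq_of_dof_eq (hd : 1 ≤ d) {K : C} {u v : M.Sub K → Euc d × ℝ}
    (h : ∀ q, M.dof K u q = M.dof K v q) : u = v :=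
  funext fun κ => rtDof_injective (b := M.simplex κ.1) hd fun i => h (κ, i)

/-- The normal traces of `u` are continuous over the faces inside `K`. -/
def IsBalanced (K : C) (u : M.Sub K → Euc d × ℝ) : Prop :=
  ∀ q q' : M.Sub K × Fin (d + 1), q ≠ q' → M.side q.1.1 q.2 = M.side q'.1.1 q'.2 →
    M.dof K u q' = -M.dof K u q

/-- The outfluxes of `u` through the faces of `∂K`. -/
def HasExtFlux (K : C) (u : M.Sub K → Euc d × ℝ) (e : M.ExtFace K → ℝ) : Prop :=
  ∀ (q : M.Sub K × Fin (d + 1)) (h : M.OnBoundary M.cell K (M.side q.1.1 q.2)),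
    M.dof K u q = e ⟨_, h⟩

lemma isBalanced_ofCoef (hd : 1 ≤ d) (K : C) (e : M.ExtFace K → ℝ) (y : M.IntFace K → ℝ) :
    M.IsBalanced K (M.ofCoef K e y) := by
  intro q q' hne h
  have hin : M.Inside M.cell K (M.side q.1.1 q.2) := by
    refine ⟨(q.1.1, q.2), (q'.1.1, q'.2), fun he => ?_, ⟨q.1.2, rfl⟩, q'.1.2, h.symm⟩
    exact ne_of_side_eq hne h (Subtype.ext (congrArg Prod.fst he))
  rw [M.dof_ofCoef_int hd K e y q hin, M.dof_ofCoef_int hd K e y q' (h ▸ hin),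
    fluxSign_eq_neg hd hne h]
  simp only [h, mul_neg]

lemma hasExtFlux_ofCoef (hd : 1 ≤ d) (K : C) (e : M.ExtFace K → ℝ) (y : M.IntFace K → ℝ) :
    M.HasExtFlux K (M.ofCoef K e y) e := fun q h => M.dof_ofCoef_ext hd K e y q h

-- Balance makes the fluxes seen from the two sides of an interior face opposite, exactly as the
-- signs of the basis function are. The coefficient can therefore be read off from either adjacent
-- simplex, and an arbitrary choice `r` is made.
variable {M} in
lemma exists_eq_ofCoef (hd : 1 ≤ d) {K : C} {u : M.Sub K → Euc d × ℝ} {e : M.ExtFace K → ℝ}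
    (hu : M.IsBalanced K u) (he : M.HasExtFlux K u e) : ∃ y, u = M.ofCoef K e y := by
  have hch : ∀ σ : M.IntFace K, ∃ q : M.Sub K × Fin (d + 1), M.side q.1.1 q.2 = σ.1 := fun σ => by
    obtain ⟨q, -, -, hq, -⟩ := exists_pair_of_inside σ.2
    exact ⟨q, hq⟩
  choose r hr using hch
  refine ⟨fun σ => M.dof K u (r σ) * M.fluxSign K (r σ), eq_of_dof_eq hd fun q => ?_⟩
  rcases onBoundary_or_inside q.1 q.2 with h | h
  · rw [M.dof_ofCoef_ext hd K e _ q h, he q h]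
  · rw [M.dof_ofCoef_int hd K e _ q h]
    by_cases hq : r ⟨_, h⟩ = q
    · rw [hq, mul_assoc, M.fluxSign_mul_self hd, mul_one]
    · rw [hu _ q hq (hr ⟨_, h⟩), fluxSign_eq_neg hd hq (hr ⟨_, h⟩), mul_assoc, mul_neg,
        M.fluxSign_mul_self hd]
      ring

variable {M} in
/-- Summation over the sides of the simplices of `𝒯_K`: the faces inside `K` do not contribute. -/
lemma sum_dof_mul (hd : 1 ≤ d) {K : C} {u : M.Sub K → Euc d × ℝ} {e : M.ExtFace K → ℝ}
    (hu : M.IsBalanced K u) (he : M.HasExtFlux K u e) (m : S → ℝ) :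
    ∑ q : M.Sub K × Fin (d + 1), M.dof K u q * m (M.side q.1.1 q.2) = ∑ σ, e σ * m σ.1 := by
  classical
  have h1 : ∀ q : M.Sub K × Fin (d + 1), M.dof K u q * m (M.side q.1.1 q.2) =
      ∑ σ, if M.side q.1.1 q.2 = σ then M.dof K u q * m σ else 0 := fun q => by simp
  have h2 : ∀ σ : S, (∑ q : M.Sub K × Fin (d + 1),
      if M.side q.1.1 q.2 = σ then M.dof K u q * m σ else 0) =
        if h : M.OnBoundary M.cell K σ then e ⟨σ, h⟩ * m σ else 0 := by
    intro σ
    split_ifs with h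
    · obtain ⟨q, rfl⟩ := exists_of_onBoundary h
      rw [sum_side_of_onBoundary h q rfl fun p => M.dof K u p * m (M.side q.1.1 q.2), he q h]
    · by_cases hin : M.Inside M.cell K σ
      · obtain ⟨q, q', hne, hq, hq'⟩ := exists_pair_of_inside hin
        rw [sum_side_of_inside hd hne hq hq' fun p => M.dof K u p * m σ,
          hu q q' hne (hq.trans hq'.symm)]
        ring
      · refine Finset.sum_eq_zero fun q _ => if_neg ?_
        rintro rfl
        rcases onBoundary_or_inside q.1 q.2 with h' | h'
        · exact h h'
        · exact hin h'
  simp only [h1]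
  rw [Finset.sum_comm]
  simp only [h2]
  rw [Finset.sum_dite, Finset.sum_const_zero, add_zero]
  refine Finset.sum_bij (fun σ _ => (⟨σ.1, (Finset.mem_filter.1 σ.2).2⟩ : M.ExtFace K)) ?_ ?_ ?_ ?_
  · exact fun _ _ => Finset.mem_univ _
  · intro a _ b _ hab
    exact Subtype.ext (congrArg (fun p : M.ExtFace K => p.1) hab)
  · intro σ _
    exact ⟨⟨σ.1, Finset.mem_filter.2 ⟨Finset.mem_univ _, σ.2⟩⟩, Finset.mem_attach _ _, rfl⟩
  · exact fun _ _ => rfl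

end PolytopalMesh

/-! ### The Schur complement of a saddle-point problem -/

section SaddlePoint

open Matrix

variable {I X J : Type*} [Fintype I] [Fintype X] [Fintype J] [DecidableEq I] [DecidableEq J]

/-- The Schur complement of a saddle-point matrix gives the energy of the solution of the saddle
point problem. -/
lemma exists_saddle_point (Aii : Matrix I I ℝ) (Aie : Matrix I X ℝ) (Aee : Matrix X X ℝ)
    (Bi : Matrix J I ℝ) (Be : Matrix J X ℝ) (hpos : ∀ y, y ⬝ᵥ (Aii *ᵥ y) = 0 → y = 0)
    (hinj : ∀ p, Biᵀ *ᵥ p = 0 → p = 0) (U : X → ℝ) :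
    ∃ y p, Aii *ᵥ y + Aie *ᵥ U + Biᵀ *ᵥ p = 0 ∧ Bi *ᵥ y + Be *ᵥ U = 0 ∧
      U ⬝ᵥ ((Aee - (fromRows Aie Be)ᵀ * (fromBlocks Aii Biᵀ Bi 0)⁻¹ * fromRows Aie Be) *ᵥ U) =
        U ⬝ᵥ (Aee *ᵥ U) + 2 * (y ⬝ᵥ (Aie *ᵥ U)) + y ⬝ᵥ (Aii *ᵥ y) := by
  set B : Matrix (I ⊕ J) (I ⊕ J) ℝ := fromBlocks Aii Biᵀ Bi 0 with hB
  have hBz : ∀ z, B *ᵥ z = Sum.elim (Aii *ᵥ (z ∘ Sum.inl) + Biᵀ *ᵥ (z ∘ Sum.inr))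
      (Bi *ᵥ (z ∘ Sum.inl)) := fun z => by
    rw [hB, fromBlocks_mulVec]
    simp
  have htr : ∀ (y : I → ℝ) (p : J → ℝ), y ⬝ᵥ (Biᵀ *ᵥ p) = (Bi *ᵥ y) ⬝ᵥ p := fun y p => by
    rw [dotProduct_mulVec, vecMul_transpose]
  -- For a kernel vector `(y, p)`, pairing the first row with `y` removes the multiplier term since
  -- `Bi y = 0`. Definiteness gives `y = 0`, and injectivity of `Biᵀ` gives `p = 0`.
  have hdet : IsUnit B.det := by
    rw [isUnit_iff_ne_zero]
    intro h0
    obtain ⟨z, hz, hBz0⟩ := exists_mulVec_eq_zero_iff.2 h0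
    rw [hBz] at hBz0
    have h1 : Aii *ᵥ (z ∘ Sum.inl) + Biᵀ *ᵥ (z ∘ Sum.inr) = 0 :=
      funext fun i => congrFun hBz0 (Sum.inl i)
    have h2 : Bi *ᵥ (z ∘ Sum.inl) = 0 := funext fun i => congrFun hBz0 (Sum.inr i)
    have h3 : z ∘ Sum.inl = 0 := by
      refine hpos _ ?_
      have := congrArg ((z ∘ Sum.inl) ⬝ᵥ ·) h1
      simp only [dotProduct_add, htr, h2, zero_dotProduct, dotProduct_zero, add_zero] at this
      exact this
    rw [h3, mulVec_zero, zero_add] at h1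
    have h4 := hinj _ h1
    refine hz (funext fun k => ?_)
    rcases k with k | k
    · exact congrFun h3 k
    · exact congrFun h4 k
  set z := -(B⁻¹ *ᵥ (fromRows Aie Be *ᵥ U)) with hz
  have hBz1 : B *ᵥ z = -(fromRows Aie Be *ᵥ U) := by
    rw [hz, mulVec_neg, mulVec_mulVec, mul_nonsing_inv _ hdet, one_mulVec]
  rw [hBz, fromRows_mulVec] at hBz1
  set y := z ∘ Sum.inl
  set p := z ∘ Sum.inr
  have h1 : Aii *ᵥ y + Biᵀ *ᵥ p = -(Aie *ᵥ U) := funext fun i => congrFun hBz1 (Sum.inl i)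
  have h2 : Bi *ᵥ y = -(Be *ᵥ U) := funext fun i => congrFun hBz1 (Sum.inr i)
  refine ⟨y, p, ?_, by rw [h2, neg_add_cancel], ?_⟩
  · rw [add_right_comm, h1, neg_add_cancel]
  have h3 : U ⬝ᵥ (((fromRows Aie Be)ᵀ * B⁻¹ * fromRows Aie Be) *ᵥ U) =
      -((Aie *ᵥ U) ⬝ᵥ y + (Be *ᵥ U) ⬝ᵥ p) := by
    rw [← mulVec_mulVec, ← mulVec_mulVec, dotProduct_mulVec, vecMul_transpose,
      show B⁻¹ *ᵥ (fromRows Aie Be *ᵥ U) = -z by rw [hz, neg_neg], dotProduct_neg,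
      fromRows_mulVec]
    congr 1
    simp only [dotProduct, Fintype.sum_sum_type, Sum.elim_inl, Sum.elim_inr, y, p,
      Function.comp_apply]
  -- Testing the first row with `y` and using the constraint `Bi y = -Be U` eliminates the
  -- multiplier, leaving energy terms only.
  have h4 : (Be *ᵥ U) ⬝ᵥ p = y ⬝ᵥ (Aii *ᵥ y) + y ⬝ᵥ (Aie *ᵥ U) := by
    have h5 := htr y p
    have h6 := congrArg (y ⬝ᵥ ·) h1
    simp only [dotProduct_add, dotProduct_neg] at h6
    rw [h2, neg_dotProduct] at h5
    linarith
  rw [sub_mulVec, dotProduct_sub, h3, h4, dotProduct_comm (Aie *ᵥ U) y]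
  ring

end SaddlePoint

/-! ### The mixed finite element method in terms of coefficients -/

namespace PolytopalMesh

variable {d : ℕ} {Ω : Set (Euc d)} {T S V C F : Type*} [Fintype T] [Fintype S] [Fintype V]
  [Fintype C] [Fintype F] (M : PolytopalMesh d Ω T S V C F)

lemma faceArea_side (κ : T) (i : Fin (d + 1)) :
    M.faceArea (M.side κ i) = (μHE[d - 1] : Measure (Euc d)).real (sideSet (M.simplex κ) i) := by
  rw [faceArea, M.faceHull_side]

lemma faceArea_pos (hd : 1 ≤ d) (κ : T) (i : Fin (d + 1)) : 0 < M.faceArea (M.side κ i) := by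
  rw [M.faceArea_side]
  exact area_sideSet_pos hd i

lemma dof_eq_faceArea (hd : 1 ≤ d) {K : C} (u : M.Sub K → Euc d × ℝ)
    (q : M.Sub K × Fin (d + 1)) {x : Euc d} (hx : x ∈ M.faceHull (M.side q.1.1 q.2)) :
    M.dof K u q = M.faceArea (M.side q.1.1 q.2) *
      inner ℝ (rtEval (u q.1) x) (M.outNormal q.1.1 q.2) := by
  rw [M.faceHull_side] at hx
  rw [dof, rtDof_eq_area hd _ hx.2, M.faceArea_side]
  rfl

lemma faceHull_nonempty (hd : 1 ≤ d) (κ : T) (i : Fin (d + 1)) :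
    (M.faceHull (M.side κ i)).Nonempty := by
  by_contra h
  have := M.faceArea_pos hd κ i
  rw [faceArea, Set.not_nonempty_iff_eq_empty.1 h] at this
  simp at this

lemma elemFlux_side {U : F → ℝ} {K : C} (q : M.Sub K × Fin (d + 1))
    (h : M.OnBoundary M.cell K (M.side q.1.1 q.2)) :
    M.elemFlux U K ⟨_, h⟩ = inner ℝ (M.outNormal q.1.1 q.2) (M.normal (M.side q.1.1 q.2)) *
      M.subFlux U (M.side q.1.1 q.2) := by
  obtain ⟨⟨κ, rfl⟩, i⟩ := q
  change inner ℝ (M.outward (M.cell κ) (M.parent (M.side κ i))) (M.normal (M.side κ i)) * _ = _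
  rw [M.outward_eq κ i h]

lemma integral_normal (hd : 1 ≤ d) {K : C} (u : M.Sub K → Euc d × ℝ)
    (q : M.Sub K × Fin (d + 1)) :
    ∫ x in M.faceHull (M.side q.1.1 q.2),
        inner ℝ (rtEval (u q.1) x) (M.normal (M.side q.1.1 q.2)) ∂(μHE[d - 1] : Measure (Euc d)) =
      inner ℝ (M.outNormal q.1.1 q.2) (M.normal (M.side q.1.1 q.2)) * M.dof K u q := by
  have hA := M.faceArea_pos hd q.1.1 q.2
  have hmeas : MeasurableSet (M.faceHull (M.side q.1.1 q.2)) := by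
    rw [M.faceHull_side]
    exact (isClosed_sideSet _ _).measurableSet
  have h1 : ∀ x ∈ M.faceHull (M.side q.1.1 q.2),
      inner ℝ (rtEval (u q.1) x) (M.normal (M.side q.1.1 q.2)) =
        inner ℝ (M.outNormal q.1.1 q.2) (M.normal (M.side q.1.1 q.2)) *
          (M.dof K u q / M.faceArea (M.side q.1.1 q.2)) := by
    intro x hx
    rw [M.dof_eq_faceArea hd u q hx, mul_div_cancel_left₀ _ hA.ne']
    rcases M.normal_eq_or q.1.1 q.2 with h | h
    · rw [h, real_inner_self_eq_norm_sq, M.norm_outNormal hd, one_pow, one_mul]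
    · rw [h, inner_neg_right, inner_neg_right, real_inner_self_eq_norm_sq, M.norm_outNormal hd]
      ring
  rw [setIntegral_congr_fun hmeas h1, setIntegral_const, smul_eq_mul]
  change M.faceArea (M.side q.1.1 q.2) * _ = _
  field_simp

/-- Normal components are constant on each face, so pointwise continuity of the normal traces and
prescribed integral fluxes are both conditions on one number per face. The orientation `±1` of the
fixed normal squares to one. -/
lemma memVN_iff (hd : 1 ≤ d) {U : F → ℝ} {K : C} {u : M.Sub K → Euc d × ℝ} :
    M.MemVN U K u ↔ M.IsBalanced K u ∧ M.HasExtFlux K u (M.elemFlux U K) := by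
  refine and_congr ⟨fun h q q' hne hs => ?_, fun h κ κ' i i' hne hs x hx => ?_⟩
    ⟨fun h q hb => ?_, fun h κ i hb => ?_⟩
  · obtain ⟨x, hx⟩ := M.faceHull_nonempty hd q.1.1 q.2
    rw [M.dof_eq_faceArea hd u q hx, M.dof_eq_faceArea hd u q' (hs ▸ hx),
      h q.1 q'.1 q.2 q'.2 (ne_of_side_eq hne hs) hs x hx, hs]
    ring
  · have h1 := h (κ, i) (κ', i') (fun he => hne (congrArg Prod.fst he)) hs
    rw [M.dof_eq_faceArea hd u (κ, i) hx, M.dof_eq_faceArea hd u (κ', i') (hs ▸ hx)] at h1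
    simp only at h1
    rw [← hs, ← mul_neg] at h1
    rw [mul_left_cancel₀ (M.faceArea_pos hd κ.1 i).ne' h1, neg_neg]
  · have h1 := h q.1 q.2 hb
    rw [M.integral_normal hd u q] at h1
    rw [M.elemFlux_side q hb, ← h1, ← mul_assoc]
    rcases M.inner_outNormal_normal hd q.1.1 q.2 with h2 | h2 <;> rw [h2] <;> ring
  · rw [M.integral_normal hd u (κ, i), h (κ, i) hb, M.elemFlux_side (κ, i) hb, ← mul_assoc]
    simp only
    rcases M.inner_outNormal_normal hd κ.1 i with h2 | h2 <;> rw [h2] <;> ring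

/-! ### The `L²` product and the divergence in terms of coefficients -/

/-- The `L²(K)` scalar product. -/
def cellForm (K : C) : LinearMap.BilinForm ℝ (M.Sub K → Euc d × ℝ) :=
  ∑ κ : M.Sub K, (rtForm (M.simplex κ.1)).compl₁₂ (LinearMap.proj κ) (LinearMap.proj κ)

lemma cellForm_apply (K : C) (u v : M.Sub K → Euc d × ℝ) :
    M.cellForm K u v = ∑ κ : M.Sub K, rtForm (M.simplex κ.1) (u κ) (v κ) := by
  simp [cellForm, LinearMap.sum_apply]

lemma cellForm_comm (K : C) (u v : M.Sub K → Euc d × ℝ) :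
    M.cellForm K u v = M.cellForm K v u := by
  simp only [cellForm_apply]
  exact Finset.sum_congr rfl fun κ _ => rtForm_comm _ _

lemma cellForm_self (K : C) (u : M.Sub K → Euc d × ℝ) : M.cellForm K u u = M.energy K u := by
  simp only [cellForm_apply, energy, rtForm_self]
  rfl

lemma cellForm_self_nonneg (K : C) (u : M.Sub K → Euc d × ℝ) : 0 ≤ M.cellForm K u u := by
  rw [cellForm_apply]
  exact Finset.sum_nonneg fun κ _ => rtForm_self_nonneg _

variable {M} in
lemma eq_zero_of_cellForm_self (hd : 1 ≤ d) {K : C} {u : M.Sub K → Euc d × ℝ}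
    (h : M.cellForm K u u = 0) : u = 0 := by
  rw [cellForm_apply, Finset.sum_eq_zero_iff_of_nonneg fun κ _ => rtForm_self_nonneg _] at h
  exact funext fun κ => eq_zero_of_rtForm_self hd (h κ (Finset.mem_univ _))

lemma rtMass_eq (α : ℝ) (K : C) (σ σ' : S) :
    M.rtMass α K σ σ' = α * M.cellForm K (M.basisCoef K σ') (M.basisCoef K σ) := by
  simp only [rtMass, cellForm_apply, rtForm_apply, rtEval_basisCoef]
  rfl

lemma dotProduct_rtMass {A B : Type*} [Fintype A] [Fintype B] (α : ℝ) (K : C) (a : A → S)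
    (b : B → S) (y : A → ℝ) (z : B → ℝ) :
    y ⬝ᵥ ((Matrix.of fun σ σ' => M.rtMass α K (a σ) (b σ')) *ᵥ z) =
      α * M.cellForm K (∑ σ, z σ • M.basisCoef K (b σ)) (∑ σ, y σ • M.basisCoef K (a σ)) := by
  simp only [dotProduct, Matrix.mulVec, Matrix.of_apply, rtMass_eq, map_sum, map_smul,
    LinearMap.sum_apply, LinearMap.smul_apply, smul_eq_mul, Finset.mul_sum]
  refine Finset.sum_congr rfl fun σ _ => Finset.sum_congr rfl fun σ' _ => ?_
  ring

/-- The divergence of the `RT₀` field, constant in each simplex. -/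
def cellDiv (K : C) : (M.Sub K → Euc d × ℝ) →ₗ[ℝ] M.Sub K → ℝ where
  toFun u κ := d * (u κ).2
  map_add' u v := by
    ext κ
    simp [mul_add]
  map_smul' c u := by
    ext κ
    simp
    ring

lemma sum_dof (K : C) (u : M.Sub K → Euc d × ℝ) (κ : M.Sub K) :
    ∑ i, M.dof K u (κ, i) = M.cellDiv K u κ * M.vol κ.1 :=
  sum_rtDof (b := M.simplex κ.1) (u κ)

lemma hasConstDiv_iff (K : C) (u : M.Sub K → Euc d × ℝ) :
    M.HasConstDiv K u ↔ ∃ δ, ∀ κ, M.cellDiv K u κ = δ := by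
  refine exists_congr fun δ => forall_congr' fun κ => ?_
  simp only [divergence_rtEval]
  exact ⟨fun h => h 0, fun h _ => h⟩

lemma rtDiv_eq (K : C) (q : M.Sub K → ℝ) (σ : S) :
    M.rtDiv K q σ = -∑ κ, M.vol κ.1 * q κ * M.cellDiv K (M.basisCoef K σ) κ := by
  rw [rtDiv]
  congr 1
  refine Finset.sum_congr rfl fun κ _ => ?_
  have h1 : M.rtBasis K σ κ = rtEval (M.basisCoef K σ κ) :=
    funext fun x => (M.rtEval_basisCoef K σ κ x).symm
  simp only [h1, divergence_rtEval, setIntegral_const, smul_eq_mul]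
  change M.vol κ.1 * (d * (M.basisCoef K σ κ).2 * q κ) =
    M.vol κ.1 * q κ * (d * (M.basisCoef K σ κ).2)
  ring

lemma sum_rtDiv (K : C) (q : M.Sub K → ℝ) {A : Type*} [Fintype A] (a : A → S) (y : A → ℝ) :
    ∑ σ, M.rtDiv K q (a σ) * y σ =
      -∑ κ, M.vol κ.1 * q κ * M.cellDiv K (∑ σ, y σ • M.basisCoef K (a σ)) κ := by
  simp only [rtDiv_eq, map_sum, map_smul, Finset.sum_apply, Pi.smul_apply, smul_eq_mul,
    Finset.mul_sum, neg_mul, Finset.sum_neg_distrib, Finset.sum_mul]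
  rw [Finset.sum_comm]
  congr 1
  refine Finset.sum_congr rfl fun σ _ => Finset.sum_congr rfl fun σ' _ => ?_
  ring

lemma cell_sum_vol_pos (K : C) : 0 < ∑ κ : M.Sub K, M.vol κ.1 := by
  obtain ⟨κ, hκ⟩ := M.cell_surjective K
  exact Finset.sum_pos (fun κ _ => M.vol_pos κ.1) ⟨⟨κ, hκ⟩, Finset.mem_univ _⟩

/-- Conversely, the divergence minus its mean `m` over the cell is itself an admissible zero-mean
multiplier. Testing with it makes the sum of its squares, weighted by the volumes, vanish. -/
lemma hasConstDiv_iff_basis {J : Type*} [Fintype J] {K : C} (q : Module.Basis J ℝ (M.Q0 K))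
    (u : M.Sub K → Euc d × ℝ) :
    M.HasConstDiv K u ↔ ∀ l, ∑ κ, M.vol κ.1 * (q l).1 κ * M.cellDiv K u κ = 0 := by
  rw [hasConstDiv_iff]
  constructor
  · rintro ⟨δ, hδ⟩ l
    simp only [hδ, ← Finset.sum_mul]
    have : ∑ κ, M.vol κ.1 * (q l).1 κ = 0 := (q l).2
    rw [this, zero_mul]
  · intro h
    let Λ : M.Q0 K →ₗ[ℝ] ℝ :=
      (∑ κ : M.Sub K, (M.vol κ.1 * M.cellDiv K u κ) • LinearMap.proj κ) ∘ₗ (M.Q0 K).subtype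
    have hΛ : ∀ r : M.Q0 K, Λ r = ∑ κ, M.vol κ.1 * r.1 κ * M.cellDiv K u κ := fun r => by
      simp only [Λ, LinearMap.coe_comp, Function.comp_apply, LinearMap.sum_apply,
        LinearMap.smul_apply, LinearMap.proj_apply, smul_eq_mul, Submodule.subtype_apply]
      exact Finset.sum_congr rfl fun κ _ => by ring
    have hΛ0 : Λ = 0 := q.ext fun l => by rw [hΛ, h, LinearMap.zero_apply]
    set m := (∑ κ, M.vol κ.1 * M.cellDiv K u κ) / ∑ κ : M.Sub K, M.vol κ.1 with hm
    have hV := M.cell_sum_vol_pos K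
    have hr : (fun κ => M.cellDiv K u κ - m) ∈ M.Q0 K := by
      change ∑ κ, M.vol κ.1 * (M.cellDiv K u κ - m) = 0
      simp only [mul_sub, Finset.sum_sub_distrib, ← Finset.sum_mul]
      rw [hm]
      field_simp
      ring
    have h1 := hΛ ⟨_, hr⟩
    have h2 : ∑ κ, M.vol κ.1 * (M.cellDiv K u κ - m) = 0 := hr
    rw [hΛ0, LinearMap.zero_apply] at h1
    have h3 : ∑ κ : M.Sub K, M.vol κ.1 * (M.cellDiv K u κ - m) ^ 2 = 0 := by
      have h4 : ∀ κ : M.Sub K, M.vol κ.1 * (M.cellDiv K u κ - m) ^ 2 =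
          M.vol κ.1 * (M.cellDiv K u κ - m) * M.cellDiv K u κ -
            M.vol κ.1 * (M.cellDiv K u κ - m) * m := fun κ => by ring
      simp only [h4, Finset.sum_sub_distrib, ← Finset.sum_mul, h2]
      rw [← h1]
      ring
    rw [Finset.sum_eq_zero_iff_of_nonneg fun κ _ =>
      mul_nonneg (M.vol_pos κ.1).le (sq_nonneg _)] at h3
    refine ⟨m, fun κ => ?_⟩
    have h5 := (mul_eq_zero.1 (h3 κ (Finset.mem_univ _))).resolve_left (M.vol_pos κ.1).ne'
    have h6 := pow_eq_zero_iff two_ne_zero |>.1 h5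
    linarith

end PolytopalMesh

/-! ### The energy minimiser on a cell -/

namespace PolytopalMesh

variable {d : ℕ} {Ω : Set (Euc d)} {T S V C F : Type*} [Fintype T] [Fintype S] [Fintype V]
  [Fintype C] [Fintype F] (M : PolytopalMesh d Ω T S V C F)

variable {M} in
lemma sum_mul_cellDiv {K : C} (r : M.Sub K → ℝ) (u : M.Sub K → Euc d × ℝ) :
    ∑ κ, M.vol κ.1 * r κ * M.cellDiv K u κ =
      ∑ p : M.Sub K × Fin (d + 1), M.dof K u p * r p.1 := by
  rw [Fintype.sum_prod_type]
  refine Finset.sum_congr rfl fun κ _ => ?_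
  change _ = ∑ i, M.dof K u (κ, i) * r κ
  rw [← Finset.sum_mul, M.sum_dof]
  ring

variable {M} in
/-- The divergence maps the `RT₀` fields without flux through `∂K` onto the piecewise constants of
zero mean value: a multiplier orthogonal to their range vanishes. -/
lemma eq_zero_of_rtDiv_eq_zero (hd : 1 ≤ d) {K : C} {r : M.Sub K → ℝ} (hr : r ∈ M.Q0 K)
    (h : ∀ σ : M.IntFace K, M.rtDiv K r σ.1 = 0) : r = 0 := by
  classical
  -- The divergence of the basis function of an interior face has opposite integrals over the two
  -- adjacent simplices, so testing with it measures the jump of `r` across the face.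
  have h1 : ∀ (κ κ' : M.Sub K) (i i' : Fin (d + 1)), κ ≠ κ' → M.side κ.1 i = M.side κ'.1 i' →
      r κ = r κ' := by
    intro κ κ' i i' hne hs
    have hin : M.Inside M.cell K (M.side κ.1 i) :=
      ⟨(κ.1, i), (κ'.1, i'), fun he => hne (Subtype.ext (congrArg Prod.fst he)), ⟨κ.2, rfl⟩,
        κ'.2, hs.symm⟩
    have h2 := h ⟨_, hin⟩
    have hne' : ((κ, i) : M.Sub K × Fin (d + 1)) ≠ (κ', i') := fun he => hne (congrArg Prod.fst he)
    simp only [rtDiv_eq, sum_mul_cellDiv, M.dof_basisCoef hd, ite_mul, zero_mul] at h2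
    rw [sum_side_of_inside hd hne' rfl hs.symm, fluxSign_eq_neg hd hne' hs] at h2
    have h3 : M.fluxSign K (κ, i) * (r κ - r κ') = 0 := by
      simp only at h2
      linarith
    rcases mul_eq_zero.1 h3 with h4 | h4
    · have := M.fluxSign_mul_self hd K (κ, i)
      rw [h4] at this
      norm_num at this
    · linarith
  let R : T → ℝ := fun κ => if hκ : M.cell κ = K then r ⟨κ, hκ⟩ else 0
  have hR : ∀ κ : M.Sub K, R κ.1 = r κ := fun κ => dif_pos κ.2
  have hstep : ∀ a b, (M.cell a = M.cell b ∧ ∃ i j, M.side a i = M.side b j) → R a = R b := by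
    rintro a b ⟨hc, i, j, hs⟩
    by_cases hab : a = b
    · rw [hab]
    by_cases ha : M.cell a = K
    · have hb := hc ▸ ha
      rw [hR ⟨a, ha⟩, hR ⟨b, hb⟩]
      exact h1 ⟨a, ha⟩ ⟨b, hb⟩ i j (fun he => hab (congrArg (fun p : M.Sub K => p.1) he)) hs
    · simp only [R]
      rw [dif_neg ha, dif_neg (hc ▸ ha)]
  -- Vanishing jumps propagate along chains of adjacent simplices. Connectedness of the cell is
  -- essential here: otherwise zero-mean functions constant on the components would remain.
  have h2 : ∀ κ κ' : M.Sub K, r κ = r κ' := by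
    intro κ κ'
    rw [← hR κ, ← hR κ']
    have hpath := M.cell_connected κ.1 κ'.1 (κ.2.trans κ'.2.symm)
    generalize κ'.1 = b at hpath
    induction hpath with
    | refl => rfl
    | tail _ hs ih => exact ih.trans (hstep _ _ hs)
  funext κ
  have h3 : ∑ κ', M.vol κ'.1 * r κ' = 0 := hr
  simp only [fun κ' => h2 κ' κ, ← Finset.sum_mul] at h3
  exact (mul_eq_zero.1 h3).resolve_left (M.cell_sum_vol_pos K).ne'

variable {M} in
lemma ofCoef_zero_left (K : C) (y : M.IntFace K → ℝ) :
    M.ofCoef K 0 y = ∑ σ, y σ • M.basisCoef K σ.1 := by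
  simp [ofCoef]

lemma ofCoef_sub (K : C) (e : M.ExtFace K → ℝ) (y y' : M.IntFace K → ℝ) :
    M.ofCoef K e y' - M.ofCoef K e y = M.ofCoef K 0 (y' - y) := by
  rw [ofCoef_zero_left]
  simp only [ofCoef, Pi.sub_apply, sub_smul, Finset.sum_sub_distrib]
  abel

variable {M} in
lemma eq_zero_of_ofCoef_eq_zero (hd : 1 ≤ d) {K : C} {y : M.IntFace K → ℝ}
    (h : M.ofCoef K 0 y = 0) : y = 0 := by
  funext σ
  obtain ⟨q, -, -, hq, -⟩ := exists_pair_of_inside σ.2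
  obtain ⟨σ, hσ⟩ := σ
  simp only at hq
  subst hq
  have h1 := M.dof_ofCoef_int hd K 0 y q hσ
  rw [h] at h1
  have h2 : M.dof K 0 q = 0 := by simp [dof]
  rw [h2] at h1
  have h3 := M.fluxSign_mul_self hd K q
  rcases mul_eq_zero.1 h1.symm with h4 | h4
  · exact h4
  · rw [h4] at h3
    norm_num at h3

/-- The minimal energy among the Raviart–Thomas fields of constant divergence with prescribed
fluxes through `∂K` is attained by a unique field, and is given by the mixed finite element
matrix. -/
theorem exists_cell_minimiser (hd : 1 ≤ d) {α : ℝ} (hα : 0 < α) (K : C) {J : Type*} [Fintype J]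
    (q : Module.Basis J ℝ (M.Q0 K)) (e : M.ExtFace K → ℝ) :
    ∃ u, M.IsBalanced K u ∧ M.HasExtFlux K u e ∧ M.HasConstDiv K u ∧
      (∀ w, M.IsBalanced K w → M.HasExtFlux K w e → M.HasConstDiv K w →
        M.energy K u ≤ M.energy K w ∧ (M.energy K w ≤ M.energy K u → w = u)) ∧
      e ⬝ᵥ (M.mfeMatrix α K q *ᵥ e) = α * M.energy K u := by
  classical
  let Aii : Matrix (M.IntFace K) (M.IntFace K) ℝ := .of fun σ σ' => M.rtMass α K σ.1 σ'.1
  let Aie : Matrix (M.IntFace K) (M.ExtFace K) ℝ := .of fun σ σ' => M.rtMass α K σ.1 σ'.1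
  let Aee : Matrix (M.ExtFace K) (M.ExtFace K) ℝ := .of fun σ σ' => M.rtMass α K σ.1 σ'.1
  let Bi : Matrix J (M.IntFace K) ℝ := .of fun l σ => M.rtDiv K (q l).1 σ.1
  let Be : Matrix J (M.ExtFace K) ℝ := .of fun l σ => M.rtDiv K (q l).1 σ.1
  have hBi : ∀ y l, (Bi *ᵥ y) l =
      -∑ κ, M.vol κ.1 * (q l).1 κ * M.cellDiv K (M.ofCoef K 0 y) κ := fun y l => by
    rw [ofCoef_zero_left]
    exact M.sum_rtDiv K (q l).1 (fun σ : M.IntFace K => σ.1) y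
  have hBe : ∀ l, (Be *ᵥ e) l =
      -∑ κ, M.vol κ.1 * (q l).1 κ * M.cellDiv K (∑ σ, e σ • M.basisCoef K σ.1) κ := fun l =>
    M.sum_rtDiv K (q l).1 (fun σ : M.ExtFace K => σ.1) e
  have hAii : ∀ y z, y ⬝ᵥ (Aii *ᵥ z) = α * M.cellForm K (M.ofCoef K 0 z) (M.ofCoef K 0 y) := by
    intro y z
    rw [ofCoef_zero_left, ofCoef_zero_left]
    exact M.dotProduct_rtMass α K (fun σ : M.IntFace K => σ.1) (fun σ : M.IntFace K => σ.1) y z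
  have hAie : ∀ y, y ⬝ᵥ (Aie *ᵥ e) =
      α * M.cellForm K (∑ σ, e σ • M.basisCoef K σ.1) (M.ofCoef K 0 y) := by
    intro y
    rw [ofCoef_zero_left]
    exact M.dotProduct_rtMass α K (fun σ : M.IntFace K => σ.1) (fun σ : M.ExtFace K => σ.1) y e
  have hAee : e ⬝ᵥ (Aee *ᵥ e) = α * M.cellForm K (∑ σ, e σ • M.basisCoef K σ.1)
      (∑ σ, e σ • M.basisCoef K σ.1) :=
    M.dotProduct_rtMass α K (fun σ : M.ExtFace K => σ.1) (fun σ : M.ExtFace K => σ.1) e e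
  have hpos : ∀ y, y ⬝ᵥ (Aii *ᵥ y) = 0 → y = 0 := by
    intro y hy
    rw [hAii] at hy
    exact eq_zero_of_ofCoef_eq_zero hd
      (eq_zero_of_cellForm_self hd ((mul_eq_zero.1 hy).resolve_left hα.ne'))
  have hinj : ∀ p, Biᵀ *ᵥ p = 0 → p = 0 := by
    intro p hp
    have h1 : (∑ l, p l • q l : M.Q0 K).1 = 0 := by
      refine eq_zero_of_rtDiv_eq_zero hd (∑ l, p l • q l : M.Q0 K).2 fun σ => ?_
      have h2 := congrFun hp σ
      simp only [Matrix.mulVec, dotProduct, Matrix.transpose_apply, Bi, Matrix.of_apply,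
        rtDiv_eq, Pi.zero_apply] at h2
      rw [rtDiv_eq, ← h2]
      simp only [Submodule.coe_sum, Submodule.coe_smul, Finset.sum_apply, Pi.smul_apply,
        smul_eq_mul, Finset.mul_sum, Finset.sum_mul, neg_mul, Finset.sum_neg_distrib]
      rw [Finset.sum_comm]
      congr 1
      refine Finset.sum_congr rfl fun l _ => Finset.sum_congr rfl fun κ _ => ?_
      ring
    have h3 : ∑ l, p l • q l = 0 := Subtype.ext h1
    exact funext fun l => Fintype.linearIndependent_iff.1 q.linearIndependent p h3 l
  obtain ⟨y, p, h1, h2, h3⟩ := exists_saddle_point Aii Aie Aee Bi Be hpos hinj e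
  have hu : M.ofCoef K e y = ∑ σ, e σ • M.basisCoef K σ.1 + M.ofCoef K 0 y := by
    rw [ofCoef_zero_left]
    rfl
  -- The Euler–Lagrange equation: the solution is orthogonal to the variations that have no flux
  -- through `∂K` and no divergence, the multiplier acting trivially on these.
  have horth : ∀ z, Bi *ᵥ z = 0 → M.cellForm K (M.ofCoef K e y) (M.ofCoef K 0 z) = 0 := by
    intro z hz
    have h4 := congrArg (z ⬝ᵥ ·) h1
    simp only [dotProduct_add, dotProduct_zero, hAii, hAie] at h4
    rw [Matrix.dotProduct_mulVec, Matrix.vecMul_transpose, hz, zero_dotProduct, add_zero,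
      ← mul_add, ← LinearMap.add_apply, ← map_add, add_comm, ← hu] at h4
    exact (mul_eq_zero.1 h4).resolve_left hα.ne'
  refine ⟨M.ofCoef K e y, M.isBalanced_ofCoef hd K e y, M.hasExtFlux_ofCoef hd K e y, ?_, ?_, ?_⟩
  · rw [M.hasConstDiv_iff_basis q]
    intro l
    have h4 := congrFun h2 l
    rw [Pi.add_apply, hBi, hBe, Pi.zero_apply, ← neg_add, neg_eq_zero, ← Finset.sum_add_distrib]
      at h4
    rw [← h4, hu, map_add]
    refine Finset.sum_congr rfl fun κ _ => ?_
    rw [Pi.add_apply]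
    ring
  · intro w hw hwe hwd
    obtain ⟨y', rfl⟩ := exists_eq_ofCoef hd hw hwe
    have h4 : Bi *ᵥ (y' - y) = 0 := by
      funext l
      have h5 := (M.hasConstDiv_iff_basis q _).1 hwd l
      have h6 := congrFun h2 l
      rw [Pi.add_apply, hBi, hBe, Pi.zero_apply, ← neg_add, neg_eq_zero,
        ← Finset.sum_add_distrib] at h6
      rw [hBi, ← M.ofCoef_sub K e, map_sub, hu, map_add, Pi.zero_apply, neg_eq_zero]
      simp only [Pi.sub_apply, Pi.add_apply, mul_sub, mul_add, Finset.sum_sub_distrib,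
        Finset.sum_add_distrib] at h5 h6 ⊢
      linarith
    have h5 := horth _ h4
    have h6 : M.ofCoef K e y' = M.ofCoef K e y + M.ofCoef K 0 (y' - y) := by
      rw [← M.ofCoef_sub K e]
      abel
    -- Pythagoras: the cross term vanishes by orthogonality. The excess energy is the energy of the
    -- difference, which gives minimality and uniqueness at once.
    have h7 : M.energy K (M.ofCoef K e y') = M.energy K (M.ofCoef K e y) +
        M.cellForm K (M.ofCoef K 0 (y' - y)) (M.ofCoef K 0 (y' - y)) := by
      rw [← cellForm_self, ← cellForm_self, h6]
      simp only [map_add, LinearMap.add_apply]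
      rw [M.cellForm_comm K (M.ofCoef K 0 (y' - y)) (M.ofCoef K e y), h5]
      ring
    have h8 := M.cellForm_self_nonneg K (M.ofCoef K 0 (y' - y))
    refine ⟨by linarith, fun hle => ?_⟩
    have h9 : M.ofCoef K 0 (y' - y) = 0 := eq_zero_of_cellForm_self hd (by linarith)
    rw [h6, h9, add_zero]
  · have h4 : e ⬝ᵥ (M.mfeMatrix α K q *ᵥ e) =
        e ⬝ᵥ (Aee *ᵥ e) + 2 * (y ⬝ᵥ (Aie *ᵥ e)) + y ⬝ᵥ (Aii *ᵥ y) := by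
      rw [← h3]
      rfl
    rw [h4, hAee, hAie, hAii, ← cellForm_self, hu]
    simp only [map_add, LinearMap.add_apply]
    rw [M.cellForm_comm K (M.ofCoef K 0 y) (∑ σ, e σ • M.basisCoef K σ.1)]
    ring

end PolytopalMesh

/-! ### Areas of faces, total outfluxes and the reconstruction on the whole mesh -/

namespace SimplicialMesh

variable {d : ℕ} {Ω : Set (Euc d)} {T S V : Type*} (M : SimplicialMesh d Ω T S V)

/-- Different faces overlap in a set of zero area. -/
lemma euclideanHausdorff_face_inter (hd : 1 ≤ d) {κ κ' : T} {i i' : Fin (d + 1)}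
    (hne : M.side κ i ≠ M.side κ' i') : (μHE[d - 1] : Measure (Euc d))
      (M.faceHull (M.side κ i) ∩ M.faceHull (M.side κ' i')) = 0 := by
  have hcard : ∀ (κ : T) (i : Fin (d + 1)), (M.vert κ '' {i}ᶜ).ncard = d := fun κ i => by
    rw [Set.ncard_image_of_injective _ (M.vert_injective κ), Set.ncard_compl]
    simp
  -- Each face has `d` vertices, so distinct faces leave a vertex of the first outside the second.
  -- Its coordinate vanishes on the overlap, which thus lies in the intersection of two coordinate
  -- hyperplanes.
  obtain ⟨j, hji, hj⟩ : ∃ j ≠ i, M.vert κ j ∉ M.vert κ' '' {i'}ᶜ := by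
    by_contra hc
    push Not at hc
    refine hne ((M.side_eq_iff κ i κ' i').2 ?_)
    refine Set.eq_of_subset_of_ncard_le ?_ (by rw [hcard, hcard]) (Set.toFinite _)
    rintro _ ⟨j, hj, rfl⟩
    exact hc j hj
  refine measure_mono_null (fun x hx => ?_)
    (euclideanHausdorff_inter_eq_zero (b := M.simplex κ) hd hji.symm)
  obtain ⟨hx, hx'⟩ := hx
  rw [mem_faceHull] at hx hx'
  refine ⟨hx.2, ?_⟩
  rw [← nodal_vert, M.nodal_eq _ hx.1 hx'.1]
  by_contra h0
  obtain ⟨k, hk⟩ := M.exists_vert_of_nodal_pos h0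
  have hki : k = i' := by
    by_contra hki
    exact hj ⟨k, hki, hk⟩
  subst hki
  rw [← hk, nodal_vert] at h0
  exact h0 hx'.2

end SimplicialMesh

namespace PolytopalMesh

variable {d : ℕ} {Ω : Set (Euc d)} {T S V C F : Type*} [Fintype T] [Fintype S] [Fintype V]
  [Fintype C] [Fintype F] (M : PolytopalMesh d Ω T S V C F)

-- A polytopal face could a priori contain simplicial faces from other cells; `parent_entire` puts
-- all of them on the boundary of `K`. Areas then add up because distinct simplicial faces overlap
-- in null sets.
open Classical in
lemma polyFaceArea_eq (hd : 1 ≤ d) (K : C) {τ : F} (hτ : τ ∈ M.cellFaces K) :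
    M.polyFaceArea τ = ∑ σ : M.ExtFace K with M.parent σ.1 = τ, M.faceArea σ.1 := by
  obtain ⟨σ₀, hσ₀, hp₀⟩ := (Finset.mem_filter.1 hτ).2
  have h1 : M.polyFaceSet τ =
      ⋃ σ ∈ (Finset.univ.filter fun σ : M.ExtFace K => M.parent σ.1 = τ), M.faceHull σ.1 := by
    ext x
    simp only [polyFaceSet, Set.mem_iUnion, Finset.mem_filter, Finset.mem_univ, true_and,
      Set.mem_ofPred_eq, exists_prop]
    constructor
    · rintro ⟨σ, ⟨⟨L, hL⟩, hp⟩, hx⟩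
      exact ⟨⟨σ, M.parent_entire K L σ₀ σ hσ₀ hL (hp₀.trans hp.symm)⟩, hp, hx⟩
    · rintro ⟨σ, hp, hx⟩
      exact ⟨σ.1, ⟨⟨K, σ.2⟩, hp⟩, hx⟩
  have h2 : ∀ σ : M.ExtFace K, ∃ q : M.Sub K × Fin (d + 1), M.side q.1.1 q.2 = σ.1 := fun σ =>
    exists_of_onBoundary σ.2
  have hfin : ∀ σ : M.ExtFace K, (μHE[d - 1] : Measure (Euc d)) (M.faceHull σ.1) ≠ ⊤ := by
    intro σ htop
    obtain ⟨q, hq⟩ := h2 σ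
    have h3 := M.faceArea_pos hd q.1.1 q.2
    rw [hq, faceArea, Measure.real, htop] at h3
    simp at h3
  rw [polyFaceArea, h1, Measure.real, measure_biUnion_finset₀, ENNReal.toReal_sum]
  · rfl
  · exact fun σ _ => hfin σ
  · intro σ _ σ' _ hne
    obtain ⟨q, hq⟩ := h2 σ
    obtain ⟨q', hq'⟩ := h2 σ'
    change (μHE[d - 1] : Measure (Euc d)) (M.faceHull σ.1 ∩ M.faceHull σ'.1) = 0
    rw [← hq, ← hq']
    refine M.euclideanHausdorff_face_inter hd fun h => hne (Subtype.ext ?_)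
    rw [← hq, ← hq', h]
  · intro σ _
    obtain ⟨q, hq⟩ := h2 σ
    rw [← hq, M.faceHull_side]
    exact (isClosed_sideSet _ _).measurableSet.nullMeasurableSet

/-- The distribution of the face fluxes to simplicial faces preserves the total outflux. -/
lemma sum_elemFlux (hd : 1 ≤ d) (U : F → ℝ) (K : C) :
    ∑ σ, M.elemFlux U K σ = M.outflux U K := by
  classical
  have hmaps : ∀ σ ∈ (Finset.univ : Finset (M.ExtFace K)), M.parent σ.1 ∈ M.cellFaces K := by
    intro σ _
    exact Finset.mem_filter.2 ⟨Finset.mem_univ _, σ.1, σ.2, rfl⟩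
  rw [← Finset.sum_fiberwise_of_maps_to hmaps, outflux]
  refine Finset.sum_congr rfl fun τ hτ => ?_
  have h1 : ∀ σ ∈ Finset.univ.filter (fun σ : M.ExtFace K => M.parent σ.1 = τ),
      M.elemFlux U K σ =
        U τ * inner ℝ (M.outward K τ) (M.polyNormal τ) / M.polyFaceArea τ * M.faceArea σ.1 := by
    intro σ hσ
    have hp := (Finset.mem_filter.1 hσ).2
    rw [elemFlux, subFlux, M.polyNormal_eq K σ.1 σ.2, hp]
    ring
  have hpos : 0 < M.polyFaceArea τ := by
    obtain ⟨σ, hσ, hp⟩ := (Finset.mem_filter.1 hτ).2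
    rw [M.polyFaceArea_eq hd K hτ]
    refine Finset.sum_pos (fun σ _ => ?_)
      ⟨⟨σ, hσ⟩, Finset.mem_filter.2 ⟨Finset.mem_univ _, hp⟩⟩
    obtain ⟨q, hq⟩ := exists_of_onBoundary σ.2
    rw [← hq]
    exact M.faceArea_pos hd _ _
  rw [Finset.sum_congr rfl h1, ← Finset.mul_sum, ← M.polyFaceArea_eq hd K hτ]
  field_simp

lemma restrict_cellSet (hd : 1 ≤ d) (K : C) :
    (volume : Measure (Euc d)).restrict (M.cellSet K) =
      ∑ κ : M.Sub K, volume.restrict (M.hull κ.1) :=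
  M.restrict_iUnion_hull hd (e := fun κ : M.Sub K => κ.1) Subtype.val_injective

lemma isCompact_cellSet (K : C) : IsCompact (M.cellSet K) :=
  isCompact_iUnion fun _ => isCompact_hull _

lemma cellVol_eq (hd : 1 ≤ d) (K : C) : M.cellVol K = ∑ κ : M.Sub K, M.vol κ.1 := by
  have h := congrArg (fun μ : Measure (Euc d) => (μ Set.univ).toReal) (M.restrict_cellSet hd K)
  simp only [Measure.restrict_apply_univ, Measure.finsetSum_apply] at h
  exact h.trans (ENNReal.toReal_sum fun κ _ => (isCompact_hull (M.simplex κ.1)).measure_lt_top.ne)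

lemma cellVol_pos (hd : 1 ≤ d) (K : C) : 0 < M.cellVol K := by
  rw [M.cellVol_eq hd]
  exact M.cell_sum_vol_pos K

/-- The constant divergence is the total outflux over the volume. -/
lemma cellDiv_eq (hd : 1 ≤ d) {U : F → ℝ} {K : C} {u : M.Sub K → Euc d × ℝ}
    (hu : M.IsBalanced K u) (he : M.HasExtFlux K u (M.elemFlux U K)) (hdiv : M.HasConstDiv K u)
    (κ : M.Sub K) : M.cellDiv K u κ = M.outflux U K / M.cellVol K := by
  obtain ⟨δ, hδ⟩ := (M.hasConstDiv_iff K u).1 hdiv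
  have h1 := sum_dof_mul hd hu he fun _ => 1
  simp only [mul_one, M.sum_elemFlux hd] at h1
  rw [eq_div_iff (M.cellVol_pos hd K).ne', ← h1, hδ, M.cellVol_eq hd, Finset.mul_sum,
    Fintype.sum_prod_type]
  exact Finset.sum_congr rfl fun κ _ => by rw [M.sum_dof, hδ]

/-! ### The reconstruction on the whole mesh -/

/-- The properties determining the flux reconstruction on each cell, in terms of its degrees of
freedom. -/
def IsLift (U : F → ℝ) (u : T → Euc d × ℝ) : Prop :=
  ∀ K, M.IsBalanced K (fun κ => u κ.1) ∧ M.HasExtFlux K (fun κ => u κ.1) (M.elemFlux U K) ∧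
    M.HasConstDiv K (fun κ => u κ.1)

/-- The flux reconstruction exists, is unique, and its energy is given by the mixed finite element
matrices. -/
theorem exists_fluxReconstruction (hd : 1 ≤ d) {α : ℝ} (hα : 0 < α) {J : C → Type*}
    [∀ K, Fintype (J K)] (q : ∀ K, Module.Basis (J K) ℝ (M.Q0 K)) (U : F → ℝ) :
    ∃ u, M.IsFluxReconstruction U u ∧ (∀ u', M.IsFluxReconstruction U u' → u' = u) ∧
      M.IsLift U u ∧ ∀ K, M.elemFlux U K ⬝ᵥ (M.mfeMatrix α K (q K) *ᵥ M.elemFlux U K) =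
        α * M.energy K (fun κ => u κ.1) := by
  choose v hb he hdiv hmin hen using fun K => M.exists_cell_minimiser hd hα K (q K) (M.elemFlux U K)
  have hv : ∀ K, (fun κ : M.Sub K => v (M.cell κ.1) ⟨κ.1, rfl⟩) = v K := by
    intro K
    funext ⟨κ, hκ⟩
    subst hκ
    rfl
  refine ⟨fun κ => v (M.cell κ) ⟨κ, rfl⟩, fun K => ?_, fun u' hu' => ?_, fun K => ?_, fun K => ?_⟩
  · rw [hv K, M.memVN_iff hd]
    refine ⟨⟨⟨hb K, he K⟩, hdiv K⟩, fun w hw hwd => ?_⟩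
    rw [M.memVN_iff hd] at hw
    exact (hmin K w hw.1 hw.2 hwd).1
  · funext κ
    obtain ⟨⟨h1, h2⟩, h3⟩ := hu' (M.cell κ)
    rw [M.memVN_iff hd] at h1
    have h4 := h3 (v (M.cell κ)) ((M.memVN_iff hd).2 ⟨hb _, he _⟩) (hdiv _)
    have h5 := (hmin (M.cell κ) _ h1.1 h1.2 h2).2 h4
    exact congrFun h5 ⟨κ, rfl⟩
  · rw [hv K]
    exact ⟨hb K, he K, hdiv K⟩
  · rw [hv K]
    exact hen K

variable {M} in
/-- The fluxes of the reconstruction over a face shared by two simplices are opposite. -/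
lemma IsLift.rtDof_eq_neg (hd : 1 ≤ d) {U : F → ℝ} {u : T → Euc d × ℝ} (hu : M.IsLift U u)
    {q q' : T × Fin (d + 1)} (hne : q ≠ q') (h : M.side q.1 q.2 = M.side q'.1 q'.2) :
    rtDof (M.simplex q'.1) q'.2 (u q'.1) = -rtDof (M.simplex q.1) q.2 (u q.1) := by
  -- Inside a cell this is balance. Between two cells both fluxes come from the same value `subFlux`
  -- along the fixed normal, and the exterior normals are opposite.
  by_cases hc : M.cell q.1 = M.cell q'.1
  · refine (hu (M.cell q.1)).1 (⟨q.1, rfl⟩, q.2) (⟨q'.1, hc.symm⟩, q'.2) (fun he => hne ?_) h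
    exact Prod.ext (congrArg (fun p => p.1.1) he) (congrArg (fun p => p.2) he)
  · have hb : ∀ {q q' : T × Fin (d + 1)}, M.side q.1 q.2 = M.side q'.1 q'.2 →
        M.cell q.1 ≠ M.cell q'.1 → M.OnBoundary M.cell (M.cell q.1) (M.side q.1 q.2) := by
      intro q q' h hc
      refine ⟨q, ⟨rfl, rfl⟩, fun p hp => ?_⟩
      by_contra hpq
      have := M.side_eq_trichotomy hd (q := q) (q' := p) (q'' := q') hp.2.symm h (Ne.symm hpq)
        (fun he => hc (by rw [he]))
      exact hc (by rw [← this, hp.1])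
    have h1 := (hu (M.cell q.1)).2.1 (⟨q.1, rfl⟩, q.2) (hb h hc)
    have h2 := (hu (M.cell q'.1)).2.1 (⟨q'.1, rfl⟩, q'.2) (hb h.symm (Ne.symm hc))
    rw [M.elemFlux_side (⟨q.1, rfl⟩, q.2)] at h1
    rw [M.elemFlux_side (⟨q'.1, rfl⟩, q'.2)] at h2
    have h3 : M.outNormal q'.1 q'.2 = -M.outNormal q.1 q.2 := by
      refine M.outNormal_eq_neg hd (fun he => hc (by rw [he])) h
    simp only [dof] at h1 h2
    rw [h1, h2, h3, inner_neg_left, h]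
    ring

/-- Expand the polynomial in the fields `x - bᵢ`. Each of them carries flux only through the side
opposite to `bᵢ`, so its boundary term is the mean of `φ` over this side times the corresponding
flux. -/
lemma integral_rt_green (hd : 1 ≤ d) (κ : T) (w : Euc d × ℝ) {φ : Euc d → ℝ}
    (hφ : ContDiff ℝ 1 φ) :
    ∫ x in M.hull κ, (inner ℝ (rtEval w x) (gradient φ x) + d * w.2 * φ x) =
      ∑ i, rtDof (M.simplex κ) i w * ((M.faceArea (M.side κ i))⁻¹ *
        ∫ x in M.faceHull (M.side κ i), φ x ∂(μHE[d - 1] : Measure (Euc d))) := by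
  have hV := M.vol_pos κ
  have hd0 : (0 : ℝ) < d := by exact_mod_cast hd
  have hgrad : Continuous (gradient φ) :=
    (InnerProductSpace.toDual ℝ (Euc d)).symm.continuous.comp (hφ.continuous_fderiv one_ne_zero)
  have hφc := hφ.continuous
  have h1 : ∀ x, inner ℝ (rtEval w x) (gradient φ x) + d * w.2 * φ x =
      ∑ i, rtDof (M.simplex κ) i w / (d * M.vol κ) *
        (inner ℝ (x - M.simplex κ i) (gradient φ x) + d * φ x) := by
    intro x
    have h2 : d * w.2 = ∑ i, rtDof (M.simplex κ) i w / (d * M.vol κ) * d := by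
      rw [← Finset.sum_mul, ← Finset.sum_div, sum_rtDof]
      change _ = d * w.2 * M.vol κ / _ * _
      field_simp
    rw [rtEval_eq_sum (b := M.simplex κ) hd, sum_inner, h2, Finset.sum_mul,
      ← Finset.sum_add_distrib]
    refine Finset.sum_congr rfl fun i _ => ?_
    rw [inner_smul_left, conj_trivial]
    change rtDof (M.simplex κ) i w / (d * M.vol κ) * _ + _ = _
    ring
  simp_rw [h1]
  rw [integral_finsetSum]
  · refine Finset.sum_congr rfl fun i _ => ?_
    rw [integral_const_mul, SimplicialMesh.hull, integral_hull_green hd i hφ, M.faceArea_side, area_sideSet_eq hd,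
      M.faceHull_side]
    change _ = _ * ((d * M.vol κ * _)⁻¹ * _)
    rw [mul_inv]
    ring
  · intro i _
    refine (Continuous.continuousOn ?_).integrableOn_compact (isCompact_hull _)
    fun_prop

/-- A piecewise Raviart–Thomas field with matching fluxes is orthogonal to gradients up to its
divergence. -/
lemma sum_integral_green (hd : 1 ≤ d) (hΩ : IsOpen Ω) {u : T → Euc d × ℝ}
    (hu : ∀ q q' : T × Fin (d + 1), q ≠ q' → M.side q.1 q.2 = M.side q'.1 q'.2 →
      rtDof (M.simplex q'.1) q'.2 (u q'.1) = -rtDof (M.simplex q.1) q.2 (u q.1))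
    {φ : Euc d → ℝ} (hφ : ContDiff ℝ 1 φ) (hφΩ : ∀ x, x ∉ Ω → φ x = 0) :
    ∑ κ, ∫ x in M.hull κ, (inner ℝ (rtEval (u κ) x) (gradient φ x) + d * (u κ).2 * φ x) = 0 := by
  classical
  simp only [M.integral_rt_green hd _ _ hφ]
  set m : S → ℝ := fun σ => (M.faceArea σ)⁻¹ *
    ∫ x in M.faceHull σ, φ x ∂(μHE[d - 1] : Measure (Euc d)) with hm
  change ∑ κ, ∑ i, rtDof (M.simplex κ) i (u κ) * m (M.side κ i) = 0
  rw [← Fintype.sum_prod_type' fun κ i => rtDof (M.simplex κ) i (u κ) * m (M.side κ i)]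
  have hbd : ∀ q : T × Fin (d + 1), (¬∃ q', q' ≠ q ∧ M.side q'.1 q'.2 = M.side q.1 q.2) →
      m (M.side q.1 q.2) = 0 := by
    intro q hq
    have h1 : ∫ x in M.faceHull (M.side q.1 q.2), φ x ∂(μHE[d - 1] : Measure (Euc d)) = 0 := by
      rw [setIntegral_congr_fun (g := fun _ => 0)]
      · simp
      · rw [M.faceHull_side]
        exact (isClosed_sideSet _ _).measurableSet
      · intro x hx
        refine hφΩ x (M.faceHull_disjoint hd hΩ (fun κ' i' hs => ?_) hx)
        by_contra hne
        exact hq ⟨(κ', i'), fun he => hne (congrArg Prod.fst he), hs⟩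
    simp only [hm, h1, mul_zero]
  -- Each side of a simplex is matched with the side of its neighbour on the same face, and their
  -- contributions cancel. A side without neighbour lies outside `Ω`, where `φ` vanishes.
  refine Finset.sum_involution
    (fun q _ => if h : ∃ q', q' ≠ q ∧ M.side q'.1 q'.2 = M.side q.1 q.2 then h.choose else q)
    ?_ ?_ ?_ ?_
  · intro q _
    split_ifs with h
    · rw [hu q _ h.choose_spec.1.symm h.choose_spec.2.symm, h.choose_spec.2]
      ring
    · rw [hbd q h]
      ring
  · intro q _ hne
    split_ifs with h
    · exact h.choose_spec.1
    · exact absurd (by rw [hbd q h, mul_zero]) hne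
  · exact fun _ _ => Finset.mem_univ _
  · intro q _
    by_cases h : ∃ q', q' ≠ q ∧ M.side q'.1 q'.2 = M.side q.1 q.2
    · simp only [dif_pos h]
      have h2 := h.choose_spec
      have h3 : ∃ q', q' ≠ h.choose ∧ M.side q'.1 q'.2 = M.side h.choose.1 h.choose.2 :=
        ⟨q, h2.1.symm, h2.2.symm⟩
      rw [dif_pos h3]
      exact M.side_eq_trichotomy hd h3.choose_spec.2.symm h2.2 h3.choose_spec.1.symm h2.1
    · simp only [dif_neg h]

end PolytopalMesh

/-! ### Integrals over the domain and the weak divergence of lifts -/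

namespace SimplicialMesh

variable {d : ℕ} {Ω : Set (Euc d)} {T S V : Type*} [Fintype T] (M : SimplicialMesh d Ω T S V)

lemma integrableOn_of_hull (hd : 1 ≤ d) (hΩr : interior (closure Ω) = Ω) {f : Euc d → ℝ}
    {g : T → Euc d → ℝ} (hfg : ∀ κ, f =ᵐ[volume.restrict (M.hull κ)] g κ)
    (hg : ∀ κ, IntegrableOn (g κ) (M.hull κ)) : IntegrableOn f Ω := by
  rw [IntegrableOn, M.restrict_eq_sum hd hΩr, integrable_finsetSum_measure]
  exact fun κ _ => (hg κ).congr (hfg κ).symm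

lemma integral_eq_sum_hull (hd : 1 ≤ d) (hΩr : interior (closure Ω) = Ω) {f : Euc d → ℝ}
    {g : T → Euc d → ℝ} (hfg : ∀ κ, f =ᵐ[volume.restrict (M.hull κ)] g κ)
    (hg : ∀ κ, IntegrableOn (g κ) (M.hull κ)) :
    ∫ x in Ω, f x = ∑ κ, ∫ x in M.hull κ, g κ x := by
  rw [M.restrict_eq_sum hd hΩr, integral_finsetSum_measure]
  · exact Finset.sum_congr rfl fun κ _ => integral_congr_ae (hfg κ)
  · exact fun κ _ => (hg κ).congr (hfg κ).symm

lemma ae_mem_interior_hull (κ : T) : ∀ᵐ x ∂(volume.restrict (M.hull κ)), x ∈ interior (M.hull κ) := by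
  rw [ae_restrict_iff' (M.isClosed_hull κ).measurableSet]
  filter_upwards [interior_hull_ae_eq (M.simplex κ)] with x hx hxκ
  exact (Eq.to_iff hx).2 hxκ

end SimplicialMesh

namespace PolytopalMesh

variable {d : ℕ} {Ω : Set (Euc d)} {T S V C F : Type*} [Fintype T] [Fintype S] [Fintype V]
  [Fintype C] [Fintype F] (M : PolytopalMesh d Ω T S V C F)

/-- Sums over the simplices can be arranged by cells. -/
lemma sum_cells {G : Type*} [AddCommMonoid G] (g : T → G) :
    ∑ κ, g κ = ∑ K, ∑ κ : M.Sub K, g κ.1 := by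
  classical
  rw [← Fintype.sum_fiberwise M.cell g]
  refine Finset.sum_congr rfl fun K _ => ?_
  exact Fintype.sum_equiv (Equiv.refl _) _ _ fun _ => rfl

lemma toField_of_mem_interior (u : T → Euc d × ℝ) {κ : T} {x : Euc d}
    (hx : x ∈ interior (M.hull κ)) : M.toField u x = rtEval (u κ) x := by
  rw [toField, Finset.sum_eq_single κ, Set.indicator_of_mem hx]
  · intro κ' _ hne
    refine Set.indicator_of_notMem (fun hx' => hne ?_) _
    exact (M.eq_of_coord_pos (M.mem_interior_hull.1 hx) (interior_subset hx')).symm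
  · exact fun h => absurd (Finset.mem_univ _) h

lemma toField_ae (u : T → Euc d × ℝ) (κ : T) :
    M.toField u =ᵐ[volume.restrict (M.hull κ)] rtEval (u κ) :=
  (M.ae_mem_interior_hull κ).mono fun _ hx => M.toField_of_mem_interior u hx

lemma memLp_toField (u : T → Euc d × ℝ) (p : ENNReal) (s : Set (Euc d)) :
    MemLp (M.toField u) p (volume.restrict s) := by
  have h : MemLp (M.toField u) p volume := by
    have h0 : M.toField u = ∑ κ, (interior (M.hull κ)).indicator (rtEval (u κ)) := by
      ext1 x
      rw [Finset.sum_apply]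
      rfl
    rw [h0]
    refine memLp_finsetSum' _ fun κ _ => ?_
    rw [memLp_indicator_iff_restrict isOpen_interior.measurableSet]
    refine MemLp.mono_measure (Measure.restrict_mono interior_subset le_rfl) ?_
    obtain ⟨B, hB⟩ := (isCompact_hull (M.simplex κ)).exists_bound_of_continuousOn
      (continuous_rtEval (u κ)).continuousOn
    have : IsFiniteMeasure (volume.restrict (M.hull κ)) :=
      ⟨by rw [Measure.restrict_apply_univ]; exact (isCompact_hull _).measure_lt_top⟩
    exact MemLp.of_bound (continuous_rtEval (u κ)).aestronglyMeasurable B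
      (ae_restrict_of_forall_mem (M.isClosed_hull κ).measurableSet hB)
  exact h.restrict s

lemma l2norm_toField_sq (hd : 1 ≤ d) (hΩr : interior (closure Ω) = Ω) (u : T → Euc d × ℝ) :
    l2norm Ω (M.toField u) ^ 2 = ∑ K, M.energy K (fun κ => u κ.1) := by
  rw [l2norm, Real.sq_sqrt (integral_nonneg fun _ => by positivity)]
  rw [M.integral_eq_sum_hull hd hΩr (g := fun κ x => ‖rtEval (u κ) x‖ ^ 2), M.sum_cells]
  · rfl
  · exact fun κ => (M.toField_ae u κ).mono fun x hx => by simp only [hx]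
  · exact fun κ => ((continuous_rtEval _).norm.pow 2).continuousOn.integrableOn_compact
      (isCompact_hull _)

/-- The fluxes of a lift match over all interior faces, so Green's formula leaves only the
divergence, fixed on each cell by the total outflux. This is applied to the discretization,
linearization and algebraic fluxes alike. -/
lemma integral_inner_toField_gradient (hd : 1 ≤ d) (hΩ : IsOpen Ω)
    (hΩr : interior (closure Ω) = Ω) {U : F → ℝ} {u : T → Euc d × ℝ} (hu : M.IsLift U u)
    {φ : Euc d → ℝ} (hφ : IsTestFunction Ω φ) :
    ∫ x in Ω, inner ℝ (M.toField u x) (gradient φ x) =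
      -∑ K, M.outflux U K / M.cellVol K * ∫ x in M.cellSet K, φ x := by
  have hφ1 : ContDiff ℝ 1 φ := hφ.1.of_le (by exact_mod_cast le_top)
  have hgrad : Continuous (gradient φ) :=
    (InnerProductSpace.toDual ℝ (Euc d)).symm.continuous.comp (hφ1.continuous_fderiv one_ne_zero)
  have hφ0 : ∀ x, x ∉ Ω → φ x = 0 := fun x hx =>
    image_eq_zero_of_notMem_tsupport fun h => hx (hφ.2.2 h)
  have hint : ∀ κ, IntegrableOn (fun x => inner ℝ (rtEval (u κ) x) (gradient φ x)) (M.hull κ) :=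
    fun κ => ((continuous_rtEval _).inner hgrad).continuousOn.integrableOn_compact
      (isCompact_hull _)
  have hintφ : ∀ κ, IntegrableOn φ (M.hull κ) := fun κ =>
    hφ1.continuous.continuousOn.integrableOn_compact (isCompact_hull _)
  have h1 := M.sum_integral_green hd hΩ (fun q q' => hu.rtDof_eq_neg hd) hφ1 hφ0
  have h2 : ∀ κ, ∫ x in M.hull κ, (inner ℝ (rtEval (u κ) x) (gradient φ x) + d * (u κ).2 * φ x) =
      (∫ x in M.hull κ, inner ℝ (rtEval (u κ) x) (gradient φ x)) +
        d * (u κ).2 * ∫ x in M.hull κ, φ x := fun κ => by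
    rw [integral_add (hint κ) ((hintφ κ).const_mul _), integral_const_mul]
  simp only [h2, Finset.sum_add_distrib] at h1
  rw [M.integral_eq_sum_hull hd hΩr
    (g := fun κ x => inner ℝ (rtEval (u κ) x) (gradient φ x)) _ hint]
  · rw [eq_neg_of_add_eq_zero_left h1, M.sum_cells]
    refine congrArg _ (Finset.sum_congr rfl fun K _ => ?_)
    have h3 : ∫ x in M.cellSet K, φ x = ∑ κ : M.Sub K, ∫ x in M.hull κ.1, φ x := by
      rw [M.restrict_cellSet hd]
      exact integral_finsetSum_measure fun κ _ => hintφ κ.1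
    rw [h3, Finset.mul_sum]
    refine Finset.sum_congr rfl fun κ _ => ?_
    rw [← M.cellDiv_eq hd (hu K).1 (hu K).2.1 (hu K).2.2 κ]
    rfl
  · exact fun κ => (M.toField_ae u κ).mono fun x hx => by simp only [hx]

/-- A lift is in `H(div, Ω)`. -/
lemma exists_hasWeakDivergence (hd : 1 ≤ d) (hΩ : IsOpen Ω)
    (hΩr : interior (closure Ω) = Ω) {U : F → ℝ} {u : T → Euc d × ℝ} (hu : M.IsLift U u) :
    ∃ w, HasWeakDivergence Ω (M.toField u) w := by
  refine ⟨fun x => ∑ K, (M.cellSet K).indicator (fun _ => M.outflux U K / M.cellVol K) x,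
    M.memLp_toField u 2 Ω, ?_, fun φ hφ => ?_⟩
  · refine MemLp.restrict _ (memLp_finsetSum _ fun K _ => ?_)
    exact memLp_indicator_const 2 (M.isCompact_cellSet K).measurableSet _
      (Or.inr (M.isCompact_cellSet K).measure_lt_top.ne)
  · rw [M.integral_inner_toField_gradient hd hΩ hΩr hu hφ]
    have hφi : Integrable φ := hφ.1.continuous.integrable_of_hasCompactSupport hφ.2.1
    have h1 : ∀ x, (∑ K, (M.cellSet K).indicator (fun _ => M.outflux U K / M.cellVol K) x) * φ x =
        ∑ K, (M.cellSet K).indicator (fun x => M.outflux U K / M.cellVol K * φ x) x := fun x => by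
      rw [Finset.sum_mul]
      exact Finset.sum_congr rfl fun K _ => (Set.indicator_mul_left (M.cellSet K)
        (fun _ => M.outflux U K / M.cellVol K) φ).symm
    have h0 : ∀ x, x ∉ Ω → (∑ K, (M.cellSet K).indicator
        (fun _ => M.outflux U K / M.cellVol K) x) * φ x = 0 := fun x hx => by
      rw [image_eq_zero_of_notMem_tsupport fun h => hx (hφ.2.2 h), mul_zero]
    rw [setIntegral_eq_integral_of_forall_compl_eq_zero h0]
    simp_rw [h1]
    rw [integral_finsetSum]
    · refine congrArg _ (Finset.sum_congr rfl fun K _ => ?_)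
      rw [integral_indicator (M.isCompact_cellSet K).measurableSet, integral_const_mul]
    · exact fun K _ => (hφi.const_mul _).indicator (M.isCompact_cellSet K).measurableSet

end PolytopalMesh

/-! ### An inequality for symmetric tensors -/

/-- The estimate on symmetric tensors behind the discretization estimator. -/
lemma norm_add_sq_le_of_isSymm {E : Type*} [NormedAddCommGroup E] [InnerProductSpace ℝ E]
    {T : E →L[ℝ] E} {c L : ℝ} (hc : 0 < c) (hL : 0 < L)
    (hsymm : ∀ a b, inner ℝ (T a) b = inner ℝ a (T b))
    (hlow : ∀ v, c * ‖v‖ ^ 2 ≤ inner ℝ v (T v)) (hup : ∀ v, ‖T v‖ ≤ L * ‖v‖) (u g : E) :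
    c⁻¹ * ‖T u + g‖ ^ 2 ≤
      c⁻¹ * L ^ 2 * ‖u‖ ^ 2 + c⁻¹ ^ 2 * L * ‖g‖ ^ 2 + 2 * c⁻¹ * L * inner ℝ u g := by
  -- The vector `s` is `(L - T) u`. Replacing `T u` by `L u - s` turns the claim, multiplied by
  -- `c²`, into the inequality `key`.
  set s : E := L • u - T u with hs
  have hT : ∀ v, inner ℝ v (T v) ≤ L * ‖v‖ ^ 2 := fun v => by
    nlinarith [real_inner_le_norm v (T v), hup v, norm_nonneg v,
      mul_le_mul_of_nonneg_left (hup v) (norm_nonneg v)]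
  have hp : inner ℝ s u = L * ‖u‖ ^ 2 - inner ℝ u (T u) := by
    rw [hs, inner_sub_left, inner_smul_left, real_inner_self_eq_norm_sq, conj_trivial, hsymm]
  have hss : inner ℝ s s = ‖s‖ ^ 2 := real_inner_self_eq_norm_sq s
  have hus : inner ℝ s s = L * inner ℝ u s - inner ℝ u (T s) := by
    conv_lhs => rw [hs, inner_sub_left, inner_smul_left, conj_trivial]
    rw [hsymm]
  -- The quadratic form of `L - T ≥ 0` at `u - t s`, with its last term bounded by `L - T ≤ L - c`.
  -- The choice `t = 1 / (L - c)` below yields `‖s‖² ≤ (L - c) (s, u)`.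
  have hq : ∀ t : ℝ, 0 ≤ inner ℝ s u - 2 * t * ‖s‖ ^ 2 + t ^ 2 * ((L - c) * ‖s‖ ^ 2) := by
    intro t
    have h1 := hT (u - t • s)
    have h2 := hlow s
    rw [map_sub, map_smul, inner_sub_left, inner_sub_right, inner_sub_right, inner_smul_left,
      inner_smul_left, inner_smul_right, inner_smul_right, conj_trivial,
      ← hsymm s u, real_inner_comm u (T s), ← hsymm u, @norm_sub_sq_real, inner_smul_right,
      norm_smul, mul_pow, Real.norm_eq_abs, sq_abs] at h1
    have h3 : inner ℝ (T s) u = L * inner ℝ u s - ‖s‖ ^ 2 := by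
      rw [real_inner_comm]; linarith
    have h4 : inner ℝ (T u) s = inner ℝ u (T s) := hsymm u s
    have h5 : inner ℝ u (T s) = L * inner ℝ u s - ‖s‖ ^ 2 := by rw [← h3, real_inner_comm]
    have h6 : inner ℝ (T u) u = inner ℝ u (T u) := hsymm u u
    rw [h5, h6] at h1
    nlinarith [mul_le_mul_of_nonneg_left h2 (sq_nonneg t)]
  -- The order `c ≤ L` can fail only in the trivial space, where all vectors vanish; hence the case
  -- distinctions.
  have hδ : 0 ≤ L - c ∨ ‖s‖ = 0 := by
    by_cases h : ‖s‖ = 0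
    · exact Or.inr h
    · have h1 := hlow s
      have h2 := hT s
      have h3 : 0 < ‖s‖ ^ 2 := by positivity
      exact Or.inl (by nlinarith)
  have hTu : T u = L • u - s := by rw [hs]; abel
  have hexp : ‖T u + g‖ ^ 2 = L ^ 2 * ‖u‖ ^ 2 + ‖s‖ ^ 2 + ‖g‖ ^ 2 - 2 * L * inner ℝ s u
      + 2 * L * inner ℝ u g - 2 * inner ℝ s g := by
    rw [hTu, ← real_inner_self_eq_norm_sq]
    simp only [inner_add_left, inner_add_right, inner_sub_left, inner_sub_right, inner_smul_left,
      inner_smul_right, conj_trivial, real_inner_self_eq_norm_sq]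
    rw [real_inner_comm s u, real_inner_comm g u, real_inner_comm g s]
    ring
  have hsg := abs_le.1 (abs_real_inner_le_norm s g)
  have key : 0 ≤ (L - c) * ‖g‖ ^ 2 + 2 * c * inner ℝ s g + 2 * L * c * inner ℝ s u
      - c * ‖s‖ ^ 2 := by
    rcases hδ with hδ | hs0
    · rcases hδ.eq_or_lt with hδ | hδ
      · have h1 := hq 1
        rw [← hδ] at h1 ⊢
        have h2 := hq (L / c)
        have h3 : ‖s‖ ^ 2 ≤ 0 := by
          have h4 := hT u
          have h5 := hlow u
          have h6 : L = c := by linarith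
          rw [h6] at hp
          nlinarith
        have h4 : ‖s‖ = 0 := by nlinarith [norm_nonneg s]
        have h5 : s = 0 := norm_eq_zero.1 h4
        simp [h5]
      · have h1 := hq (1 / (L - c))
        have h2 : ‖s‖ ^ 2 ≤ (L - c) * inner ℝ s u := by
          have h3 : inner ℝ s u - 2 * (1 / (L - c)) * ‖s‖ ^ 2 +
              (1 / (L - c)) ^ 2 * ((L - c) * ‖s‖ ^ 2) = inner ℝ s u - ‖s‖ ^ 2 / (L - c) := by
            field_simp
            ring
          rw [h3, sub_nonneg, div_le_iff₀ hδ] at h1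
          linarith
        -- After multiplication by `L - c`, the lower bound for `(s, u)` completes the square `((L -
        -- c) ‖g‖ - c ‖s‖)²` and leaves the spare term `L c ‖s‖²`.
        refine nonneg_of_mul_nonneg_right (a := L - c) ?_ hδ
        nlinarith [mul_le_mul_of_nonneg_left h2 (mul_pos hL hc).le,
          mul_le_mul_of_nonneg_left hsg.1 (mul_pos hδ hc).le,
          sq_nonneg ((L - c) * ‖g‖ - c * ‖s‖), mul_nonneg (mul_pos hL hc).le (sq_nonneg ‖s‖)]
    · have h5 : s = 0 := norm_eq_zero.1 hs0
      have h6 : (0 : ℝ) ≤ L - c ∨ ‖g‖ = 0 := by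
        by_cases h : ‖g‖ = 0
        · exact Or.inr h
        · have h1 := hlow g
          have h2 := hT g
          have h3 : 0 < ‖g‖ ^ 2 := by positivity
          exact Or.inl (by nlinarith)
      rcases h6 with h6 | h6
      · simp only [h5, inner_zero_left, norm_zero]
        nlinarith [mul_nonneg h6 (sq_nonneg ‖g‖)]
      · simp [h5, h6]
  have hrw : c⁻¹ * L ^ 2 * ‖u‖ ^ 2 + c⁻¹ ^ 2 * L * ‖g‖ ^ 2 + 2 * c⁻¹ * L * inner ℝ u g
      - c⁻¹ * ‖T u + g‖ ^ 2 = c⁻¹ ^ 2 * ((L - c) * ‖g‖ ^ 2 + 2 * c * inner ℝ s g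
        + 2 * L * c * inner ℝ s u - c * ‖s‖ ^ 2) := by
    rw [hexp]
    field_simp
    ring
  have : 0 ≤ c⁻¹ ^ 2 * ((L - c) * ‖g‖ ^ 2 + 2 * c * inner ℝ s g
        + 2 * L * c * inner ℝ s u - c * ‖s‖ ^ 2) := by positivity
  linarith

/-! ### Piecewise affine potentials and the discretization estimator -/

namespace PolytopalMesh

variable {d : ℕ} {Ω : Set (Euc d)} {T S V C F : Type*} [Fintype T] [Fintype S] [Fintype V]
  [Fintype C] [Fintype F] (M : PolytopalMesh d Ω T S V C F)

/-- The gradient on `κ` of the continuous piecewise affine function with the point values `Z`. -/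
def pointGrad (Z : V → ℝ) (κ : T) : Euc d := ∑ i, Z (M.vert κ i) • baryGrad (M.simplex κ) i

/-- The piecewise affine function with the point values `Z` on `κ`. -/
def interp (Z : V → ℝ) (κ : T) (x : Euc d) : ℝ :=
  ∑ i, Z (M.vert κ i) * (M.simplex κ).coord i x

lemma interp_add (Z : V → ℝ) (κ : T) (x v : Euc d) :
    M.interp Z κ (x + v) = M.interp Z κ x + inner ℝ (M.pointGrad Z κ) v := by
  simp only [interp, pointGrad, sum_inner, inner_smul_left, conj_trivial, coord_add, mul_add,
    Finset.sum_add_distrib]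

lemma continuous_interp (Z : V → ℝ) (κ : T) : Continuous (M.interp Z κ) :=
  continuous_finsetSum _ fun _ _ => continuous_const.mul (continuous_coord _ _)

lemma interp_simplex (Z : V → ℝ) (κ : T) (i : Fin (d + 1)) :
    M.interp Z κ (M.simplex κ i) = Z (M.vert κ i) := by
  simp [interp, AffineBasis.coord_apply]

lemma integral_interp (hd : 1 ≤ d) (Z : V → ℝ) (κ : T) :
    ∫ x in M.hull κ, M.interp Z κ x = M.vol κ / (d + 1) * ∑ i, Z (M.vert κ i) := by
  simp only [interp]
  rw [integral_finsetSum, Finset.mul_sum]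
  · refine Finset.sum_congr rfl fun i _ => ?_
    rw [integral_const_mul, SimplicialMesh.hull, integral_hull_coord hd, mul_comm]
    rfl
  · exact fun i _ => (continuous_const.mul (continuous_coord _ _)).continuousOn.integrableOn_compact
      (isCompact_hull _)

open Classical in
/-- Green's formula on a simplex for an affine function. -/
lemma integral_inner_pointGrad (hd : 1 ≤ d) (Z : V → ℝ) (κ : T) (w : Euc d × ℝ) :
    (∫ x in M.hull κ, inner ℝ (rtEval w x) (M.pointGrad Z κ)) +
        d * w.2 * ∫ x in M.hull κ, M.interp Z κ x =
      ∑ i, rtDof (M.simplex κ) i w *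
        ((1 / (d : ℝ)) * ∑ a with a ∈ M.faceVertices (M.side κ i), Z a) := by
  have hV := M.vol_pos κ
  have hd0 : (0 : ℝ) < d := by exact_mod_cast hd
  have h1 : ∀ i, ∑ a with a ∈ M.faceVertices (M.side κ i), Z a =
      ∑ j, Z (M.vert κ j) - Z (M.vert κ i) := by
    intro i
    have h2 : (Finset.univ.filter fun a => a ∈ M.faceVertices (M.side κ i)) =
        (Finset.univ.erase i).map ⟨M.vert κ, M.vert_injective κ⟩ := by
      ext a
      rw [M.faceVertices_side]
      simp only [Finset.mem_filter, Finset.mem_univ, true_and, Finset.mem_map, Finset.mem_erase,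
        and_true]
      rfl
    rw [h2, Finset.sum_map, ← Finset.sum_erase_eq_sub (Finset.mem_univ i)]
    rfl
  -- For an affine function `s` with value `Zᵢ` at `bᵢ`, the product of `x - bᵢ` with `∇s` is `s(x)
  -- - Zᵢ`.
  have h3 : ∀ x, inner ℝ (rtEval w x) (M.pointGrad Z κ) =
      ∑ i, rtDof (M.simplex κ) i w / (d * M.vol κ) * (M.interp Z κ x - Z (M.vert κ i)) := by
    intro x
    rw [rtEval_eq_sum (b := M.simplex κ) hd, sum_inner]
    refine Finset.sum_congr rfl fun i _ => ?_
    rw [inner_smul_left, conj_trivial, real_inner_comm]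
    have h4 := M.interp_add Z κ (M.simplex κ i) (x - M.simplex κ i)
    rw [add_sub_cancel, M.interp_simplex] at h4
    rw [h4, add_sub_cancel_left]
    rfl
  have h5 : ∫ x in M.hull κ, inner ℝ (rtEval w x) (M.pointGrad Z κ) =
      ∑ i, rtDof (M.simplex κ) i w / (d * M.vol κ) *
        ((∫ x in M.hull κ, M.interp Z κ x) - M.vol κ * Z (M.vert κ i)) := by
    have hi : IntegrableOn (M.interp Z κ) (M.hull κ) :=
      (M.continuous_interp Z κ).continuousOn.integrableOn_compact (isCompact_hull (M.simplex κ))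
    have hconst : ∀ r : ℝ, IntegrableOn (fun _ => r) (M.hull κ) (volume : Measure (Euc d)) :=
      fun r => continuous_const.continuousOn.integrableOn_compact (isCompact_hull (M.simplex κ))
    simp_rw [h3]
    rw [integral_finsetSum]
    · refine Finset.sum_congr rfl fun i _ => ?_
      rw [integral_const_mul, integral_sub hi (hconst _), setIntegral_const, smul_eq_mul]
      rfl
    · exact fun i _ => (hi.sub (hconst _)).const_mul _
  have h6 := sum_rtDof (b := M.simplex κ) w
  change _ = d * w.2 * M.vol κ at h6
  have h7 : d * w.2 = ∑ i, rtDof (M.simplex κ) i w / M.vol κ := by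
    rw [← Finset.sum_div, h6]
    field_simp
  rw [h5, h7, Finset.sum_mul, ← Finset.sum_add_distrib]
  refine Finset.sum_congr rfl fun i _ => ?_
  rw [h1, M.integral_interp hd]
  field_simp
  ring

lemma gradient_hat (a : V) (κ : T) (x : Euc d) [DecidableEq V] :
    gradient (M.hat a κ) x = ∑ i, if M.vert κ i = a then baryGrad (M.simplex κ) i else 0 := by
  refine HasGradientAt.gradient ?_
  have h : M.hat a κ = fun y => M.hat a κ 0 +
      inner ℝ (∑ i, if M.vert κ i = a then baryGrad (M.simplex κ) i else 0) y := by
    ext y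
    simp only [hat, sum_inner, ← Finset.sum_add_distrib]
    refine Finset.sum_congr rfl fun i _ => ?_
    by_cases hi : M.vert κ i = a
    · have h1 := coord_add (M.simplex κ) i 0 y
      rw [zero_add] at h1
      simp only [if_pos hi, h1]
    · simp only [if_neg hi, inner_zero_left, add_zero]
  rw [h, hasGradientAt_iff_hasFDerivAt]
  exact ((InnerProductSpace.toDual ℝ (Euc d) _).hasFDerivAt).const_add _

lemma sum_subVertex {K : C} (κ : M.Sub K) {G : Type*} [AddCommMonoid G] [DecidableEq V]
    (g : Fin (d + 1) → V → G) :
    ∑ a : M.SubVertex K, (∑ i, if M.vert κ.1 i = a.1 then g i a.1 else 0) =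
      ∑ i, g i (M.vert κ.1 i) := by
  rw [Finset.sum_comm]
  refine Finset.sum_congr rfl fun i _ => ?_
  let a₀ : M.SubVertex K := ⟨M.vert κ.1 i, κ.1, i, κ.2, rfl⟩
  rw [Finset.sum_eq_single a₀]
  · exact if_pos rfl
  · exact fun a _ hne => if_neg fun h => hne (Subtype.ext h.symm)
  · exact fun h => absurd (Finset.mem_univ _) h

lemma stiffMatrix_form (β : ℝ) (K : C) (Z : V → ℝ) :
    M.elemPoint Z K ⬝ᵥ (M.stiffMatrix β K *ᵥ M.elemPoint Z K) =
      β * ∑ κ : M.Sub K, ∫ _ in M.hull κ.1, ‖M.pointGrad Z κ.1‖ ^ 2 := by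
  classical
  have h1 : ∀ κ : M.Sub K, M.pointGrad Z κ.1 = ∑ a : M.SubVertex K,
      Z a.1 • gradient (M.hat a.1 κ.1) 0 := by
    intro κ
    simp only [gradient_hat, Finset.smul_sum, smul_ite, smul_zero]
    rw [M.sum_subVertex κ fun i a => Z a • baryGrad (M.simplex κ.1) i]
    rfl
  have h2 : ∀ κ : M.Sub K, ∀ a, ∀ x, gradient (M.hat a κ.1) x = gradient (M.hat a κ.1) 0 := by
    intro κ a x
    rw [gradient_hat, gradient_hat]
  simp only [dotProduct, Matrix.mulVec, stiffMatrix, Matrix.of_apply, elemPoint, Finset.mul_sum,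
    Finset.sum_mul, setIntegral_const]
  have h3 : ∀ κ : M.Sub K, β * (volume.real (M.hull κ.1) • ‖M.pointGrad Z κ.1‖ ^ 2) =
      ∑ a : M.SubVertex K, ∑ a' : M.SubVertex K, Z a.1 * (∫ x in M.hull κ.1,
        inner ℝ (β • gradient (M.hat a'.1 κ.1) x) (gradient (M.hat a.1 κ.1) x)) * Z a'.1 := by
    intro κ
    simp only [h2, setIntegral_const]
    rw [← real_inner_self_eq_norm_sq, h1 κ, sum_inner]
    simp only [inner_sum, smul_eq_mul, Finset.mul_sum]
    rw [Finset.sum_comm]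
    refine Finset.sum_congr rfl fun a _ => Finset.sum_congr rfl fun a' _ => ?_
    simp only [inner_smul_left, inner_smul_right, conj_trivial]
    ring
  refine Eq.trans ?_ (Finset.sum_congr rfl fun κ _ => (h3 κ).symm)
  refine Eq.trans ?_ Finset.sum_comm
  refine Finset.sum_congr rfl fun a _ => ?_
  refine Eq.trans ?_ Finset.sum_comm
  refine Finset.sum_congr rfl fun a' _ => Finset.sum_congr rfl fun κ _ => ?_
  ring

/-- The hat functions sum to one, so pairing the mass matrix with the vector of ones gives the
integral of the interpolant. -/
lemma massMatrix_form (K : C) (Z : V → ℝ) :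
    (fun _ => 1) ⬝ᵥ (M.massMatrix K *ᵥ M.elemPoint Z K) =
      ∑ κ : M.Sub K, ∫ x in M.hull κ.1, M.interp Z κ.1 x := by
  classical
  have h1 : ∀ κ : M.Sub K, ∀ x, M.interp Z κ.1 x = ∑ a : M.SubVertex K, ∑ a' : M.SubVertex K,
      M.hat a'.1 κ.1 x * M.hat a.1 κ.1 x * Z a'.1 := by
    intro κ x
    have h2 : ∑ a : M.SubVertex K, M.hat a.1 κ.1 x = 1 := by
      rw [← (M.simplex κ.1).sum_coord_apply_eq_one x,
        ← M.sum_subVertex (G := ℝ) κ fun i _ => (M.simplex κ.1).coord i x]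
      exact Finset.sum_congr rfl fun a _ => Finset.sum_congr rfl fun i _ => by congr
    have h3 : ∑ a : M.SubVertex K, M.hat a.1 κ.1 x * Z a.1 = M.interp Z κ.1 x := by
      rw [interp, ← M.sum_subVertex (G := ℝ) κ fun i a => Z a * (M.simplex κ.1).coord i x]
      refine Finset.sum_congr rfl fun a _ => ?_
      rw [hat, Finset.sum_mul]
      refine Finset.sum_congr rfl fun i _ => ?_
      by_cases h : M.vert κ.1 i = a.1
      · rw [if_pos h, if_pos h, mul_comm]
      · rw [if_neg h, if_neg h, zero_mul]
    rw [Finset.sum_comm, ← h3]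
    refine Finset.sum_congr rfl fun a _ => ?_
    rw [← Finset.sum_mul, ← Finset.mul_sum, h2, mul_one]
  have hcont : ∀ a κ, Continuous (M.hat a κ) := fun a κ => by
    unfold hat
    refine continuous_finsetSum _ fun i _ => ?_
    split_ifs
    · exact continuous_coord _ _
    · exact continuous_const
  have hint : ∀ (κ : M.Sub K) a a', IntegrableOn
      (fun x => M.hat a' κ.1 x * M.hat a κ.1 x * Z a') (M.hull κ.1) := fun κ a a' =>
    (((hcont _ _).mul (hcont _ _)).mul continuous_const).continuousOn.integrableOn_compact
      (isCompact_hull _)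
  simp only [dotProduct, Matrix.mulVec, massMatrix, Matrix.of_apply, elemPoint, one_mul,
    Finset.sum_mul]
  have h4 : ∀ κ : M.Sub K, ∫ x in M.hull κ.1, M.interp Z κ.1 x =
      ∑ a : M.SubVertex K, ∑ a' : M.SubVertex K,
        (∫ x in M.hull κ.1, M.hat a'.1 κ.1 x * M.hat a.1 κ.1 x) * Z a'.1 := by
    intro κ
    simp_rw [h1 κ]
    rw [integral_finsetSum]
    swap
    · intro a _
      refine integrable_finsetSum _ fun a' _ => ?_
      exact hint κ a.1 a'.1
    refine Finset.sum_congr rfl fun a _ => ?_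
    rw [integral_finsetSum]
    swap
    · intro a' _
      exact hint κ a.1 a'.1
    exact Finset.sum_congr rfl fun a' _ => integral_mul_const _ _
  refine Eq.trans ?_ (Finset.sum_congr rfl fun κ _ => (h4 κ).symm)
  refine Eq.trans ?_ Finset.sum_comm
  exact Finset.sum_congr rfl fun a _ => Finset.sum_comm

/-- The discretization estimator as an integral. -/
lemma etaSpSq_eq (hd : 1 ≤ d) {J : C → Type*} [∀ K, Fintype (J K)]
    (q : ∀ K, Module.Basis (J K) ℝ (M.Q0 K)) (c L : ℝ) {U : F → ℝ} {u : T → Euc d × ℝ}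
    (hu : M.IsLift U u) (K : C)
    (hK : M.elemFlux U K ⬝ᵥ (M.mfeMatrix (c⁻¹ * L ^ 2) K (q K) *ᵥ M.elemFlux U K) =
        c⁻¹ * L ^ 2 * M.energy K (fun κ => u κ.1)) (Z : V → ℝ) :
    etaSpSq M q c L U Z K = ∑ κ : M.Sub K, ∫ x in M.hull κ.1,
      (c⁻¹ * L ^ 2 * ‖rtEval (u κ.1) x‖ ^ 2 + c⁻¹ ^ 2 * L * ‖M.pointGrad Z κ.1‖ ^ 2 +
        2 * c⁻¹ * L * inner ℝ (rtEval (u κ.1) x) (M.pointGrad Z κ.1)) := by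
  classical
  -- Green's formula summed over the simplices of the cell, the faces inside cancelling. The mass
  -- matrix term of the estimator subtracts precisely the divergence part, leaving the integral of
  -- `u · ∇s` over the cell.
  have hfl : M.elemFlux U K ⬝ᵥ M.elemPointExt Z K = ∑ κ : M.Sub K,
      ((∫ x in M.hull κ.1, inner ℝ (rtEval (u κ.1) x) (M.pointGrad Z κ.1)) +
        M.outflux U K * (M.cellVol K)⁻¹ * ∫ x in M.hull κ.1, M.interp Z κ.1 x) := by
    have h1 := sum_dof_mul hd (hu K).1 (hu K).2.1 fun σ =>
      (1 / (d : ℝ)) * ∑ a with a ∈ M.faceVertices σ, Z a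
    refine Eq.trans (by rfl) (h1.symm.trans ?_)
    rw [Fintype.sum_prod_type]
    refine Finset.sum_congr rfl fun κ _ => ?_
    have h2 := M.cellDiv_eq hd (hu K).1 (hu K).2.1 (hu K).2.2 κ
    rw [← div_eq_mul_inv, ← h2]
    exact (M.integral_inner_pointGrad hd Z κ.1 (u κ.1)).symm
  unfold etaSpSq
  lift_lets
  intro UK ZK
  change M.elemFlux U K ⬝ᵥ _ + M.elemPoint Z K ⬝ᵥ (_ *ᵥ M.elemPoint Z K) + 2 * c⁻¹ * L *
    (M.elemFlux U K ⬝ᵥ _ - _ * (_ ⬝ᵥ (_ *ᵥ M.elemPoint Z K))) = _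
  rw [hK, hfl, stiffMatrix_form, massMatrix_form, energy, Finset.sum_add_distrib, ← Finset.mul_sum,
    add_sub_cancel_right, Finset.mul_sum, Finset.mul_sum, Finset.mul_sum, ← Finset.sum_add_distrib,
    ← Finset.sum_add_distrib]
  refine Finset.sum_congr rfl fun κ _ => ?_
  have hcont : ∀ g : Euc d → ℝ, Continuous g → IntegrableOn g (M.hull κ.1) := fun g hg =>
    hg.continuousOn.integrableOn_compact (isCompact_hull _)
  have hr := continuous_rtEval (u κ.1)
  rw [integral_add, integral_add, integral_const_mul, integral_const_mul, integral_const_mul]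
  all_goals exact hcont _ (by fun_prop)

end PolytopalMesh

/-! ### Lipschitz functions, thresholding and mollification -/

/-- A function that is Lipschitz on each set of a finite closed cover is Lipschitz. -/
lemma lipschitzWith_of_finite_closed_cover {E ι : Type*} [NormedAddCommGroup E] [NormedSpace ℝ E]
    [Finite ι] {A : ι → Set E} (hA : ∀ i, IsClosed (A i)) (hcov : ∀ x, ∃ i, x ∈ A i) {f : E → ℝ}
    {C : NNReal} (hf : ∀ i, LipschitzOnWith C f (A i)) : LipschitzWith C f := by
  have hcont : Continuous f := (locallyFinite_of_finite A).continuous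
    (Set.iUnion_eq_univ_iff.2 hcov) hA fun i => (hf i).continuousOn
  have key : ∀ x y, f y ≤ f x + C * ‖y - x‖ := by
    intro x y
    have hγ : Continuous fun t : ℝ => x + t • (y - x) := by fun_prop
    -- Along a segment it is enough to bound the right slopes, and only for parameters arbitrarily
    -- close to `t`. Among the finitely many closed sets, one is met for such parameters, and it
    -- also contains the limit point.
    have h := image_le_of_liminf_slope_right_le_deriv_boundary (a := 0) (b := 1)
      (f := fun t : ℝ => f (x + t • (y - x))) (B := fun t => f x + C * ‖y - x‖ * t)
      (B' := fun _ => C * ‖y - x‖) (hcont.comp hγ).continuousOn (by simp) (by fun_prop)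
      (fun t _ => by
        have := ((hasDerivAt_id t).const_mul (C * ‖y - x‖)).const_add (f x)
        simpa using this.hasDerivWithinAt) ?_ (Set.right_mem_Icc.2 zero_le_one)
    · simpa using h
    · intro t _ r hr
      obtain ⟨i, hi⟩ : ∃ i, ∃ᶠ z in 𝓝[>] t, x + z • (y - x) ∈ A i := by
        by_contra hc
        simp only [not_exists, not_frequently] at hc
        obtain ⟨z, hz⟩ := (eventually_all.2 hc).exists
        obtain ⟨i, hi⟩ := hcov (x + z • (y - x))
        exact hz i hi
      have hti : x + t • (y - x) ∈ A i := by
        rw [← (hA i).closure_eq]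
        exact mem_closure_of_frequently_of_tendsto hi (hγ.continuousAt.mono_left inf_le_left)
      refine (hi.and_eventually self_mem_nhdsWithin).mono fun z hz => lt_of_le_of_lt ?_ hr
      have hzt : 0 < z - t := sub_pos.2 hz.2
      have h1 := (hf i).dist_le_mul _ hz.1 _ hti
      rw [slope_def_field, div_le_iff₀ hzt]
      rw [Real.dist_eq, dist_eq_norm] at h1
      have h2 : x + z • (y - x) - (x + t • (y - x)) = (z - t) • (y - x) := by module
      rw [h2, norm_smul, Real.norm_eq_abs, abs_of_pos hzt] at h1
      calc _ ≤ |f (x + z • (y - x)) - f (x + t • (y - x))| := le_abs_self _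
        _ ≤ _ := h1
        _ = _ := by ring
  refine LipschitzWith.of_dist_le_mul fun x y => ?_
  rw [Real.dist_eq, dist_eq_norm, abs_le]
  have h1 := key x y
  have h2 := key y x
  rw [norm_sub_rev] at h1
  constructor <;> linarith

/-- Cutting off the values below `ε`. -/
def softThreshold (ε a : ℝ) : ℝ := max (a - ε) 0 - max (-a - ε) 0

lemma abs_softThreshold_sub_le {ε : ℝ} (hε : 0 ≤ ε) (a b : ℝ) :
    |softThreshold ε a - softThreshold ε b| ≤ |a - b| := by
  unfold softThreshold
  grind

lemma softThreshold_of_abs_le {ε a : ℝ} (h : |a| ≤ ε) : softThreshold ε a = 0 := by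
  rw [abs_le] at h
  rw [softThreshold, max_eq_right (by linarith), max_eq_right (by linarith), sub_zero]

lemma softThreshold_of_le {ε a : ℝ} (hε : 0 ≤ ε) (h : ε ≤ a) : softThreshold ε a = a - ε := by
  rw [softThreshold, max_eq_left (by linarith), max_eq_right (by linarith), sub_zero]

lemma softThreshold_of_le_neg {ε a : ℝ} (hε : 0 ≤ ε) (h : a ≤ -ε) : softThreshold ε a = a + ε := by
  rw [softThreshold, max_eq_right (by linarith), max_eq_left (by linarith)]
  ring

section Mollify

variable {d : ℕ}

/-- The radius of mollification belonging to the threshold `ε`. -/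
def mollifyRadius (C : NNReal) (ε : ℝ) : ℝ := ε / (2 * (C + 1))

open scoped Convolution in
/-- Mollification of a thresholded Lipschitz function. -/
lemma exists_mollification {s : Euc d → ℝ} {C : NNReal} (hs : LipschitzWith C s) {Ω : Set (Euc d)}
    (hΩb : Bornology.IsBounded Ω) (hsΩ : ∀ x, x ∉ Ω → s x = 0) {ε : ℝ} (hε : 0 < ε) :
    ∃ φ : Euc d → ℝ, IsTestFunction Ω φ ∧ (∀ x, ‖gradient φ x‖ ≤ C) ∧
      ∀ (x₀ g : Euc d) (a : ℝ), (∀ y, dist y x₀ < 2 * mollifyRadius C ε →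
        softThreshold ε (s y) = a + inner ℝ g y) → gradient φ x₀ = g := by
  set δ := mollifyRadius C ε with hδdef
  have hC : (0 : ℝ) ≤ C := C.2
  have hδ : 0 < δ := by rw [hδdef, mollifyRadius]; positivity
  -- Within distance `δ` the function varies by at most `ε / 2`. Where `|s| < ε / 2` the thresholded
  -- function hence vanishes on the whole averaging ball, which keeps the support of the
  -- mollification inside `Ω`.
  have hCδ : C * δ ≤ ε / 2 := by
    rw [hδdef, mollifyRadius]
    rw [mul_div_assoc', div_le_div_iff₀ (by positivity) (by positivity)]
    nlinarith
  set v : Euc d → ℝ := fun x => softThreshold ε (s x) with hv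
  have hvlip : LipschitzWith C v := LipschitzWith.of_dist_le_mul fun x y => by
    refine le_trans ?_ (hs.dist_le_mul x y)
    exact abs_softThreshold_sub_le hε.le _ _
  let ρ : ContDiffBump (0 : Euc d) := ⟨δ / 2, δ, by linarith, by linarith⟩
  have hρ0 : ∀ t : Euc d, δ ≤ ‖t‖ → ρ.normed volume t = 0 := fun t ht => by
    rw [ContDiffBump.normed, ρ.zero_of_le_dist (by simpa using ht), zero_div]
  have hρi : Integrable (ρ.normed volume) (volume : Measure (Euc d)) := ρ.integrable_normed
  have hρc : HasCompactSupport (ρ.normed (volume : Measure (Euc d))) := ρ.hasCompactSupport_normed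
  have hρcont : Continuous (ρ.normed (volume : Measure (Euc d))) := ρ.contDiff_normed.continuous (n := 1)
  set φ : Euc d → ℝ := ρ.normed volume ⋆[ContinuousLinearMap.lsmul ℝ ℝ, volume] v with hφ
  have hφx : ∀ x, φ x = ∫ t, ρ.normed volume t * v (x - t) := fun x => rfl
  have hint : ∀ w : Euc d → ℝ, Continuous w → Integrable fun t => ρ.normed volume t * w t :=
    fun w hw => (hρcont.mul hw).integrable_of_hasCompactSupport hρc.mul_right
  have hsm : ContDiff ℝ ∞ φ := hρc.contDiff_convolution_left _ ρ.contDiff_normed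
    hvlip.continuous.locallyIntegrable
  have hsupp : tsupport φ ⊆ {x | ε / 2 ≤ |s x|} := by
    refine closure_minimal (fun x hx => ?_)
      (isClosed_le continuous_const hs.continuous.abs)
    by_contra hlt
    simp only [Set.mem_ofPred_eq, not_le] at hlt
    refine hx ?_
    rw [hφx]
    refine integral_eq_zero_of_ae (ae_of_all _ fun t => ?_)
    rcases le_or_gt δ ‖t‖ with ht | ht
    · simp [hρ0 t ht]
    · have h1 := hs.dist_le_mul (x - t) x
      rw [dist_eq_norm (x - t), sub_sub_cancel_left, norm_neg, Real.dist_eq] at h1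
      have h2 : |s (x - t)| ≤ ε := by
        have h3 : |s (x - t)| ≤ |s (x - t) - s x| + |s x| := by
          simpa using abs_add_le (s (x - t) - s x) (s x)
        have h4 : C * ‖t‖ ≤ C * δ := by gcongr
        linarith
      simp [hv, softThreshold_of_abs_le h2]
  have hsub : {x | ε / 2 ≤ |s x|} ⊆ Ω := fun x hx => by
    by_contra hxΩ
    simp only [Set.mem_ofPred_eq, hsΩ x hxΩ, abs_zero] at hx
    linarith
  refine ⟨φ, ⟨hsm, ?_, hsupp.trans hsub⟩, fun x => ?_, fun x₀ g a hx₀ => ?_⟩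
  · exact Metric.isCompact_of_isClosed_isBounded (isClosed_tsupport _)
      (hΩb.subset (hsupp.trans hsub))
  · have hlip : LipschitzWith C φ := LipschitzWith.of_dist_le_mul fun x y => by
      rw [Real.dist_eq, hφx, hφx, ← integral_sub
        (hint (fun t => v (x - t)) (hvlip.continuous.comp (by fun_prop)))
        (hint (fun t => v (y - t)) (hvlip.continuous.comp (by fun_prop)))]
      calc _ ≤ ∫ t, ρ.normed volume t * (C * dist x y) := by
            rw [← Real.norm_eq_abs]
            refine norm_integral_le_of_norm_le (hρi.mul_const _) (ae_of_all _ fun t => ?_)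
            rw [← mul_sub, norm_mul, Real.norm_of_nonneg (ρ.nonneg_normed _)]
            refine mul_le_mul_of_nonneg_left ?_ (ρ.nonneg_normed _)
            have := hvlip.dist_le_mul (x - t) (y - t)
            rwa [dist_sub_right] at this
        _ = C * dist x y := by rw [integral_mul_const, ρ.integral_normed, one_mul]
    rw [gradient, LinearIsometryEquiv.norm_map]
    exact norm_fderiv_le_of_lipschitz ℝ hlip
  · refine HasGradientAt.gradient ?_
    -- Averaging an affine function changes it by a constant only, so its gradient is exact and no
    -- symmetry of the kernel is used. The radius `2 δ` accommodates the ball of `x` around `x₀` and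
    -- the kernel.
    have h1 : φ =ᶠ[𝓝 x₀] fun x => (a - ∫ t, ρ.normed volume t * inner ℝ g t) + inner ℝ g x := by
      filter_upwards [Metric.ball_mem_nhds x₀ hδ] with x hx
      have h2 : ∀ t, ρ.normed volume t * v (x - t) =
          ρ.normed volume t * (a + inner ℝ g x) - ρ.normed volume t * inner ℝ g t := fun t => by
        rcases le_or_gt δ ‖t‖ with ht | ht
        · simp [hρ0 t ht]
        · have h3 : v (x - t) = a + inner ℝ g (x - t) := by
            refine hx₀ _ ?_
            rw [Metric.mem_ball, dist_eq_norm] at hx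
            rw [dist_eq_norm]
            have := norm_sub_le (x - x₀) t
            rw [sub_right_comm] at this
            linarith
          rw [h3, inner_sub_right]
          ring
      rw [hφx]
      simp_rw [h2]
      rw [integral_sub (hρi.mul_const _) (hint _ (by fun_prop)), integral_mul_const,
        ρ.integral_normed]
      ring
    rw [hasGradientAt_iff_hasFDerivAt]
    refine HasFDerivAt.congr_of_eventuallyEq ?_ h1
    exact ((InnerProductSpace.toDual ℝ (Euc d) g).hasFDerivAt).const_add _

end Mollify

lemma volume_inner_eq_zero {d : ℕ} {g : Euc d} (hg : g ≠ 0) (a : ℝ) :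
    volume {x : Euc d | a + inner ℝ g x = 0} = 0 := by
  set f : Euc d →ᵃ[ℝ] ℝ := (innerₛₗ ℝ g).toAffineMap + AffineMap.const ℝ (Euc d) a with hf
  have hfx : ∀ x, f x = a + inner ℝ g x := fun x => by simp [hf, add_comm]
  have h : {x : Euc d | a + inner ℝ g x = 0} =
      ((AffineSubspace.mk' (0 : ℝ) ⊥ : AffineSubspace ℝ ℝ).comap f : Set (Euc d)) := by
    ext x
    simp [AffineSubspace.mem_mk', hfx]
  rw [h]
  refine Measure.addHaar_affineSubspace _ _ fun htop => ?_
  have h1 : ∀ x, a + inner ℝ g x = 0 := fun x => by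
    have : x ∈ ((⊤ : AffineSubspace ℝ (Euc d)) : Set (Euc d)) := trivial
    rw [← htop, ← h] at this
    exact this
  have h2 := h1 g
  have h3 := h1 0
  rw [inner_zero_right] at h3
  rw [real_inner_self_eq_norm_sq] at h2
  have := norm_pos_iff.2 hg
  nlinarith

/-! ### The piecewise affine potential as a limit of test functions -/

namespace PolytopalMesh

variable {d : ℕ} {Ω : Set (Euc d)} {T S V C F : Type*} [Fintype T] [Fintype S] [Fintype V]
  [Fintype C] [Fintype F] (M : PolytopalMesh d Ω T S V C F)

lemma interp_eq_sum_nodal (Z : V → ℝ) (κ : T) (x : Euc d) :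
    M.interp Z κ x = ∑ a, Z a * M.nodal a κ x := by
  classical
  simp only [SimplicialMesh.nodal, Finset.mul_sum]
  rw [Finset.sum_comm, interp]
  refine Finset.sum_congr rfl fun i _ => ?_
  simp

open Classical in
/-- The continuous piecewise affine function with the point values `Z`. -/
def glue (Z : V → ℝ) (x : Euc d) : ℝ :=
  if h : ∃ κ, x ∈ M.hull κ then M.interp Z h.choose x else 0

lemma glue_eq (Z : V → ℝ) {κ : T} {x : Euc d} (hx : x ∈ M.hull κ) :
    M.glue Z x = M.interp Z κ x := by
  have h : ∃ κ, x ∈ M.hull κ := ⟨κ, hx⟩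
  rw [glue, dif_pos h, interp_eq_sum_nodal, interp_eq_sum_nodal]
  exact Finset.sum_congr rfl fun a _ => by rw [M.nodal_eq a h.choose_spec hx]

/-- In a simplex containing `x ∉ Ω`, a vertex with positive coordinate cannot lie in `Ω` by
`mem_of_node_mem`. It is thus a boundary vertex, with value zero. -/
lemma glue_eq_zero (hΩ : IsOpen Ω) (hΩr : interior (closure Ω) = Ω) {Z : V → ℝ}
    (hZ : ∀ a, M.node a ∈ frontier Ω → Z a = 0) {x : Euc d} (hx : x ∉ Ω) : M.glue Z x = 0 := by
  by_cases h : ∃ κ, x ∈ M.hull κ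
  · obtain ⟨κ, hκ⟩ := h
    rw [M.glue_eq Z hκ]
    refine Finset.sum_eq_zero fun i _ => ?_
    rcases (M.mem_hull.1 hκ i).eq_or_lt with h0 | h0
    · rw [← h0, mul_zero]
    · rw [hZ, zero_mul]
      rw [hΩ.frontier_eq]
      refine ⟨M.hull_subset_closure κ ?_, fun ha => hx (M.mem_of_node_mem hΩ hΩr hκ h0 ha)⟩
      rw [← M.simplex_apply]
      exact subset_convexHull ℝ _ (Set.mem_range_self i)
  · rw [glue, dif_neg h]

/-- The simplices together with the complement of `Ω` form a finite closed cover of the space, and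
the function is affine or zero on each member. -/
lemma exists_lipschitzWith_glue (hΩ : IsOpen Ω) (hΩr : interior (closure Ω) = Ω) {Z : V → ℝ}
    (hZ : ∀ a, M.node a ∈ frontier Ω → Z a = 0) : ∃ B, LipschitzWith B (M.glue Z) := by
  refine ⟨∑ κ, ‖M.pointGrad Z κ‖₊, lipschitzWith_of_finite_closed_cover
    (A := fun i : Option T => i.elim Ωᶜ M.hull) ?_ ?_ ?_⟩
  · rintro (_ | κ)
    · exact hΩ.isClosed_compl
    · exact M.isClosed_hull κ
  · intro x
    by_cases hx : x ∈ Ω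
    · obtain ⟨κ, hκ⟩ := M.exists_mem_hull (subset_closure hx)
      exact ⟨some κ, hκ⟩
    · exact ⟨none, hx⟩
  · rintro (_ | κ)
    · refine LipschitzOnWith.of_dist_le_mul fun x hx y hy => ?_
      rw [M.glue_eq_zero hΩ hΩr hZ hx, M.glue_eq_zero hΩ hΩr hZ hy, dist_self]
      positivity
    · refine LipschitzOnWith.of_dist_le_mul fun x hx y hy => ?_
      rw [M.glue_eq Z hx, M.glue_eq Z hy]
      have h1 := M.interp_add Z κ y (x - y)
      rw [add_sub_cancel] at h1
      rw [Real.dist_eq, dist_eq_norm, h1, add_sub_cancel_left]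
      refine (abs_real_inner_le_norm _ _).trans (mul_le_mul_of_nonneg_right ?_ (norm_nonneg _))
      rw [NNReal.coe_sum]
      exact Finset.single_le_sum (f := fun κ => (‖M.pointGrad Z κ‖₊ : ℝ))
        (fun κ _ => NNReal.coe_nonneg _) (Finset.mem_univ κ)

/-- The gradient of the piecewise affine function with the point values `Z`. -/
def gradField (Z : V → ℝ) : Euc d → Euc d := M.toField fun κ => (M.pointGrad Z κ, 0)

lemma gradField_of_mem_interior (Z : V → ℝ) {κ : T} {x : Euc d} (hx : x ∈ interior (M.hull κ)) :
    M.gradField Z x = M.pointGrad Z κ := by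
  rw [gradField, M.toField_of_mem_interior _ hx]
  simp [rtEval]

/-- The piecewise affine function with point values vanishing on the boundary is a limit of test
functions. -/
lemma exists_testFunctions_tendsto (hd : 1 ≤ d) (hΩ : IsOpen Ω) (hΩb : Bornology.IsBounded Ω)
    (hΩr : interior (closure Ω) = Ω) {Z : V → ℝ} (hZ : ∀ a, M.node a ∈ frontier Ω → Z a = 0) :
    ∃ (φ : ℕ → Euc d → ℝ) (B : ℝ), (∀ n, IsTestFunction Ω (φ n)) ∧
      (∀ n x, ‖gradient (φ n) x‖ ≤ B) ∧ ∀ᵐ x ∂(volume.restrict Ω),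
        ∀ᶠ n in atTop, gradient (φ n) x = M.gradField Z x := by
  obtain ⟨B, hB⟩ := M.exists_lipschitzWith_glue hΩ hΩr hZ
  have hs0 := fun x hx => M.glue_eq_zero hΩ hΩr hZ (x := x) hx
  choose φ hφ hφB hφg using fun n : ℕ =>
    exists_mollification hB hΩb hs0 (ε := 1 / ((n : ℝ) + 1)) Nat.one_div_pos_of_nat
  refine ⟨φ, B, hφ, hφB, ?_⟩
  have hmr : ∀ n : ℕ, B * (2 * mollifyRadius B (1 / ((n : ℝ) + 1))) ≤ 1 / ((n : ℝ) + 1) := by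
    intro n
    have h1 : (0 : ℝ) < 1 / ((n : ℝ) + 1) := Nat.one_div_pos_of_nat
    have hB0 : (0 : ℝ) ≤ B := B.2
    rw [mollifyRadius, mul_div_assoc', mul_div_assoc', div_le_iff₀ (by positivity)]
    nlinarith
  have hmr0 : Tendsto (fun n : ℕ => 2 * mollifyRadius B (1 / ((n : ℝ) + 1))) atTop (𝓝 0) := by
    have h := (tendsto_one_div_add_atTop_nhds_zero_nat (𝕜 := ℝ)).div_const (2 * ((B : ℝ) + 1))
    simpa [mollifyRadius] using h.const_mul 2
  have hlip : ∀ n : ℕ, ∀ x y, dist y x < 2 * mollifyRadius B (1 / ((n : ℝ) + 1)) →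
      |M.glue Z y - M.glue Z x| ≤ 1 / ((n : ℝ) + 1) := by
    intro n x y hxy
    refine le_trans ?_ (hmr n)
    have := hB.dist_le_mul y x
    rw [Real.dist_eq] at this
    exact this.trans (mul_le_mul_of_nonneg_left hxy.le B.2)
  rw [M.restrict_eq_sum hd hΩr, ← Measure.sum_fintype, Measure.ae_sum_iff]
  intro κ
  -- The zero set of a nonconstant affine function is null. At almost every zero of the potential
  -- its gradient therefore vanishes as well, and thresholding does no harm there.
  have hnull : ∀ᵐ x ∂(volume.restrict (M.hull κ)), M.interp Z κ x = 0 → M.pointGrad Z κ = 0 := by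
    by_cases hg : M.pointGrad Z κ = 0
    · exact ae_of_all _ fun _ _ => hg
    · have h0 : ∀ x, M.interp Z κ x = M.interp Z κ 0 + inner ℝ (M.pointGrad Z κ) x := fun x => by
        rw [← M.interp_add, zero_add]
      refine ae_restrict_of_ae ((measure_eq_zero_iff_ae_notMem.1
        (volume_inner_eq_zero hg (M.interp Z κ 0))).mono fun x hx h => absurd ?_ hx)
      rw [← h]
      exact (h0 x).symm
  filter_upwards [M.ae_mem_interior_hull κ, hnull] with x hx hxn
  rw [M.gradField_of_mem_interior Z hx]
  have hball : ∀ᶠ n : ℕ in atTop, ∀ y, dist y x < 2 * mollifyRadius B (1 / ((n : ℝ) + 1)) →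
      M.glue Z y = M.interp Z κ y := by
    obtain ⟨r, hr, hball⟩ := Metric.isOpen_iff.1 isOpen_interior x hx
    filter_upwards [hmr0.eventually_lt_const hr] with n hn y hy
    exact M.glue_eq Z (interior_subset (hball (hy.trans hn)))
  have haff : ∀ y, M.interp Z κ y =
      M.interp Z κ 0 + inner ℝ (M.pointGrad Z κ) y := fun y => by
    rw [← M.interp_add, zero_add]
  have hxs := M.glue_eq Z (interior_subset hx)
  have hε0 : ∀ n : ℕ, (0 : ℝ) ≤ 1 / ((n : ℝ) + 1) := fun n => Nat.one_div_pos_of_nat.le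
  have hε := fun r hr =>
    ((tendsto_one_div_add_atTop_nhds_zero_nat (𝕜 := ℝ)).const_mul 2).eventually_lt_const (u := r) hr
  rw [mul_zero] at hε
  -- At a point with nonzero value, eventually `|s(x)| > 2 ε` while `s` varies by at most `ε` on the
  -- relevant ball. The threshold then merely shifts `s` by `±ε` there, and the gradient is
  -- unchanged.
  rcases lt_trichotomy (M.glue Z x) 0 with h0 | h0 | h0
  · filter_upwards [hball, hε (-M.glue Z x) (by linarith)] with n hn hnε
    refine hφg n x _ (M.interp Z κ 0 + 1 / ((n : ℝ) + 1)) fun y hy => ?_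
    have h1 := abs_le.1 (hlip n x y hy)
    rw [softThreshold_of_le_neg (hε0 n) (by linarith), hn y hy, haff]
    ring
  · rw [hxs] at h0
    filter_upwards [hball] with n hn
    refine hφg n x _ 0 fun y hy => ?_
    have h1 : M.glue Z y = 0 := by
      have h2 := M.interp_add Z κ x (y - x)
      rw [add_sub_cancel, hxn h0, h0, inner_zero_left, add_zero] at h2
      rw [hn y hy, h2]
    rw [h1, softThreshold_of_abs_le (by simpa using hε0 n), hxn h0, inner_zero_left, add_zero]
  · filter_upwards [hball, hε (M.glue Z x) (by linarith)] with n hn hnε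
    refine hφg n x _ (M.interp Z κ 0 - 1 / ((n : ℝ) + 1)) fun y hy => ?_
    have h1 := abs_le.1 (hlip n x y hy)
    rw [softThreshold_of_le (hε0 n) (by linarith), hn y hy, haff]
    ring

variable {M} in
lemma IsPointValues.eq_zero {P : C → ℝ} {Z : V → ℝ} (hZ : M.IsPointValues P Z) {a : V}
    (ha : M.node a ∈ frontier Ω) : Z a = 0 := by
  rcases hZ with rfl | ⟨Λ, rfl⟩
  · exact if_pos ha
  · exact if_pos ha

end PolytopalMesh

/-! ### Strongly monotone equations and the abstract error bound -/

section Monotone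

variable {H : Type*} [NormedAddCommGroup H] [InnerProductSpace ℝ H] [CompleteSpace H]

/-- A strongly monotone Lipschitz nonlinear equation on a closed subspace has a solution. -/
lemma exists_monotone_correction (W : Submodule ℝ H) [W.HasOrthogonalProjection] {N : H → H}
    {c L : ℝ} (hc : 0 < c) (hL : 0 < L)
    (hmono : ∀ v w, c * ‖v - w‖ ^ 2 ≤ inner ℝ (v - w) (N v - N w))
    (hlip : ∀ v w, ‖N v - N w‖ ≤ L * ‖v - w‖) (a : H) :
    ∃ w ∈ W, N (a + w) ∈ Wᗮ := by
  have hW : CompleteSpace W := by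
    have : IsClosed (W : Set H) := by
      rw [← W.orthogonal_orthogonal]
      exact Wᗮ.isClosed_orthogonal
    exact this.completeSpace_coe
  -- The damped map has squared Lipschitz constant at most `1 - 2 τ c + τ² L²`; this choice
  -- minimises it, with value `1 - c² / L² < 1`. A fixed point of `Φ` is a `w` at which the
  -- projection of `N (a + w)` onto `W` vanishes.
  set τ : ℝ := c / L ^ 2 with hτ
  have hτ0 : 0 < τ := by positivity
  set Φ : W → W := fun w => w - τ • W.orthogonalProjectionOnto (N (a + w)) with hΦ
  have hK : ContractingWith (Real.toNNReal (Real.sqrt (1 - c ^ 2 / L ^ 2))) Φ := by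
    constructor
    · rw [← NNReal.coe_lt_coe, Real.coe_toNNReal _ (Real.sqrt_nonneg _), NNReal.coe_one,
        Real.sqrt_lt' one_pos]
      have : 0 < c ^ 2 / L ^ 2 := by positivity
      linarith
    · refine LipschitzWith.of_dist_le_mul fun w w' => ?_
      rw [Real.coe_toNNReal _ (Real.sqrt_nonneg _), dist_eq_norm, dist_eq_norm,
        ← Real.sqrt_sq (norm_nonneg (w - w')), ← Real.sqrt_mul' _ (sq_nonneg _)]
      refine Real.le_sqrt_of_sq_le ?_
      have h1 : Φ w - Φ w' = (w - w') - τ • W.orthogonalProjectionOnto (N (a + w) - N (a + w')) := by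
        simp only [hΦ, map_sub, smul_sub]
        abel
      have h2 : (a + (w : H)) - (a + (w' : H)) = ((w - w' : W) : H) := by
        rw [add_sub_add_left_eq_sub]; rfl
      have h3 := hmono (a + w) (a + w')
      have h4 := hlip (a + w) (a + w')
      rw [h2] at h3 h4
      have h5 := W.norm_orthogonalProjectionOnto_apply_le (N (a + w) - N (a + w'))
      have h6 : ‖W.orthogonalProjectionOnto (N (a + w) - N (a + w'))‖ ^ 2 ≤
          L ^ 2 * ‖w - w'‖ ^ 2 := by
        rw [← mul_pow]
        exact pow_le_pow_left₀ (norm_nonneg _) (h5.trans h4) 2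
      rw [h1, norm_sub_sq_real, inner_smul_right, norm_smul, mul_pow, Real.norm_eq_abs, sq_abs,
        Submodule.inner_orthogonalProjectionOnto_eq_of_mem_left]
      change c * ‖w - w'‖ ^ 2 ≤ _ at h3
      have h7 : τ ^ 2 * (L ^ 2 * ‖w - w'‖ ^ 2) = c ^ 2 / L ^ 2 * ‖w - w'‖ ^ 2 := by
        rw [hτ]; field_simp
      have h8 : τ * (c * ‖w - w'‖ ^ 2) = c ^ 2 / L ^ 2 * ‖w - w'‖ ^ 2 := by
        rw [hτ]; field_simp
      nlinarith [mul_le_mul_of_nonneg_left h3 hτ0.le, mul_le_mul_of_nonneg_left h6 (sq_nonneg τ)]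
  set w := ContractingWith.fixedPoint Φ hK with hw
  have hfix : Φ w = w := hK.fixedPoint_isFixedPt
  refine ⟨w, w.2, ?_⟩
  rw [← Submodule.orthogonalProjectionOnto_eq_zero_iff]
  have h1 : τ • W.orthogonalProjectionOnto (N (a + w)) = 0 := by
    have h2 := hfix
    simp only [hΦ, sub_eq_self] at h2
    exact h2
  exact (smul_eq_zero.1 h1).resolve_left hτ0.ne'

/-- The error of an approximation `a` of the solution `u` of a strongly monotone problem is bounded
by a nonconformity part and by a dual norm of a residual. -/
lemma norm_sub_le_of_monotone (W : Submodule ℝ H) [W.HasOrthogonalProjection] {N : H → H}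
    {c L : ℝ} (hc : 0 < c) (hL : 0 < L)
    (hmono : ∀ v w, c * ‖v - w‖ ^ 2 ≤ inner ℝ (v - w) (N v - N w))
    (hlip : ∀ v w, ‖N v - N w‖ ≤ L * ‖v - w‖) {u a g : H} {B : ℝ} (hu : N u ∈ Wᗮ) (hg : g ∈ Wᗮ)
    (hB : ∀ z ∈ Wᗮ, inner ℝ (u - a) z ≤ B * ‖z‖) (hB0 : 0 ≤ B) :
    c * ‖u - a‖ ≤ L * B + ‖N a + g‖ := by
  obtain ⟨w, hw, hN⟩ := exists_monotone_correction W hc hL hmono hlip a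
  have h1 : c * ‖w‖ ≤ ‖N a + g‖ := by
    have h2 := hmono (a + w) a
    rw [add_sub_cancel_left] at h2
    -- Both `N (a + w)` and `g` are orthogonal to `w ∈ W`, so `g` can be inserted freely.
    have h3 : inner ℝ w (N (a + w) - N a) = -inner ℝ w (N a + g) := by
      rw [inner_sub_right, inner_add_right, (Submodule.mem_orthogonal _ _).1 hN w hw,
        (Submodule.mem_orthogonal _ _).1 hg w hw]
      ring
    have h4 := abs_le.1 (abs_real_inner_le_norm w (N a + g))
    by_contra hlt
    push Not at hlt
    rcases (norm_nonneg w).eq_or_lt with h0 | h0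
    · rw [← h0, mul_zero] at hlt
      exact absurd hlt (norm_nonneg _).not_gt
    · nlinarith
  have h2 : c * ‖u - (a + w)‖ ≤ L * B := by
    have h3 := hmono u (a + w)
    have hz : N u - N (a + w) ∈ Wᗮ := Wᗮ.sub_mem hu hN
    -- The difference of the images lies in `Wᗮ`, so the unknown correction `w` drops out and the
    -- dual bound for `u - a` applies.
    have h4 : inner ℝ (u - (a + w)) (N u - N (a + w)) = inner ℝ (u - a) (N u - N (a + w)) := by
      rw [← sub_sub, inner_sub_left, (Submodule.mem_orthogonal _ _).1 hz w hw, sub_zero]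
    have h5 := hB _ hz
    have h6 := mul_le_mul_of_nonneg_left (hlip u (a + w)) hB0
    by_contra hlt
    push Not at hlt
    rcases (norm_nonneg (u - (a + w))).eq_or_lt with h0 | h0
    · rw [← h0, mul_zero] at hlt
      exact absurd hlt (mul_nonneg hL.le hB0).not_gt
    · nlinarith
  have h3 : ‖u - a‖ ≤ ‖u - (a + w)‖ + ‖w‖ := by
    have : u - a = (u - (a + w)) + w := by abel
    rw [this]
    exact norm_add_le _ _
  nlinarith

end Monotone

/-! ### Norms and inner products in `L²` -/

section L2

variable {d : ℕ} {G : Type*} [NormedAddCommGroup G] {s : Set (Euc d)}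

lemma norm_toLp_eq_l2norm {f : Euc d → G} (hf : MemLp f 2 (volume.restrict s)) :
    ‖hf.toLp f‖ = l2norm s f := by
  rw [Lp.norm_toLp, hf.eLpNorm_eq_integral_rpow_norm two_ne_zero ENNReal.ofNat_ne_top,
    ENNReal.toReal_ofReal (Real.rpow_nonneg (integral_nonneg fun _ => by positivity) _), l2norm,
    Real.sqrt_eq_rpow]
  simp

lemma inner_toLp [InnerProductSpace ℝ G] {f g : Euc d → G} (hf : MemLp f 2 (volume.restrict s))
    (hg : MemLp g 2 (volume.restrict s)) :
    inner ℝ (hf.toLp f) (hg.toLp g) = ∫ x in s, inner ℝ (f x) (g x) := by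
  rw [L2.inner_def]
  refine integral_congr_ae ?_
  filter_upwards [hf.coeFn_toLp, hg.coeFn_toLp] with x h1 h2
  rw [h1, h2]

lemma integrable_inner_of_memLp [InnerProductSpace ℝ G] {f g : Euc d → G}
    (hf : MemLp f 2 (volume.restrict s)) (hg : MemLp g 2 (volume.restrict s)) :
    Integrable (fun x => inner ℝ (f x) (g x)) (volume.restrict s) := by
  refine (L2.integrable_inner (𝕜 := ℝ) (hf.toLp f) (hg.toLp g)).congr ?_
  filter_upwards [hf.coeFn_toLp, hg.coeFn_toLp] with x h1 h2
  rw [h1, h2]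

lemma abs_integral_inner_le [InnerProductSpace ℝ G] {f g : Euc d → G}
    (hf : MemLp f 2 (volume.restrict s)) (hg : MemLp g 2 (volume.restrict s)) :
    |∫ x in s, inner ℝ (f x) (g x)| ≤ l2norm s f * l2norm s g := by
  rw [← inner_toLp hf hg, ← norm_toLp_eq_l2norm hf, ← norm_toLp_eq_l2norm hg]
  exact abs_real_inner_le_norm _ _

end L2

/-! ### Test functions and the Friedrichs inequality -/

section Friedrichs

variable {d : ℕ} {Ω : Set (Euc d)}

lemma gradient_apply_eq (φ : Euc d → ℝ) (x : Euc d) (i : Fin d) :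
    gradient φ x i = fderiv ℝ φ x (EuclideanSpace.single i 1) := by
  rw [← inner_gradient_left, EuclideanSpace.inner_single_right]
  simp

namespace IsTestFunction

variable {φ ψ : Euc d → ℝ}

lemma contDiff_one (hφ : IsTestFunction Ω φ) : ContDiff ℝ 1 φ :=
  hφ.1.of_le (by exact_mod_cast le_top)

lemma eq_zero (hφ : IsTestFunction Ω φ) {x : Euc d} (hx : x ∉ Ω) : φ x = 0 :=
  image_eq_zero_of_notMem_tsupport fun h => hx (hφ.2.2 h)

lemma continuous_gradient (hφ : IsTestFunction Ω φ) : Continuous (gradient φ) :=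
  (InnerProductSpace.toDual ℝ (Euc d)).symm.continuous.comp
    (hφ.contDiff_one.continuous_fderiv one_ne_zero)

lemma hasCompactSupport_gradient (hφ : IsTestFunction Ω φ) : HasCompactSupport (gradient φ) :=
  (hφ.2.1.fderiv ℝ).comp_left (map_zero _)

lemma memLp (hφ : IsTestFunction Ω φ) : MemLp φ 2 (volume.restrict Ω) :=
  (hφ.1.continuous.memLp_of_hasCompactSupport hφ.2.1).restrict _

lemma memLp_gradient (hφ : IsTestFunction Ω φ) : MemLp (gradient φ) 2 (volume.restrict Ω) :=
  (hφ.continuous_gradient.memLp_of_hasCompactSupport hφ.hasCompactSupport_gradient).restrict _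

lemma add (hφ : IsTestFunction Ω φ) (hψ : IsTestFunction Ω ψ) : IsTestFunction Ω (φ + ψ) :=
  ⟨hφ.1.add hψ.1, hφ.2.1.add hψ.2.1, (tsupport_add _ _).trans (Set.union_subset hφ.2.2 hψ.2.2)⟩

lemma const_smul (hφ : IsTestFunction Ω φ) (r : ℝ) : IsTestFunction Ω (r • φ) :=
  ⟨hφ.1.const_smul r, hφ.2.1.smul_left (f := fun _ => r),
    (closure_mono (Function.support_const_smul_subset r φ)).trans hφ.2.2⟩

lemma gradient_add (hφ : IsTestFunction Ω φ) (hψ : IsTestFunction Ω ψ) (x : Euc d) :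
    gradient (φ + ψ) x = gradient φ x + gradient ψ x := by
  rw [gradient, fderiv_add (hφ.contDiff_one.differentiable one_ne_zero x)
    (hψ.contDiff_one.differentiable one_ne_zero x), map_add]
  rfl

lemma gradient_const_smul (hφ : IsTestFunction Ω φ) (r : ℝ) (x : Euc d) :
    gradient (r • φ) x = r • gradient φ x := by
  rw [gradient, fderiv_const_smul (hφ.contDiff_one.differentiable one_ne_zero x), map_smulₛₗ]
  rfl

lemma integral_mul_fderiv (hφ : IsTestFunction Ω φ) {f : Euc d → ℝ} (hf : ContDiff ℝ 1 f)
    (v : Euc d) : ∫ x, f x * fderiv ℝ φ x v = -∫ x, fderiv ℝ f x v * φ x := by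
  have h1 : Continuous fun x => fderiv ℝ φ x v :=
    (hφ.contDiff_one.continuous_fderiv one_ne_zero).clm_apply continuous_const
  have h2 : Continuous fun x => fderiv ℝ f x v :=
    (hf.continuous_fderiv one_ne_zero).clm_apply continuous_const
  refine integral_mul_fderiv_eq_neg_fderiv_mul_of_integrable ?_ ?_ ?_
    (fun x _ => hf.differentiable one_ne_zero x)
    (fun x _ => hφ.contDiff_one.differentiable one_ne_zero x)
  · exact (h2.mul hφ.1.continuous).integrable_of_hasCompactSupport hφ.2.1.mul_left
  · exact (hf.continuous.mul h1).integrable_of_hasCompactSupport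
      (hφ.2.1.fderiv_apply ℝ v).mul_left
  · exact (hf.continuous.mul hφ.1.continuous).integrable_of_hasCompactSupport hφ.2.1.mul_left

lemma memH10 (hφ : IsTestFunction Ω φ) : MemH10 Ω φ (gradient φ) := by
  refine ⟨⟨hφ.memLp, hφ.memLp_gradient, fun ψ hψ i => ?_⟩, fun _ => φ, fun _ => hφ, ?_, ?_⟩
  · rw [setIntegral_eq_integral_of_forall_compl_eq_zero fun x hx => by
        rw [hφ.eq_zero hx, zero_mul],
      setIntegral_eq_integral_of_forall_compl_eq_zero fun x hx => by
        rw [hψ.eq_zero hx, mul_zero]]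
    simp only [gradient_apply_eq]
    exact hψ.integral_mul_fderiv hφ.contDiff_one _
  · simp
  · simp

lemma neg_mul_le_of_abs_le {a b c p q : ℝ} (hab : |a| ≤ b) (hcp : |c| ≤ p) :
    -(a * (2 * (q * c))) ≤ 2 * b * (‖q‖ * p) := by
  have h1 : |a| * |c| ≤ b * p := mul_le_mul hab hcp (abs_nonneg _) ((abs_nonneg _).trans hab)
  have h2 := mul_le_mul_of_nonneg_left h1 (abs_nonneg q)
  have h3 : -(a * (2 * (q * c))) ≤ |a * (2 * (q * c))| := neg_le_abs _
  rw [abs_mul, abs_mul, abs_mul, abs_two] at h3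
  rw [Real.norm_eq_abs]
  linarith

/-- The Friedrichs inequality for test functions. -/
lemma l2norm_le (hφ : IsTestFunction Ω φ) (hd : 1 ≤ d) (hΩ : IsOpen Ω) (hΩb : Bornology.IsBounded Ω) :
    l2norm Ω φ ≤ 2 * Metric.diam Ω * l2norm Ω (gradient φ) := by
  rcases Ω.eq_empty_or_nonempty with rfl | ⟨a, ha⟩
  · simp [l2norm]
  let i : Fin d := ⟨0, hd⟩
  have hφ2 : IsTestFunction Ω (fun x => φ x * φ x) :=
    ⟨hφ.1.mul hφ.1, hφ.2.1.mul_left, (tsupport_mul_subset_left).trans hφ.2.2⟩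
  have hf : ContDiff ℝ 1 (fun x : Euc d => x i - a i) :=
    (EuclideanSpace.proj i : Euc d →L[ℝ] ℝ).contDiff.sub contDiff_const
  have hfd : ∀ x, fderiv ℝ (fun x : Euc d => x i - a i) x (EuclideanSpace.single i 1) = 1 := by
    intro x
    have h : HasFDerivAt (fun x : Euc d => x i - a i) (EuclideanSpace.proj i : Euc d →L[ℝ] ℝ) x :=
      (EuclideanSpace.proj i : Euc d →L[ℝ] ℝ).hasFDerivAt.sub_const _
    rw [h.fderiv]
    simp
  -- Integrate `φ²` by parts against `xᵢ - aᵢ`, whose `i`-th derivative is one and whose modulus is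
  -- at most the diameter for `a, x ∈ Ω`. The factor `2` comes from differentiating the square.
  have h1 := hφ2.integral_mul_fderiv hf (EuclideanSpace.single i 1)
  simp only [hfd, one_mul] at h1
  have h2 : ∀ x, fderiv ℝ (fun x => φ x * φ x) x (EuclideanSpace.single i 1) =
      2 * (φ x * gradient φ x i) := by
    intro x
    have hdiff := hφ.contDiff_one.differentiable one_ne_zero x
    rw [fderiv_fun_mul hdiff hdiff, gradient_apply_eq]
    simp
    ring
  simp only [h2] at h1
  have h3 : ∫ x in Ω, ‖φ x‖ ^ 2 = ∫ x, φ x * φ x := by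
    have h4 : ∀ x, ‖φ x‖ ^ 2 = φ x * φ x := fun x => by rw [Real.norm_eq_abs, sq_abs, sq]
    simp_rw [h4]
    exact setIntegral_eq_integral_of_forall_compl_eq_zero fun x hx => by
      rw [hφ.eq_zero hx, zero_mul]
  have h4 : l2norm Ω φ ^ 2 = ∫ x, φ x * φ x := by
    rw [l2norm, Real.sq_sqrt (integral_nonneg fun _ => by positivity), h3]
  have h5 : l2norm Ω φ ^ 2 ≤ 2 * Metric.diam Ω * (l2norm Ω φ * l2norm Ω (gradient φ)) := by
    have h6 : l2norm Ω φ ^ 2 = ∫ x in Ω, -((x i - a i) * (2 * (φ x * gradient φ x i))) := by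
      rw [setIntegral_eq_integral_of_forall_compl_eq_zero fun x hx => by
        rw [hφ.eq_zero hx, zero_mul, mul_zero, mul_zero, neg_zero], integral_neg, h1, neg_neg, h4]
    have hn : MemLp (fun x => ‖φ x‖) 2 (volume.restrict Ω) := hφ.memLp.norm
    have hng : MemLp (fun x => ‖gradient φ x‖) 2 (volume.restrict Ω) := hφ.memLp_gradient.norm
    have h7 : ∫ x in Ω, ‖φ x‖ * ‖gradient φ x‖ ≤ l2norm Ω φ * l2norm Ω (gradient φ) := by
      have h8 := (le_abs_self _).trans (abs_integral_inner_le hn hng)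
      simp only [l2norm, norm_norm] at h8 ⊢
      refine le_trans (le_of_eq ?_) h8
      refine integral_congr_ae (ae_of_all _ fun x => ?_)
      simp [mul_comm]
    rw [h6]
    refine le_trans ?_ (mul_le_mul_of_nonneg_left h7 (by positivity))
    rw [← integral_const_mul]
    have hi : Continuous fun x : Euc d => x i - a i := hf.continuous
    have hgi : Continuous fun x : Euc d => gradient φ x i :=
      (EuclideanSpace.proj i : Euc d →L[ℝ] ℝ).continuous.comp hφ.continuous_gradient
    have hφc := hφ.1.continuous
    refine setIntegral_mono_on ?_ ?_ hΩ.measurableSet fun x hx => ?_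
    · refine Integrable.integrableOn (Continuous.integrable_of_hasCompactSupport
        (hi.mul (continuous_const.mul (hφc.mul hgi))).neg ?_)
      exact HasCompactSupport.intro hφ.2.1 fun x hx => by
        rw [image_eq_zero_of_notMem_tsupport hx, zero_mul, mul_zero, mul_zero, neg_zero]
    · have hg := hφ.continuous_gradient
      refine Integrable.integrableOn (Continuous.integrable_of_hasCompactSupport
        (continuous_const.mul (hφc.norm.mul hg.norm)) ?_)
      exact HasCompactSupport.intro hφ.2.1 fun x hx => by
        rw [image_eq_zero_of_notMem_tsupport hx, norm_zero, zero_mul, mul_zero]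
    · have h9 : |x i - a i| ≤ Metric.diam Ω := by
        refine le_trans ?_ (Metric.dist_le_diam_of_mem hΩb hx ha)
        rw [dist_eq_norm]
        exact PiLp.norm_apply_le (x - a) i
      have h10 : |gradient φ x i| ≤ ‖gradient φ x‖ := PiLp.norm_apply_le (gradient φ x) i
      exact neg_mul_le_of_abs_le h9 h10
  by_contra hlt
  push Not at hlt
  have hpos : 0 < l2norm Ω φ := lt_of_le_of_lt (by unfold l2norm; positivity) hlt
  nlinarith

end IsTestFunction

lemma MemH10.exists_tendsto {v : Euc d → ℝ} {g : Euc d → Euc d} (h : MemH10 Ω v g) :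
    ∃ (φ : ℕ → Euc d → ℝ) (hφ : ∀ n, IsTestFunction Ω (φ n)),
      Tendsto (fun n => (hφ n).memLp.toLp (φ n)) atTop (𝓝 (h.1.1.toLp v)) ∧
      Tendsto (fun n => (hφ n).memLp_gradient.toLp (gradient (φ n))) atTop
        (𝓝 (h.1.2.1.toLp g)) := by
  obtain ⟨φ, hφ, h1, h2⟩ := h.2
  exact ⟨φ, hφ, (Lp.tendsto_Lp_iff_tendsto_eLpNorm'' _ (fun n => (hφ n).memLp) _ _).2 h1,
    (Lp.tendsto_Lp_iff_tendsto_eLpNorm'' _ (fun n => (hφ n).memLp_gradient) _ _).2 h2⟩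

lemma l2norm_nonneg {G : Type*} [NormedAddCommGroup G] (v : Euc d → G) : 0 ≤ l2norm Ω v :=
  Real.sqrt_nonneg _

/-- The Friedrichs inequality with the optimal constant. -/
lemma MemH10.l2norm_le (hd : 1 ≤ d) (hΩ : IsOpen Ω) (hΩb : Bornology.IsBounded Ω) {v : Euc d → ℝ}
    {g : Euc d → Euc d} (h : MemH10 Ω v g) :
    l2norm Ω v ≤ friedrichsConstant Ω * Metric.diam Ω * l2norm Ω g := by
  have hne : (2 : ℝ) ∈ {c : ℝ | 0 ≤ c ∧ ∀ v g, MemH10 Ω v g →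
      l2norm Ω v ≤ c * Metric.diam Ω * l2norm Ω g} := by
    refine ⟨zero_le_two, fun v g h => ?_⟩
    obtain ⟨φ, hφ, h1, h2⟩ := h.exists_tendsto
    rw [← norm_toLp_eq_l2norm h.1.1, ← norm_toLp_eq_l2norm h.1.2.1]
    refine le_of_tendsto_of_tendsto' h1.norm (h2.norm.const_mul _) fun n => ?_
    rw [norm_toLp_eq_l2norm, norm_toLp_eq_l2norm]
    exact (hφ n).l2norm_le hd hΩ hΩb
  rw [mul_assoc]
  have h0 : 0 ≤ Metric.diam Ω * l2norm Ω g := mul_nonneg Metric.diam_nonneg (l2norm_nonneg g)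
  -- The infimum is itself admissible, as each inequality is closed in the constant. When the
  -- right-hand factor vanishes, no division is possible, but any admissible constant already gives
  -- the claim.
  rcases h0.eq_or_lt with h0 | h0
  · have h1 := hne.2 v g h
    rw [mul_assoc, ← h0, mul_zero] at h1
    rwa [← h0, mul_zero]
  · rw [← div_le_iff₀ h0]
    refine le_csInf ⟨2, hne⟩ fun c hc => ?_
    rw [div_le_iff₀ h0, ← mul_assoc]
    exact hc.2 v g h

lemma friedrichsConstant_nonneg : 0 ≤ friedrichsConstant Ω :=
  Real.sInf_nonneg fun _ hc => hc.1

end Friedrichs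

/-! ### The closure of the gradients of test functions -/

section GradSpace

variable {d : ℕ}

/-- The gradients of the test functions, as a subspace of `L²(Ω)ᵈ`. -/
def gradSpace (Ω : Set (Euc d)) : Submodule ℝ (Lp (Euc d) 2 (volume.restrict Ω)) where
  carrier := {z | ∃ φ, IsTestFunction Ω φ ∧ z =ᵐ[volume.restrict Ω] gradient φ}
  add_mem' := by
    rintro z z' ⟨φ, hφ, h⟩ ⟨φ', hφ', h'⟩
    refine ⟨φ + φ', hφ.add hφ', ?_⟩
    filter_upwards [Lp.coeFn_add z z', h, h'] with x h1 h2 h3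
    rw [h1, Pi.add_apply, h2, h3, hφ.gradient_add hφ']
  zero_mem' := by
    refine ⟨0, ⟨contDiff_const, HasCompactSupport.zero, by simp [tsupport]⟩, ?_⟩
    filter_upwards [Lp.coeFn_zero (Euc d) 2 (volume.restrict Ω)] with x h
    rw [h, gradient]
    simp
  smul_mem' := by
    rintro r z ⟨φ, hφ, h⟩
    refine ⟨r • φ, hφ.const_smul r, ?_⟩
    filter_upwards [Lp.coeFn_smul r z, h] with x h1 h2
    rw [h1, Pi.smul_apply, h2, hφ.gradient_const_smul]

variable {Ω : Set (Euc d)}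

lemma IsTestFunction.toLp_mem {φ : Euc d → ℝ} (hφ : IsTestFunction Ω φ) :
    hφ.memLp_gradient.toLp (gradient φ) ∈ gradSpace Ω :=
  ⟨φ, hφ, hφ.memLp_gradient.coeFn_toLp⟩

lemma MemH10.toLp_mem {v : Euc d → ℝ} {g : Euc d → Euc d} (h : MemH10 Ω v g) :
    h.1.2.1.toLp g ∈ (gradSpace Ω)ᗮᗮ := by
  rw [Submodule.orthogonal_orthogonal_eq_closure]
  obtain ⟨φ, hφ, -, h2⟩ := h.exists_tendsto
  exact mem_closure_of_tendsto h2 (Eventually.of_forall fun n => (hφ n).toLp_mem)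

/-- A boundedly convergent sequence of gradients of test functions has its limit in the closure. -/
lemma toLp_mem_of_tendsto [IsFiniteMeasure (volume.restrict Ω)] {φ : ℕ → Euc d → ℝ} {B : ℝ}
    (hφ : ∀ n, IsTestFunction Ω (φ n)) (hB : ∀ n x, ‖gradient (φ n) x‖ ≤ B) {g : Euc d → Euc d}
    (hg : MemLp g 2 (volume.restrict Ω)) (hlim : ∀ᵐ x ∂(volume.restrict Ω),
      Tendsto (fun n => gradient (φ n) x) atTop (𝓝 (g x))) :
    hg.toLp g ∈ (gradSpace Ω)ᗮᗮ := by
  -- Membership in the double orthogonal complement asks only for weak convergence: dominated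
  -- convergence with the majorant `‖w‖ B` lets the orthogonality of `w` to all the gradients pass
  -- to the limit.
  rw [Submodule.mem_orthogonal]
  intro w hw
  have h1 : ∀ n, ∫ x in Ω, inner ℝ (w x) (gradient (φ n) x) = 0 := by
    intro n
    have h := (Submodule.mem_orthogonal' _ _).1 hw _ (hφ n).toLp_mem
    rw [L2.inner_def] at h
    rw [← h]
    refine integral_congr_ae ?_
    filter_upwards [(hφ n).memLp_gradient.coeFn_toLp] with x hx
    rw [hx]
  have h2 : inner ℝ w (hg.toLp g) = ∫ x in Ω, inner ℝ (w x) (g x) := by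
    rw [L2.inner_def]
    refine integral_congr_ae ?_
    filter_upwards [hg.coeFn_toLp] with x hx
    rw [hx]
  have h3 : Tendsto (fun n => ∫ x in Ω, inner ℝ (w x) (gradient (φ n) x)) atTop
      (𝓝 (∫ x in Ω, inner ℝ (w x) (g x))) := by
    refine tendsto_integral_of_dominated_convergence (fun x => ‖w x‖ * B) (fun n => ?_) ?_
      (fun n => ae_of_all _ fun x => ?_) ?_
    · exact (Lp.aestronglyMeasurable w).inner (hφ n).continuous_gradient.aestronglyMeasurable
    · exact ((Lp.memLp w).integrable one_le_two).norm.mul_const B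
    · exact (norm_inner_le_norm _ _).trans (mul_le_mul_of_nonneg_left (hB n x) (norm_nonneg _))
    · filter_upwards [hlim] with x hx
      exact tendsto_const_nhds.inner hx
  simp only [h1] at h3
  rw [h2]
  exact tendsto_nhds_unique h3 tendsto_const_nhds

lemma inner_le_of_forall_testFunction {v : Euc d → Euc d} (hv : MemLp v 2 (volume.restrict Ω))
    {B : ℝ} (hB : ∀ φ, IsTestFunction Ω φ →
      ∫ x in Ω, inner ℝ (v x) (gradient φ x) ≤ B * l2norm Ω (gradient φ))
    {z : Lp (Euc d) 2 (volume.restrict Ω)} (hz : z ∈ (gradSpace Ω)ᗮᗮ) :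
    inner ℝ (hv.toLp v) z ≤ B * ‖z‖ := by
  rw [Submodule.orthogonal_orthogonal_eq_closure] at hz
  have hcl : IsClosed {z : Lp (Euc d) 2 (volume.restrict Ω) | inner ℝ (hv.toLp v) z ≤ B * ‖z‖} :=
    isClosed_le (by fun_prop) (by fun_prop)
  refine closure_minimal ?_ hcl hz
  rintro z ⟨φ, hφ, h⟩
  have hzφ : z = hφ.memLp_gradient.toLp (gradient φ) :=
    Lp.ext (h.trans hφ.memLp_gradient.coeFn_toLp.symm)
  rw [Set.mem_ofPred_eq, hzφ, inner_toLp, norm_toLp_eq_l2norm]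
  exact hB φ hφ

end GradSpace


/-! ### The error bound for the Darcy flux -/

lemma IsAdmissibleLaw.lipschitzWith_E {d : ℕ} {D E : ℝ → Euc d →L[ℝ] Euc d} {c L : ℝ}
    (hlaw : IsAdmissibleLaw D E c L) :
    LipschitzWith (Real.toNNReal L) fun v : Euc d => E ‖v‖ v :=
  LipschitzWith.of_dist_le_mul fun v w => by
    rw [Real.coe_toNNReal _ hlaw.L_pos.le, dist_eq_norm, dist_eq_norm]
    exact hlaw.lipschitz v w

/-- The inverse of a strongly monotone map with constant `c` is Lipschitz with constant `c⁻¹`. This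
gives measurability and square integrability of the exact flux. -/
lemma IsAdmissibleLaw.lipschitzWith_D {d : ℕ} {D E : ℝ → Euc d →L[ℝ] Euc d} {c L : ℝ}
    (hlaw : IsAdmissibleLaw D E c L) :
    LipschitzWith (Real.toNNReal c⁻¹) fun w : Euc d => -(D ‖w‖ w) :=
  LipschitzWith.of_dist_le_mul fun w w' => by
    have hc := hlaw.c_pos
    rw [Real.coe_toNNReal _ (by positivity), dist_eq_norm, dist_eq_norm]
    set v := -(D ‖w‖ w) with hv
    set v' := -(D ‖w'‖ w') with hv'
    have h1 := (hlaw.inverse v w).1 hv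
    have h2 := (hlaw.inverse v' w').1 hv'
    have h3 := hlaw.strongly_monotone v v'
    have h4 : E ‖v‖ v - E ‖v'‖ v' = w' - w := by
      rw [h1, h2]
      abel
    rw [h4] at h3
    have h5 := real_inner_le_norm (v - v') (w' - w)
    rw [norm_sub_rev w' w] at h5
    rw [inv_mul_eq_div, le_div_iff₀ hc]
    rcases (norm_nonneg (v - v')).eq_or_lt with h0 | h0
    · rw [← h0, zero_mul]
      positivity
    · nlinarith

/-- The flux error is bounded by a dual norm of the residual and a nonconformity term. -/
theorem flux_error_le {d : ℕ} {Ω : Set (Euc d)} {D E : ℝ → Euc d →L[ℝ] Euc d} {c L : ℝ}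
    (hlaw : IsAdmissibleLaw D E c L) {p : Euc d → ℝ} {gp : Euc d → Euc d} (hp : MemH10 Ω p gp)
    {a g : Euc d → Euc d} (ha : MemLp a 2 (volume.restrict Ω)) (hg : MemLp g 2 (volume.restrict Ω))
    (hgm : hg.toLp g ∈ (gradSpace Ω)ᗮᗮ) {B : ℝ} (hB0 : 0 ≤ B)
    (hB : ∀ φ, IsTestFunction Ω φ →
      ∫ x in Ω, inner ℝ (darcyFlux D gp x - a x) (gradient φ x) ≤ B * l2norm Ω (gradient φ)) :
    MemLp (fun x => E ‖a x‖ (a x)) 2 (volume.restrict Ω) ∧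
    c * l2norm Ω (fun x => darcyFlux D gp x - a x) ≤
      L * B + l2norm Ω (fun x => E ‖a x‖ (a x) + g x) := by
  have hE0 : (fun v : Euc d => E ‖v‖ v) 0 = 0 := by simp
  have hD0 : (fun w : Euc d => -(D ‖w‖ w)) 0 = 0 := by simp
  have hu : MemLp (darcyFlux D gp) 2 (volume.restrict Ω) :=
    hlaw.lipschitzWith_D.comp_memLp hD0 hp.1.2.1
  have hEa : MemLp (fun x => E ‖a x‖ (a x)) 2 (volume.restrict Ω) :=
    hlaw.lipschitzWith_E.comp_memLp hE0 ha
  refine ⟨hEa, ?_⟩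
  set N := hlaw.lipschitzWith_E.compLp (p := 2) (μ := volume.restrict Ω) hE0 with hN
  have hNx : ∀ v, N v =ᵐ[volume.restrict Ω] fun x => E ‖v x‖ (v x) := fun v =>
    hlaw.lipschitzWith_E.coeFn_compLp hE0 v
  have hmono : ∀ v w, c * ‖v - w‖ ^ 2 ≤ inner ℝ (v - w) (N v - N w) := by
    intro v w
    rw [← real_inner_self_eq_norm_sq, L2.inner_def, L2.inner_def, ← integral_const_mul]
    refine integral_mono_ae ((L2.integrable_inner _ _).const_mul c) (L2.integrable_inner _ _) ?_
    filter_upwards [Lp.coeFn_sub v w, Lp.coeFn_sub (N v) (N w), hNx v, hNx w] with x h1 h2 h3 h4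
    rw [h1, h2, Pi.sub_apply, Pi.sub_apply, h3, h4, real_inner_self_eq_norm_sq]
    exact hlaw.strongly_monotone _ _
  have hlip : ∀ v w, ‖N v - N w‖ ≤ L * ‖v - w‖ := fun v w => by
    have := hlaw.lipschitzWith_E.norm_compLp_sub_le hE0 v w
    rwa [Real.coe_toNNReal _ hlaw.L_pos.le] at this
  have hNu : N (hu.toLp _) ∈ (gradSpace Ω)ᗮᗮ := by
    have h : N (hu.toLp _) = -hp.1.2.1.toLp gp := by
      refine Lp.ext ?_
      filter_upwards [hNx (hu.toLp _), hu.coeFn_toLp, Lp.coeFn_neg (hp.1.2.1.toLp gp),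
        hp.1.2.1.coeFn_toLp] with x h1 h2 h3 h4
      rw [h1, h2, h3, Pi.neg_apply, h4]
      have h5 := (hlaw.inverse (darcyFlux D gp x) (gp x)).1 rfl
      conv_rhs => rw [h5]
      rw [neg_neg]
    rw [h]
    exact Submodule.neg_mem _ hp.toLp_mem
  -- The subspace `W` is the orthogonal complement of the gradients. Its own complement is their
  -- closure, to which the bound known for test functions extends by density.
  have h := norm_sub_le_of_monotone (gradSpace Ω)ᗮ hlaw.c_pos hlaw.L_pos hmono hlip hNu
    (a := ha.toLp a) hgm (fun z hz => by
      rw [← MemLp.toLp_sub]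
      exact inner_le_of_forall_testFunction (hu.sub ha) hB hz) hB0
  rw [← MemLp.toLp_sub, norm_toLp_eq_l2norm] at h
  have hNa : N (ha.toLp a) = hEa.toLp _ := by
    refine Lp.ext ?_
    filter_upwards [hNx (ha.toLp a), ha.coeFn_toLp, hEa.coeFn_toLp] with x h1 h2 h3
    rw [h1, h2, h3]
  rw [hNa, ← MemLp.toLp_add, norm_toLp_eq_l2norm] at h
  exact h

/-! ### The estimators as norms and dual norms -/

namespace PolytopalMesh

variable {d : ℕ} {Ω : Set (Euc d)} {T S V C F : Type*} [Fintype T] [Fintype S] [Fintype V]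
  [Fintype C] [Fintype F] (M : PolytopalMesh d Ω T S V C F)

lemma hull_subset_cellSet (κ : T) : M.hull κ ⊆ M.cellSet (M.cell κ) :=
  Set.subset_iUnion (fun κ : M.Sub (M.cell κ) => M.hull κ.1) ⟨κ, rfl⟩

lemma integral_cellSet (hd : 1 ≤ d) (K : C) {f : Euc d → ℝ}
    (hf : ∀ κ, IntegrableOn f (M.hull κ)) :
    ∫ x in M.cellSet K, f x = ∑ κ : M.Sub K, ∫ x in M.hull κ.1, f x := by
  rw [M.restrict_cellSet hd]
  exact integral_finsetSum_measure fun κ _ => hf κ.1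

/-- The source term tested with a function, for a cellwise constant source. -/
lemma integral_source_mul (hd : 1 ≤ d) (hΩr : interior (closure Ω) = Ω) {f : Euc d → ℝ}
    (hf : ∀ K, ∃ fK : ℝ, ∀ᵐ x ∂(volume.restrict (M.cellSet K)), f x = fK) {φ : Euc d → ℝ}
    (hφ : Continuous φ) :
    ∫ x in Ω, f x * φ x = ∑ K, M.load f K / M.cellVol K * ∫ x in M.cellSet K, φ x := by
  choose fK hfK using hf
  have hload : ∀ K, M.load f K / M.cellVol K = fK K := by
    intro K
    rw [load, integral_congr_ae (hfK K), setIntegral_const, smul_eq_mul]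
    exact mul_div_cancel_left₀ _ (M.cellVol_pos hd K).ne'
  have hint : ∀ κ, IntegrableOn φ (M.hull κ) := fun κ =>
    hφ.continuousOn.integrableOn_compact (isCompact_hull _)
  rw [M.integral_eq_sum_hull hd hΩr (g := fun κ x => fK (M.cell κ) * φ x), M.sum_cells]
  · refine Finset.sum_congr rfl fun K _ => ?_
    rw [hload, M.integral_cellSet hd K hint, Finset.mul_sum]
    refine Finset.sum_congr rfl fun κ _ => ?_
    rw [integral_const_mul, κ.2]
  · intro κ
    filter_upwards [ae_restrict_of_ae_restrict_of_subset (M.hull_subset_cellSet κ)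
      (hfK (M.cell κ))] with x hx
    rw [hx]
  · exact fun κ => (hint κ).const_mul _

/-- The algebraic residual tested with a function. -/
lemma sum_residual_le (hd : 1 ≤ d) (hΩr : interior (closure Ω) = Ω) (R : C → ℝ) {φ : Euc d → ℝ}
    (hφ : Continuous φ) :
    |∑ K, R K / M.cellVol K * ∫ x in M.cellSet K, φ x| ≤
      Real.sqrt (∑ K, R K ^ 2 / M.cellVol K) * l2norm Ω φ := by
  have hfin : ∀ K, IsFiniteMeasure (volume.restrict (M.cellSet K)) := fun K =>
    ⟨by rw [Measure.restrict_apply_univ]; exact (M.isCompact_cellSet K).measure_lt_top⟩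
  have hint : ∀ κ, IntegrableOn (fun x => ‖φ x‖ ^ 2) (M.hull κ) := fun κ =>
    (hφ.norm.pow 2).continuousOn.integrableOn_compact (isCompact_hull _)
  have h1 : ∀ K, |∫ x in M.cellSet K, φ x| ≤
      Real.sqrt (M.cellVol K) * l2norm (M.cellSet K) φ := by
    intro K
    have hmem : MemLp φ 2 (volume.restrict (M.cellSet K)) := by
      obtain ⟨b, hb⟩ := (M.isCompact_cellSet K).exists_bound_of_continuousOn hφ.continuousOn
      exact MemLp.of_bound hφ.aestronglyMeasurable b
        (ae_restrict_of_forall_mem (M.isCompact_cellSet K).measurableSet hb)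
    have h := abs_integral_inner_le (s := M.cellSet K) (f := fun _ => (1 : ℝ)) (memLp_const 1) hmem
    have h2 : l2norm (M.cellSet K) (fun _ => (1 : ℝ)) = Real.sqrt (M.cellVol K) := by
      rw [l2norm, setIntegral_const]
      simp [cellVol]
    rw [h2] at h
    refine le_trans (le_of_eq ?_) h
    congr 1
    refine integral_congr_ae (ae_of_all _ fun x => ?_)
    simp
  have h2 : ∑ K, l2norm (M.cellSet K) φ ^ 2 = l2norm Ω φ ^ 2 := by
    rw [l2norm, Real.sq_sqrt (integral_nonneg fun _ => by positivity),
      M.integral_eq_sum_hull hd hΩr (fun _ => EventuallyEq.rfl) hint, M.sum_cells]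
    refine Finset.sum_congr rfl fun K _ => ?_
    rw [l2norm, Real.sq_sqrt (integral_nonneg fun _ => by positivity),
      M.integral_cellSet hd K hint]
  calc |∑ K, R K / M.cellVol K * ∫ x in M.cellSet K, φ x|
      ≤ ∑ K, |R K| / Real.sqrt (M.cellVol K) * l2norm (M.cellSet K) φ := by
        refine (Finset.abs_sum_le_sum_abs _ _).trans (Finset.sum_le_sum fun K _ => ?_)
        have hV := M.cellVol_pos hd K
        rw [abs_mul, abs_div, abs_of_pos hV]
        refine (mul_le_mul_of_nonneg_left (h1 K) (by positivity)).trans (le_of_eq ?_)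
        have hs := Real.sqrt_pos.2 hV
        nth_rewrite 1 [← Real.sq_sqrt hV.le]
        field_simp
    _ ≤ Real.sqrt (∑ K, (|R K| / Real.sqrt (M.cellVol K)) ^ 2) *
        Real.sqrt (∑ K, l2norm (M.cellSet K) φ ^ 2) := Real.sum_mul_le_sqrt_mul_sqrt _ _ _
    _ = _ := by
        rw [h2, Real.sqrt_sq (l2norm_nonneg φ)]
        congr 2
        refine Finset.sum_congr rfl fun K _ => ?_
        rw [div_pow, sq_abs, Real.sq_sqrt (M.cellVol_pos hd K).le]

lemma gradField_mem (hd : 1 ≤ d) (hΩ : IsOpen Ω) (hΩb : Bornology.IsBounded Ω)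
    (hΩr : interior (closure Ω) = Ω) {Z : V → ℝ} (hZ : ∀ a, M.node a ∈ frontier Ω → Z a = 0) :
    (M.memLp_toField (fun κ => (M.pointGrad Z κ, 0)) 2 Ω).toLp (M.gradField Z) ∈
      (gradSpace Ω)ᗮᗮ := by
  obtain ⟨φ, B, hφ, hB, hlim⟩ := M.exists_testFunctions_tendsto hd hΩ hΩb hΩr hZ
  have : IsFiniteMeasure (volume.restrict Ω) :=
    ⟨by rw [Measure.restrict_apply_univ]; exact hΩb.measure_lt_top⟩
  exact toLp_mem_of_tendsto hφ hB _ (hlim.mono fun x hx =>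
    tendsto_const_nhds.congr' (hx.mono fun n hn => hn.symm))

/-- The discretization estimators are nonnegative and bound the nonconformity of the flux. -/
lemma etaSpSq_bounds (hd : 1 ≤ d) (hΩr : interior (closure Ω) = Ω)
    {D E : ℝ → Euc d →L[ℝ] Euc d} {c L : ℝ} (hlaw : IsAdmissibleLaw D E c L) {J : C → Type*}
    [∀ K, Fintype (J K)] (q : ∀ K, Module.Basis (J K) ℝ (M.Q0 K)) {U : F → ℝ}
    {u : T → Euc d × ℝ} (hu : M.IsLift U u)
    (hq : ∀ K, M.elemFlux U K ⬝ᵥ (M.mfeMatrix (c⁻¹ * L ^ 2) K (q K) *ᵥ M.elemFlux U K) =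
        c⁻¹ * L ^ 2 * M.energy K (fun κ => u κ.1)) (Z : V → ℝ)
    (hE : MemLp (fun x => E ‖M.toField u x‖ (M.toField u x)) 2 (volume.restrict Ω)) :
    (∀ K, 0 ≤ etaSpSq M q c L U Z K) ∧
      (Real.sqrt c)⁻¹ * l2norm Ω (fun x => E ‖M.toField u x‖ (M.toField u x) + M.gradField Z x) ≤
        Real.sqrt (∑ K, etaSpSq M q c L U Z K) := by
  have hc := hlaw.c_pos
  have hpt : ∀ a g w : Euc d, c⁻¹ * ‖E ‖w‖ a + g‖ ^ 2 ≤
      c⁻¹ * L ^ 2 * ‖a‖ ^ 2 + c⁻¹ ^ 2 * L * ‖g‖ ^ 2 + 2 * c⁻¹ * L * inner ℝ a g := fun a g w =>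
    norm_add_sq_le_of_isSymm hc hlaw.L_pos (hlaw.symm_E w) (fun v => hlaw.eig_lower v w)
      (fun v => hlaw.eig_upper v w) a g
  have hη := fun K => M.etaSpSq_eq hd q c L hu K (hq K) Z
  set Q : T → Euc d → ℝ := fun κ x => c⁻¹ * L ^ 2 * ‖rtEval (u κ) x‖ ^ 2 +
    c⁻¹ ^ 2 * L * ‖M.pointGrad Z κ‖ ^ 2 + 2 * c⁻¹ * L * inner ℝ (rtEval (u κ) x) (M.pointGrad Z κ)
    with hQ
  -- The tensor in `hpt` is frozen at an arbitrary vector `w`, independent of `a`. For the sign any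
  -- `w` will do, such as zero; for the bound itself `w` is the value of the reconstructed flux.
  have hQ0 : ∀ κ x, 0 ≤ Q κ x := fun κ x =>
    le_trans (by positivity) (hpt (rtEval (u κ) x) (M.pointGrad Z κ) 0)
  have hQint : ∀ κ, IntegrableOn (Q κ) (M.hull κ) := fun κ => by
    have hr := continuous_rtEval (u κ)
    refine Continuous.continuousOn ?_ |>.integrableOn_compact (isCompact_hull _)
    fun_prop
  refine ⟨fun K => ?_, ?_⟩
  · rw [hη]
    exact Finset.sum_nonneg fun κ _ => integral_nonneg (hQ0 κ.1)
  · refine Real.le_sqrt_of_sq_le ?_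
    rw [mul_pow, inv_pow, Real.sq_sqrt hc.le, l2norm,
      Real.sq_sqrt (integral_nonneg fun _ => by positivity), ← integral_const_mul]
    set q' : Euc d → ℝ := fun x => c⁻¹ * L ^ 2 * ‖M.toField u x‖ ^ 2 +
      c⁻¹ ^ 2 * L * ‖M.gradField Z x‖ ^ 2 + 2 * c⁻¹ * L * inner ℝ (M.toField u x) (M.gradField Z x)
      with hq'
    have hqQ : ∀ κ, q' =ᵐ[volume.restrict (M.hull κ)] Q κ := fun κ => by
      filter_upwards [M.ae_mem_interior_hull κ] with x hx
      simp only [hq', hQ, M.toField_of_mem_interior u hx, M.gradField_of_mem_interior Z hx]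
    have hsum : ∑ K, etaSpSq M q c L U Z K = ∫ x in Ω, q' x := by
      rw [M.integral_eq_sum_hull hd hΩr hqQ hQint, M.sum_cells]
      exact Finset.sum_congr rfl fun K _ => hη K
    rw [hsum]
    refine integral_mono ?_ (M.integrableOn_of_hull hd hΩr hqQ hQint) fun x => hpt _ _ _
    exact ((hE.add (M.memLp_toField (fun κ => (M.pointGrad Z κ, 0)) 2 Ω)).integrable_norm_pow
      two_ne_zero).const_mul _

/-- The flux estimators sum up to the norm of the lifted flux. -/
lemma sqrt_sum_etaFluxSq (hd : 1 ≤ d) (hΩr : interior (closure Ω) = Ω) {c L : ℝ} (hc : 0 < c)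
    (hL : 0 < L) {J : C → Type*} [∀ K, Fintype (J K)] (q : ∀ K, Module.Basis (J K) ℝ (M.Q0 K))
    {U : F → ℝ} {u : T → Euc d × ℝ}
    (hq : ∀ K, M.elemFlux U K ⬝ᵥ (M.mfeMatrix (c⁻¹ * L ^ 2) K (q K) *ᵥ M.elemFlux U K) =
        c⁻¹ * L ^ 2 * M.energy K (fun κ => u κ.1)) :
    (∀ K, 0 ≤ etaFluxSq M q c L U K) ∧
      Real.sqrt (∑ K, etaFluxSq M q c L U K) = (Real.sqrt c)⁻¹ * L * l2norm Ω (M.toField u) := by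
  constructor
  · intro K
    rw [etaFluxSq, hq, ← cellForm_self]
    exact mul_nonneg (by positivity) (M.cellForm_self_nonneg K _)
  · have h : ∑ K, etaFluxSq M q c L U K = ((Real.sqrt c)⁻¹ * L * l2norm Ω (M.toField u)) ^ 2 := by
      rw [mul_pow, mul_pow, inv_pow, Real.sq_sqrt hc.le, M.l2norm_toField_sq hd hΩr, Finset.mul_sum]
      exact Finset.sum_congr rfl fun K _ => hq K
    rw [h, Real.sqrt_sq]
    have := l2norm_nonneg (Ω := Ω) (M.toField u)
    positivity

lemma sqrt_sum_etaRem {c L : ℝ} (hc : 0 < c) (hL : 0 < L) (hd : 1 ≤ d) (R : C → ℝ) :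
    Real.sqrt (∑ K, etaRem M c L R K ^ 2) =
      (Real.sqrt c)⁻¹ * L * (friedrichsConstant Ω * Metric.diam Ω *
        Real.sqrt (∑ K, R K ^ 2 / M.cellVol K)) := by
  have h0 : 0 ≤ (Real.sqrt c)⁻¹ * L * (friedrichsConstant Ω * Metric.diam Ω) := by
    have := friedrichsConstant_nonneg (Ω := Ω)
    positivity
  rw [← mul_assoc, ← Real.sqrt_sq h0, ← Real.sqrt_mul (sq_nonneg _), Finset.mul_sum]
  congr 1
  refine Finset.sum_congr rfl fun K _ => ?_
  rw [etaRem, mul_pow, mul_pow _ (Real.sqrt (M.cellVol K))⁻¹, inv_pow (Real.sqrt (M.cellVol K)),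
    Real.sq_sqrt (M.cellVol_pos hd K).le, sq_abs]
  ring

lemma outflux_add (U U' : F → ℝ) (K : C) :
    M.outflux (U + U') K = M.outflux U K + M.outflux U' K := by
  simp only [outflux, Pi.add_apply, add_mul, Finset.sum_add_distrib]

end PolytopalMesh

end NonlinearDarcy

end

/-! ### The guaranteed estimate -/

open NonlinearDarcy in
theorem mainTheorem6 {d : ℕ} (hd : 1 ≤ d) {Ω : Set (Euc d)} (hΩ_open : IsOpen Ω)
    (hΩ_bounded : Bornology.IsBounded Ω) (hΩ_connected : IsConnected Ω)
    (hΩ_regular : interior (closure Ω) = Ω)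
    {T S V C F : Type*} [Fintype T] [Fintype S] [Fintype V] [Fintype C] [Fintype F]
    (M : PolytopalMesh d Ω T S V C F)
    (D E : ℝ → Euc d →L[ℝ] Euc d) (c L : ℝ) (hlaw : IsAdmissibleLaw D E c L)
    (f : Euc d → ℝ) (hf : ∀ K, ∃ fK : ℝ, ∀ᵐ x ∂(volume.restrict (M.cellSet K)), f x = fK)
    (p : Euc d → ℝ) (gp : Euc d → Euc d) (hp : IsWeakSolution Ω D f p gp)
    (A : IterativeScheme C F) (k i j : ℕ) (hk : 1 ≤ k) (hi : 1 ≤ i) (hj : 1 ≤ j)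
    (Z : V → ℝ) (hZ : M.IsPointValues (A.iterate k i) Z)
    {J : C → Type*} [∀ K, Fintype (J K)] (q : ∀ K, Module.Basis (J K) ℝ (M.Q0 K)) :
    (∀ K, 0 ≤ etaSpSq M q c L (A.discFlux k i) Z K ∧
      0 ≤ etaFluxSq M q c L (A.linErrFlux k i) K ∧
      0 ≤ etaFluxSq M q c L (A.algErrFlux k i j) K) ∧
    ∃ uh : T → Euc d × ℝ, M.IsFluxReconstruction (A.discFlux k i) uh ∧
      (∀ u', M.IsFluxReconstruction (A.discFlux k i) u' → u' = uh) ∧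
      (∃ w, HasWeakDivergence Ω (M.toField uh) w) ∧
      Real.sqrt c * l2norm Ω (fun x => darcyFlux D gp x - M.toField uh x) ≤
        Real.sqrt (∑ K, etaSpSq M q c L (A.discFlux k i) Z K)
        + Real.sqrt (∑ K, etaFluxSq M q c L (A.linErrFlux k i) K)
        + Real.sqrt (∑ K, etaFluxSq M q c L (A.algErrFlux k i j) K)
        + Real.sqrt (∑ K, etaRem M c L (A.residual M f k (i + j)) K ^ 2) := by
  have hc := hlaw.c_pos
  have hL := hlaw.L_pos
  have hα : 0 < c⁻¹ * L ^ 2 := by positivity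
  obtain ⟨uh, huh, huniq, hlift, hen⟩ := M.exists_fluxReconstruction hd hα q (A.discFlux k i)
  obtain ⟨ul, -, -, hliftl, henl⟩ := M.exists_fluxReconstruction hd hα q (A.linErrFlux k i)
  obtain ⟨ua, -, -, hlifta, hena⟩ := M.exists_fluxReconstruction hd hα q (A.algErrFlux k i j)
  obtain ⟨hlin0, hlin⟩ := M.sqrt_sum_etaFluxSq hd hΩ_regular hc hL q henl
  obtain ⟨halg0, halg⟩ := M.sqrt_sum_etaFluxSq hd hΩ_regular hc hL q hena
  set R := A.residual M f k (i + j) with hR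
  set ρ := friedrichsConstant Ω * Metric.diam Ω * Real.sqrt (∑ K, R K ^ 2 / M.cellVol K) with hρ
  have hρ0 : 0 ≤ ρ := mul_nonneg (mul_nonneg friedrichsConstant_nonneg Metric.diam_nonneg)
    (Real.sqrt_nonneg _)
  -- The three fluxes telescope to the linearized flux at the iterate `i + j`, which balances the
  -- source up to the algebraic residual of that iterate.
  have hR' : ∀ K, M.load f K - M.outflux (A.discFlux k i) K =
      R K + M.outflux (A.linErrFlux k i) K + M.outflux (A.algErrFlux k i j) K := by
    intro K
    have h1 : A.linFlux (k - 1) (A.iterate k (i + j)) =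
        A.discFlux k i + A.linErrFlux k i + A.algErrFlux k i j := by
      simp only [IterativeScheme.discFlux, IterativeScheme.linErrFlux, IterativeScheme.algErrFlux]
      abel
    rw [hR, IterativeScheme.residual, h1, M.outflux_add, M.outflux_add]
    ring
  have hu : MemLp (darcyFlux D gp) 2 (volume.restrict Ω) :=
    hlaw.lipschitzWith_D.comp_memLp (by simp) hp.1.1.2.1
  have hB : ∀ φ, IsTestFunction Ω φ →
      ∫ x in Ω, inner ℝ (darcyFlux D gp x - M.toField uh x) (gradient φ x) ≤
        (l2norm Ω (M.toField ul) + l2norm Ω (M.toField ua) + ρ) * l2norm Ω (gradient φ) := by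
    intro φ hφ
    have hsol : ∫ x in Ω, inner ℝ (darcyFlux D gp x) (gradient φ x) =
        -∑ K, M.load f K / M.cellVol K * ∫ x in M.cellSet K, φ x := by
      rw [← M.integral_source_mul hd hΩ_regular hf hφ.1.continuous,
        ← hp.2 φ (gradient φ) hφ.memH10, ← integral_neg]
      simp only [darcyFlux, inner_neg_left]
    have hsplit : ∫ x in Ω, inner ℝ (darcyFlux D gp x - M.toField uh x) (gradient φ x) =
        (∫ x in Ω, inner ℝ (darcyFlux D gp x) (gradient φ x)) -
          ∫ x in Ω, inner ℝ (M.toField uh x) (gradient φ x) := by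
      simp only [inner_sub_left]
      exact integral_sub (integrable_inner_of_memLp hu hφ.memLp_gradient)
        (integrable_inner_of_memLp (M.memLp_toField uh 2 Ω) hφ.memLp_gradient)
    have hlif := fun {U : F → ℝ} {u : T → Euc d × ℝ} (hU : M.IsLift U u) =>
      M.integral_inner_toField_gradient hd hΩ_open hΩ_regular hU hφ
    -- The imbalance of `u_h` is split by origin: the outfluxes of the error fluxes are rewritten
    -- through their lifts, so that only the residual has to be paired with `φ` itself and costs the
    -- Friedrichs constant.
    have hident : ∫ x in Ω, inner ℝ (darcyFlux D gp x - M.toField uh x) (gradient φ x) =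
        (∫ x in Ω, inner ℝ (M.toField ul x) (gradient φ x)) +
          (∫ x in Ω, inner ℝ (M.toField ua x) (gradient φ x)) -
          ∑ K, R K / M.cellVol K * ∫ x in M.cellSet K, φ x := by
      rw [hsplit, hsol, hlif hlift, hlif hliftl, hlif hlifta]
      simp only [← Finset.sum_neg_distrib, ← Finset.sum_add_distrib, ← Finset.sum_sub_distrib]
      refine Finset.sum_congr rfl fun K _ => ?_
      have h1 : M.load f K = M.outflux (A.discFlux k i) K + (R K +
          M.outflux (A.linErrFlux k i) K + M.outflux (A.algErrFlux k i j) K) := by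
        rw [← hR']
        ring
      rw [h1]
      ring
    have h1 := le_of_abs_le (abs_integral_inner_le (M.memLp_toField ul 2 Ω) hφ.memLp_gradient)
    have h2 := le_of_abs_le (abs_integral_inner_le (M.memLp_toField ua 2 Ω) hφ.memLp_gradient)
    have h3 := neg_le_of_abs_le (M.sum_residual_le hd hΩ_regular R hφ.1.continuous)
    have h4 := mul_le_mul_of_nonneg_left (hφ.memH10.l2norm_le hd hΩ_open hΩ_bounded)
      (Real.sqrt_nonneg (∑ K, R K ^ 2 / M.cellVol K))
    have h5 : Real.sqrt (∑ K, R K ^ 2 / M.cellVol K) *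
        (friedrichsConstant Ω * Metric.diam Ω * l2norm Ω (gradient φ)) =
          ρ * l2norm Ω (gradient φ) := by
      rw [hρ]
      ring
    rw [hident]
    linarith
  have hZ0 : ∀ a, M.node a ∈ frontier Ω → Z a = 0 := fun a ha => hZ.eq_zero ha
  obtain ⟨hE, herr⟩ := flux_error_le hlaw hp.1 (M.memLp_toField uh 2 Ω)
    (M.memLp_toField (fun κ => (M.pointGrad Z κ, 0)) 2 Ω)
    (M.gradField_mem hd hΩ_open hΩ_bounded hΩ_regular hZ0)
    (add_nonneg (add_nonneg (l2norm_nonneg _) (l2norm_nonneg _)) hρ0) hB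
  obtain ⟨hsp0, hsp⟩ := M.etaSpSq_bounds hd hΩ_regular hlaw q hlift hen Z hE
  refine ⟨fun K => ⟨hsp0 K, hlin0 K, halg0 K⟩, uh, huh, huniq,
    M.exists_hasWeakDivergence hd hΩ_open hΩ_regular hlift, ?_⟩
  rw [hlin, halg, M.sqrt_sum_etaRem hc hL hd]
  have hsc : 0 < Real.sqrt c := Real.sqrt_pos.2 hc
  -- Dividing by `√c` turns `c` into `√c` on the left and produces the common factor `c^(-1/2) L` of
  -- the three estimators other than the discretization one.
  have h1 := mul_le_mul_of_nonneg_left herr (inv_nonneg.2 hsc.le)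
  have h2 : (Real.sqrt c)⁻¹ * (c * l2norm Ω (fun x => darcyFlux D gp x - M.toField uh x)) =
      Real.sqrt c * l2norm Ω (fun x => darcyFlux D gp x - M.toField uh x) := by
    nth_rewrite 2 [← Real.mul_self_sqrt hc.le]
    field_simp
  rw [h2, mul_add] at h1
  refine h1.trans ?_
  have h3 : (Real.sqrt c)⁻¹ * l2norm Ω (fun x => E ‖M.toField uh x‖ (M.toField uh x) +
      M.toField (fun κ => (M.pointGrad Z κ, 0)) x) ≤ _ := hsp
  linarith
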